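/- **Setting.** Fix a universe of small sets, let $\mathbf{Set}$ be the category of small sets, and let "coproducts" mean all small coproducts, including the empty one. For a category $V$, a *$V$-graph* $X$ consists of a set $X_0$ of objects and an object $X(a,b)\in V$ for all $a,b\in X_0$; a morphism $f:X\to Y$ is a function $f:X_0\to Y_0$ with morphisms $X(a,b)\to Y(fa,fb)$. These form a category $\mathcal GV$, with a forgetful functor $(-)_0:\mathcal GV\to\mathbf{Set}$. A functor $H:V\to W$ induces $\mathcal GH:\mathcal GV\to\mathcal GW$ over $\mathbf{Set}$ by acting on homs, and a natural transformation $\phi:H\to K$ induces $\mathcal G\phi:\mathcal GH\to\mathcal GK$. A monad, monad functor, monad opfunctor or natural transformation *over* $\mathbf{Set}$ is one in the 2-category $\mathbf{CAT}/\mathbf{Set}$, i.e. the functors commute strictly with the functors to $\mathbf{Set}$ and the components of the natural transformations are sent to identities. Let $M$ be the free strict monoidal category 2-monad on $\mathbf{CAT}$ (objects of $MV$ are finite sequences of objects of $V$). A *multitensor* $(E,u,\sigma)$ on $V$ is a lax $M$-algebra structure on $V$: a functor $E:MV\to V$ (written $E_i Z_i=E(Z_1,\dots,Z_n)$, $n\ge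 0$) with natural transformations $u_Z:Z\to E(Z)$ and $\sigma: E_iE_jZ_{ij}\to E_{ij}Z_{ij}$ satisfying the unit and associativity laws. It is *distributive* if $E$ preserves coproducts in each variable. If $V$ has coproducts and $E$ is distributive, the monad $\Gamma E$ on $\mathcal GV$ over $\mathbf{Set}$ is given by $(\Gamma E)(X)_0=X_0$ and $$(\Gamma E)(X)(a,b)=\coprod_{a=x_0,\dots,x_n=b}E_i\,X(x_{i-1},x_i)$$ (coproduct over all $n\ge0$ and all such sequences in $X_0$), with unit and multiplication induced by $u$ and $\sigma$. A *lax monoidal functor* $(H,\psi):(V,E)\to(W,F)$ is a functor $H:V\to W$ with natural maps $\psi_Z:F_iHZ_i\to HE_iZ_i$ compatible with units and substitutions; an *oplax monoidal functor* has instead maps $\psi_Z:HE_iZ_i\to F_iHZ_i$. * $\mathrm{DISTMULT}$ is the 2-category whose objects are pairs $(V,E)$, with $V$ a category with coproducts and $E$ a distributive multitensor on $V$, whose 1-cells are lax monoidal functors and whose 2-cells are monoidal natural transformations. * $\mathrm{OpDISTMULT}$ has the same objects; its 1-cells are the oplax monoidal functors $(H,\psi)$ with $H$ preserving coproducts, and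 its 2-cells are the monoidal natural transformations. * $\mathcal G\text{-MND}$ is the 2-category whose objects are pairs $(V,T)$, with $V$ a category with coproducts and $T$ a monad on $\mathcal GV$ over $\mathbf{Set}$. A 1-cell $(V,T)\to(W,S)$ is a pair $(H,\psi)$ with $H:V\to W$ a functor and $\psi:S\,\mathcal GH\to\mathcal GH\,T$ making $(\mathcal GH,\psi)$ a monad functor over $\mathbf{Set}$. A 2-cell $(H,\psi)\to(K,\kappa)$ is a natural transformation $\phi:H\to K$ such that $\mathcal G\phi$ is a monad 2-cell. * $\mathcal G\text{-OpMND}$ has the same objects; a 1-cell is a pair $(H,\psi)$ with $H$ coproduct preserving and $\psi:\mathcal GH\,T\to S\,\mathcal GH$ making $(\mathcal GH,\psi)$ a monad opfunctor over $\mathbf{Set}$; 2-cells are the $\phi:H\to K$ such that $\mathcal G\phi$ is a monad 2-cell. The 2-functor $\Psi:\mathrm{DISTMULT}\to\mathcal G\text{-MND}$ sends $(V,E)$ to $(V,\Gamma E)$, sends $(H,\psi)$ to $(H,\Gamma\psi)$, where the hom maps of $\Gamma\psi$ are the composites $$\coprod_{a=x_0,\dots,x_n=b}F_iHX(x_{i-1},x_i)\xrightarrow{\coprod\psi}\coprod_{a=x_0,\dots,x_n=b}HE_iX(x_{i-1},x_i)\longrightarrow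 H\coprod_{a=x_0,\dots,x_n=b}E_iX(x_{i-1},x_i)$$ with second map the canonical comparison, and is the identity on 2-cells. The 2-functor $\Psi':\mathrm{OpDISTMULT}\to\mathcal G\text{-OpMND}$ is defined in the same way, with $(H,\psi)\mapsto(H,\Gamma'\psi)$, where $\Gamma'\psi$ is the inverse of the comparison (invertible as $H$ preserves coproducts) followed by $\coprod\psi$. **Proposition.** The 2-functors $\Psi$ and $\Psi'$ are 2-fully faithful, i.e. for all objects $A,B$ the induced functors $\mathrm{DISTMULT}(A,B)\to\mathcal G\text{-MND}(\Psi A,\Psi B)$ and $\mathrm{OpDISTMULT}(A,B)\to\mathcal G\text{-OpMND}(\Psi'A,\Psi'B)$ are isomorphisms of categories (full, faithful, and bijective on objects). In particular, for distributive multitensors $(V,E)$ and $(W,F)$ on categories with coproducts and every functor $H:V\to W$, the assignment $\psi\mapsto\Gamma\psi$ is a bijection from the lax monoidal structures on $H:(V,E)\to(W,F)$ to the monad functor structures over $\mathbf{Set}$ on $\mathcal GH:(\mathcal GV,\Gamma E)\to(\mathcal GW,\Gamma F)$; and if $H$ preserves coproducts, $\psi\mapsto\Gamma'\psi$ is a bijection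 from the oplax monoidal structures on $H$ to the monad opfunctor structures over $\mathbf{Set}$ on $\mathcal GH$. -/

import Mathlib

open CategoryTheory CategoryTheory.Limits

universe w v u v' u' v'' u''

namespace EnrichedGraphs

/-! ### Finite sequences: the free strict monoidal category -/

/-- A morphism of `MV`: a sequence of morphisms of `V`. There are no morphisms between sequences
of different lengths. -/
inductive SeqHom {V : Type u} [Category.{v} V] : List V → List V → Type (max u v)
  | nil : SeqHom [] []
  | cons {a b : V} {as bs : List V} (f : a ⟶ b) (fs : SeqHom as bs) : SeqHom (a :: as) (b :: bs)

namespace SeqHom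

variable {V : Type u} [Category.{v} V]

def id : (Z : List V) → SeqHom Z Z
  | [] => nil
  | Z :: Zs => cons (𝟙 Z) (id Zs)

def comp : {X Y Z : List V} → SeqHom X Y → SeqHom Y Z → SeqHom X Z
  | _, _, _, nil, nil => nil
  | _, _, _, cons f fs, cons g gs => cons (f ≫ g) (comp fs gs)

theorem id_comp : {X Y : List V} → (f : SeqHom X Y) → (id X).comp f = f
  | _, _, nil => rfl
  | _, _, cons f fs => congrArg₂ cons (Category.id_comp f) (id_comp fs)

theorem comp_id : {X Y : List V} → (f : SeqHom X Y) → f.comp (id Y) = f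
  | _, _, nil => rfl
  | _, _, cons f fs => congrArg₂ cons (Category.comp_id f) (comp_id fs)

theorem assoc : {W X Y Z : List V} → (f : SeqHom W X) → (g : SeqHom X Y) → (h : SeqHom Y Z) →
    (f.comp g).comp h = f.comp (g.comp h)
  | _, _, _, _, nil, nil, nil => rfl
  | _, _, _, _, cons f fs, cons g gs, cons h hs =>
    congrArg₂ cons (Category.assoc f g h) (assoc fs gs hs)

end SeqHom

/-- The free strict monoidal category `MV`: its objects are the finite sequences of objects
of `V`. -/
instance seqCategory {V : Type u} [Category.{v} V] : Category.{max u v} (List V) where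
  Hom := SeqHom
  id := SeqHom.id
  comp := SeqHom.comp
  id_comp := SeqHom.id_comp
  comp_id := SeqHom.comp_id
  assoc := SeqHom.assoc

section Sequences

variable {V : Type u} [Category.{v} V] {W : Type u'} [Category.{v'} W]

def consHom {a b : V} {as bs : List V} (f : a ⟶ b) (fs : as ⟶ bs) : (a :: as) ⟶ (b :: bs) :=
  SeqHom.cons f fs

@[simp] lemma consHom_comp {a b c : V} {as bs cs : List V} (f : a ⟶ b) (fs : as ⟶ bs)
    (g : b ⟶ c) (gs : bs ⟶ cs) :
    consHom f fs ≫ consHom g gs = consHom (f ≫ g) (fs ≫ gs) := rfl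

@[simp] lemma consHom_id (a : V) (as : List V) : consHom (𝟙 a) (𝟙 as) = 𝟙 (a :: as) := rfl

theorem seqHom_induction {P : ∀ {X Y : List V}, (X ⟶ Y) → Prop} (nil : P (𝟙 ([] : List V)))
    (cons : ∀ {a b : V} {as bs : List V} (f : a ⟶ b) (fs : as ⟶ bs), P fs → P (consHom f fs)) :
    {X Y : List V} → (f : X ⟶ Y) → P f
  | _, _, SeqHom.nil => nil
  | _, _, SeqHom.cons f fs => cons f fs (seqHom_induction nil cons fs)

lemma consHom_eqToHom {a b : V} {as bs : List V} (h : a = b) (hs : as = bs) :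
    consHom (eqToHom h) (eqToHom hs) = eqToHom (by rw [h, hs]) := by
  subst h hs; rfl

def appendHom : {X X' Y Y' : List V} → (X ⟶ X') → (Y ⟶ Y') → (X ++ Y ⟶ X' ++ Y')
  | _, _, _, _, SeqHom.nil, g => g
  | _, _, _, _, SeqHom.cons f fs, g => consHom f (appendHom fs g)

@[simp] lemma appendHom_nil {Y Y' : List V} (g : Y ⟶ Y') : appendHom (𝟙 []) g = g := rfl

@[simp] lemma appendHom_cons {a b : V} {as bs Y Y' : List V} (f : a ⟶ b) (fs : as ⟶ bs)
    (g : Y ⟶ Y') : appendHom (consHom f fs) g = consHom f (appendHom fs g) := rfl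

lemma appendHom_id (X Y : List V) : appendHom (𝟙 X) (𝟙 Y) = 𝟙 (X ++ Y) := by
  induction X with
  | nil => rfl
  | cons a as ih => exact (congrArg (consHom (𝟙 a)) ih)

theorem appendHom_comp : {X X' X'' Y Y' Y'' : List V} → (f : X ⟶ X') → (f' : X' ⟶ X'') →
    (g : Y ⟶ Y') → (g' : Y' ⟶ Y'') →
    appendHom f g ≫ appendHom f' g' = appendHom (f ≫ f') (g ≫ g')
  | _, _, _, _, _, _, SeqHom.nil, SeqHom.nil, _, _ => rfl
  | _, _, _, _, _, _, SeqHom.cons f fs, SeqHom.cons f' fs', g, g' =>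
    congrArg (consHom (f ≫ f')) (appendHom_comp fs fs' g g')

/-- The multiplication `M²V ⟶ MV` on morphisms (concatenation). -/
def flattenHom : {X Y : List (List V)} → (X ⟶ Y) → (X.flatten ⟶ Y.flatten)
  | _, _, SeqHom.nil => 𝟙 _
  | _, _, SeqHom.cons f fs => appendHom f (flattenHom fs)

@[simp] lemma flattenHom_cons {a b : List V} {as bs : List (List V)} (f : a ⟶ b) (fs : as ⟶ bs) :
    flattenHom (consHom f fs) = appendHom f (flattenHom fs) := rfl

/-- `MF` on morphisms, for a functor `F`. -/
def mapHom (F : V ⥤ W) : {X Y : List V} → (X ⟶ Y) → (X.map F.obj ⟶ Y.map F.obj)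
  | _, _, SeqHom.nil => 𝟙 _
  | _, _, SeqHom.cons f fs => consHom (F.map f) (mapHom F fs)

@[simp] lemma mapHom_cons (F : V ⥤ W) {a b : V} {as bs : List V} (f : a ⟶ b) (fs : as ⟶ bs) :
    mapHom F (consHom f fs) = consHom (F.map f) (mapHom F fs) := rfl

theorem mapHom_comp (F : V ⥤ W) : {X Y Z : List V} → (f : X ⟶ Y) → (g : Y ⟶ Z) →
    mapHom F (f ≫ g) = mapHom F f ≫ mapHom F g
  | _, _, _, SeqHom.nil, SeqHom.nil => rfl
  | _, _, _, SeqHom.cons f fs, SeqHom.cons g gs =>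
    congrArg₂ consHom (F.map_comp f g) (mapHom_comp F fs gs)

/-- The sequence of morphisms `f a ⟶ g a`, for `a` in a list. -/
def seqOf {A : Type*} {f g : A → V} (h : ∀ a, f a ⟶ g a) : (l : List A) → (l.map f ⟶ l.map g)
  | [] => 𝟙 _
  | a :: l => consHom (h a) (seqOf h l)

/-- The sequence of morphisms `f' (f a) ⟶ g' (g a)`, for `a` in a list. -/
def seqOf₂ {A B C : Type*} {f : A → B} {f' : B → V} {g : A → C} {g' : C → V}
    (h : ∀ a, f' (f a) ⟶ g' (g a)) : (l : List A) → ((l.map f).map f' ⟶ (l.map g).map g')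
  | [] => 𝟙 _
  | a :: l => consHom (h a) (seqOf₂ h l)

/-- The sequence of morphisms `a ⟶ g' (g a)`, for `a` in a list. -/
def seqOf' {B : Type*} {g : V → B} {g' : B → V} (h : ∀ a, a ⟶ g' (g a)) :
    (l : List V) → (l ⟶ (l.map g).map g')
  | [] => 𝟙 _
  | a :: l => consHom (h a) (seqOf' h l)

lemma map_flatten_eq {A B : Type*} (f : A → B) (Z : List (List A)) :
    (Z.map (List.map f)).flatten = Z.flatten.map f := by
  rw [List.map_flatten]

lemma flatten_map_singleton_eq {A : Type*} (Z : List A) : (Z.map (fun a => [a])).flatten = Z := by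
  induction Z with
  | nil => rfl
  | cons a as ih => simp [ih]

/-- The functor `V ⥤ MV` which places its variable between the sequences `P` and `Q`. -/
@[simps] def insertFunctor (P Q : List V) : V ⥤ List V where
  obj Z := P ++ Z :: Q
  map f := appendHom (𝟙 P) (consHom f (𝟙 Q))
  map_id Z := by rw [consHom_id, appendHom_id]
  map_comp f g := by rw [appendHom_comp]; simp

end Sequences

/-! ### Multitensors -/

/-- A multitensor on `V`, i.e. a lax monoidal structure `(E, u, σ)`: a lax algebra structure for
the 2-monad `M`. -/
structure Multitensor (V : Type u) [Category.{v} V] where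
  E : List V ⥤ V
  u : ∀ Z : V, Z ⟶ E.obj [Z]
  u_natural : ∀ {Z Z' : V} (f : Z ⟶ Z'), f ≫ u Z' = u Z ≫ E.map (consHom f (𝟙 []))
  σ : ∀ Z : List (List V), E.obj (Z.map E.obj) ⟶ E.obj Z.flatten
  σ_natural : ∀ {Z Z' : List (List V)} (f : Z ⟶ Z'),
    E.map (mapHom E f) ≫ σ Z' = σ Z ≫ E.map (flattenHom f)
  unit_left : ∀ Z : List V,
    u (E.obj Z) ≫ σ [Z] = E.map (eqToHom (by simp : Z = [Z].flatten))
  unit_right : ∀ Z : List V,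
    E.map (seqOf' u Z) ≫ σ (Z.map (fun z => [z])) =
      E.map (eqToHom (flatten_map_singleton_eq Z).symm)
  assoc : ∀ Z : List (List (List V)),
    σ (Z.map (List.map E.obj)) ≫ E.map (eqToHom (map_flatten_eq E.obj Z)) ≫ σ Z.flatten =
      E.map (seqOf₂ σ Z) ≫ σ (Z.map List.flatten) ≫ E.map (eqToHom List.flatten_flatten.symm)

/-- A functor `MV ⥤ D` preserves (small) coproducts in each variable. -/
def DistributiveFunctor {V : Type u} [Category.{v} V] {D : Type u'} [Category.{v'} D]
    (G : List V ⥤ D) : Prop :=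
  ∀ (P Q : List V) (J : Type w), PreservesColimitsOfShape (Discrete J) (insertFunctor P Q ⋙ G)

def Multitensor.Distributive {V : Type u} [Category.{v} V] (E : Multitensor V) : Prop :=
  DistributiveFunctor.{w} E.E

/-! ### Enriched graphs -/

/-- A graph enriched in `V`. -/
structure EGraph (V : Type u) where
  obj : Type w
  hom : obj → obj → V

/-- A morphism of enriched graphs. -/
structure EGraph.Hom {V : Type u} [Category.{v} V] (X Y : EGraph.{w} V) where
  obj : X.obj → Y.obj
  hom : ∀ a b, X.hom a b ⟶ Y.hom (obj a) (obj b)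

@[simps] instance EGraph.category {V : Type u} [Category.{v} V] : Category (EGraph.{w} V) where
  Hom := EGraph.Hom
  id X := ⟨fun a => a, fun a b => 𝟙 (X.hom a b)⟩
  comp f g := ⟨fun a => g.obj (f.obj a), fun a b => f.hom a b ≫ g.hom (f.obj a) (f.obj b)⟩
  id_comp := by simp
  comp_id := by simp
  assoc := by simp

section Graphs

variable {V : Type u} [Category.{v} V] {W : Type u'} [Category.{v'} W]
  {U : Type u''} [Category.{v''} U]

lemma EGraph.hom_ext {X Y : EGraph.{w} V} {o : X.obj → Y.obj}
    {m m' : ∀ a b, X.hom a b ⟶ Y.hom (o a) (o b)} (h : ∀ a b, m a b = m' a b) :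
    (EGraph.Hom.mk o m : X ⟶ Y) = EGraph.Hom.mk o m' := by
  obtain rfl : m = m' := by funext a b; exact h a b
  rfl

/-- The forgetful functor `(-)₀` sending an enriched graph to its set of objects. -/
@[simps] def EGraph.ob (V : Type u) [Category.{v} V] : EGraph.{w} V ⥤ Type w where
  obj X := X.obj
  map f := TypeCat.ofHom f.obj

/-- The functor `𝒢H : 𝒢V ⥤ 𝒢W`. -/
@[simps] def EGraph.map (H : V ⥤ W) : EGraph.{w} V ⥤ EGraph.{w} W where
  obj X := ⟨X.obj, fun a b => H.obj (X.hom a b)⟩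
  map f := ⟨f.obj, fun a b => H.map (f.hom a b)⟩
  map_id _ := EGraph.hom_ext fun _ _ => H.map_id _
  map_comp _ _ := EGraph.hom_ext fun _ _ => H.map_comp _ _

/-- The natural transformation `𝒢φ`. -/
@[simps] def EGraph.mapNat {H K : V ⥤ W} (φ : H ⟶ K) :
    EGraph.map.{w} H ⟶ EGraph.map.{w} K where
  app X := ⟨fun a => a, fun a b => φ.app (X.hom a b)⟩
  naturality _ _ _ := EGraph.hom_ext fun _ _ => φ.naturality _

lemma EGraph.map_over (H : V ⥤ W) : EGraph.map.{w} H ⋙ EGraph.ob W = EGraph.ob V := rfl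

end Graphs

/-! ### Sequences of objects of a graph -/

/-- `ObjSeq a b` is the set of finite sequences `a = x₀, ..., xₙ = b` with `n ≥ 0`. -/
inductive ObjSeq {S : Type w} : S → S → Type w
  | nil (a : S) : ObjSeq a a
  | cons (a : S) {b c : S} (p : ObjSeq b c) : ObjSeq a c

namespace ObjSeq

variable {S T : Type w}

/-- The sequence `a, b`. -/
def single (a b : S) : ObjSeq a b := cons a (nil b)

/-- Concatenation, identifying the last object of the first sequence with the first object of
the second one. -/
def comp : {a b c : S} → ObjSeq a b → ObjSeq b c → ObjSeq a c
  | _, _, _, nil _, q => q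
  | _, _, _, cons a p, q => cons a (p.comp q)

def map (f : S → T) : {a b : S} → ObjSeq a b → ObjSeq (f a) (f b)
  | _, _, nil a => nil (f a)
  | _, _, cons a p => cons (f a) (p.map f)

/-- The sequence `C x₀ x₁, ..., C xₙ₋₁ xₙ`. -/
def homs {A : Type*} (C : S → S → A) : {a b : S} → ObjSeq a b → List A
  | _, _, nil _ => []
  | _, _, cons a (b := b) p => C a b :: p.homs C

/-- For a sequence `x₀, ..., xₙ`, the set of sequences of elements of
`J x₀ x₁, ..., J xₙ₋₁ xₙ`. -/
def Choice (J : S → S → Type w) : {a b : S} → ObjSeq a b → Type w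
  | _, _, nil _ => PUnit
  | _, _, cons a (b := b) p => J a b × p.Choice J

/-- The list of values of a function on the entries of a sequence. -/
def Choice.list {J : S → S → Type w} {A : Type*} (g : ∀ a b, J a b → A) :
    {a b : S} → (p : ObjSeq a b) → p.Choice J → List A
  | _, _, nil _, _ => []
  | _, _, cons _ p, c => g _ _ c.1 :: Choice.list g p c.2

lemma map_id : ∀ {a b : S} (p : ObjSeq a b), p.map (fun x => x) = p
  | _, _, nil a => rfl
  | _, _, cons a p => congrArg (cons a) (map_id p)

lemma map_map {R : Type w} (f : S → T) (g : T → R) : ∀ {a b : S} (p : ObjSeq a b),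
    (p.map f).map g = p.map (fun x => g (f x))
  | _, _, nil a => rfl
  | _, _, cons a p => congrArg (cons (g (f a))) (map_map f g p)

lemma homs_comp {A : Type*} (C : S → S → A) : ∀ {a b c : S} (p : ObjSeq a b) (q : ObjSeq b c),
    (p.comp q).homs C = p.homs C ++ q.homs C
  | _, _, _, nil _, q => rfl
  | _, _, _, cons a p, q => congrArg (List.cons _) (homs_comp C p q)

lemma comp_nil : ∀ {a b : S} (p : ObjSeq a b), p.comp (nil b) = p
  | _, _, nil a => rfl
  | _, _, cons a p => congrArg (cons a) (comp_nil p)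

lemma comp_assoc : ∀ {a b c d : S} (p : ObjSeq a b) (q : ObjSeq b c) (r : ObjSeq c d),
    (p.comp q).comp r = p.comp (q.comp r)
  | _, _, _, _, nil a, _, _ => rfl
  | _, _, _, _, cons a p, q, r => congrArg (cons a) (comp_assoc p q r)

lemma homs_map {A B : Type*} (C : S → S → A) (f : A → B) : ∀ {a b : S} (p : ObjSeq a b),
    p.homs (fun x y => f (C x y)) = (p.homs C).map f
  | _, _, nil _ => rfl
  | _, _, cons a p => congrArg (List.cons _) (homs_map C f p)

lemma map_comp (f : S → T) : ∀ {a b c : S} (p : ObjSeq a b) (q : ObjSeq b c),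
    (p.comp q).map f = (p.map f).comp (q.map f)
  | _, _, _, nil _, q => rfl
  | _, _, _, cons a p, q => congrArg (cons (f a)) (map_comp f p q)

/-- Doubly-nested sequences over the sequence `p = (x₀, ..., xₙ)`: a sequence from `xᵢ₋₁` to `xᵢ`
for each `i`. -/
abbrev Nested {a b : S} (p : ObjSeq a b) : Type w := p.Choice (fun a b => ObjSeq a b)

/-- The concatenation of a doubly-nested sequence. -/
def flat : {a b : S} → (p : ObjSeq a b) → p.Nested → ObjSeq a b
  | _, _, nil a, _ => nil a
  | _, _, cons _ p, c => c.1.comp (p.flat c.2)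

/-- The list of lists of homs associated with a doubly-nested sequence. -/
def nestedHoms {A : Type*} (C : S → S → A) {a b : S} (p : ObjSeq a b) (c : p.Nested) :
    List (List A) :=
  Choice.list (fun _ _ q => q.homs C) p c

lemma flatten_nestedHoms {A : Type*} (C : S → S → A) : ∀ {a b : S} (p : ObjSeq a b)
    (c : p.Nested), (p.nestedHoms C c).flatten = (p.flat c).homs C
  | _, _, nil _, _ => rfl
  | _, _, cons _ p, c => by
    have := flatten_nestedHoms C p c.2
    simp only [nestedHoms] at this
    simp only [nestedHoms, Choice.list, flat, homs_comp, List.flatten_cons, this]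

end ObjSeq

section Coproducts

variable {C : Type u} [Category.{v} C] {D : Type u'} [Category.{v'} D]

/-- The morphisms `i j` exhibit `P` as a coproduct of the `F j`. -/
def IsCoprod {J : Type w} {F : J → C} {P : C} (i : ∀ j, F j ⟶ P) : Prop :=
  ∀ ⦃T : C⦄ (k : ∀ j, F j ⟶ T), ∃! m : P ⟶ T, ∀ j, i j ≫ m = k j

namespace IsCoprod

variable {J : Type w} {F : J → C} {P : C} {i : ∀ j, F j ⟶ P}

noncomputable def desc (h : IsCoprod i) {T : C} (k : ∀ j, F j ⟶ T) : P ⟶ T := (h k).choose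

lemma fac (h : IsCoprod i) {T : C} (k : ∀ j, F j ⟶ T) (j : J) : i j ≫ h.desc k = k j :=
  (h k).choose_spec.1 j

lemma hom_ext (h : IsCoprod i) {T : C} {m m' : P ⟶ T} (e : ∀ j, i j ≫ m = i j ≫ m') : m = m' :=
  (h (fun j => i j ≫ m')).unique e (fun _ => rfl)

lemma of_isColimit (h : IsColimit (Cofan.mk P i)) : IsCoprod i := fun _ k =>
  ⟨Cofan.IsColimit.desc h k, fun j => Cofan.IsColimit.fac h k j, fun m hm =>
    Cofan.IsColimit.hom_ext h _ _ fun j => (hm j).trans (Cofan.IsColimit.fac h k j).symm⟩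

noncomputable def isColimit (h : IsCoprod i) : IsColimit (Cofan.mk P i) :=
  Cofan.IsColimit.mk _ (fun s => h.desc s.inj) (fun s j => h.fac s.inj j)
    (fun s m hm => h.hom_ext fun j => (hm j).trans (h.fac s.inj j).symm)

lemma sigma (F : J → C) [HasCoproduct F] : IsCoprod (fun j => Sigma.ι F j) :=
  of_isColimit (coproductIsCoproduct F)

lemma map (h : IsCoprod i) (G : C ⥤ D) (_ : PreservesColimitsOfShape (Discrete J) G) :
    IsCoprod (fun j => G.map (i j)) :=
  of_isColimit (isColimitCofanMkObjOfIsColimit G _ _ h.isColimit)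

end IsCoprod

end Coproducts

section Choice

open ObjSeq

variable {S : Type w} {V : Type u} [Category.{v} V] {D : Type u'} [Category.{v'} D]

/-- The sequence of morphisms induced by `i`, on the entries of `c`. -/
def choiceHom {A : Type*} {J : S → S → Type w} {g : ∀ a b, J a b → A} {f : A → V}
    {C : S → S → V} (i : ∀ a b (j : J a b), f (g a b j) ⟶ C a b) :
    {a b : S} → (p : ObjSeq a b) → (c : p.Choice J) → ((Choice.list g p c).map f ⟶ p.homs C)
  | _, _, nil _, _ => 𝟙 _
  | _, _, cons _ p, c => consHom (i _ _ c.1) (choiceHom i p c.2)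

/-- The functor `MV ⥤ MV` which adjoins `Z` to a sequence. -/
@[simps] def consFunctor (Z : V) : List V ⥤ List V where
  obj X := Z :: X
  map f := consHom (𝟙 Z) f
  map_id _ := rfl
  map_comp f g := by simp

lemma DistributiveFunctor.cons {G : List V ⥤ D} (hG : DistributiveFunctor.{w} G) (Z : V) :
    DistributiveFunctor.{w} (consFunctor Z ⋙ G) := by
  intro P Q J
  have := hG (Z :: P) Q J
  have e : insertFunctor (Z :: P) Q ⋙ G = insertFunctor P Q ⋙ consFunctor Z ⋙ G := rfl
  exact e ▸ this

/-- If `G` preserves coproducts in each variable and each `C a b` is the coproduct of the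
`f (g j)`, then `G` applied to `C x₀ x₁, ..., C xₙ₋₁ xₙ` is the coproduct of the values of `G` at
all the sequences of summands. -/
theorem choice_isCoprod {A : Type*} {J : S → S → Type w} {g : ∀ a b, J a b → A}
    {f : A → V} {C : S → S → V} (i : ∀ a b (j : J a b), f (g a b j) ⟶ C a b)
    (hi : ∀ a b, IsCoprod (i a b)) :
    ∀ {a b : S} (p : ObjSeq a b) (G : List V ⥤ D) (_ : DistributiveFunctor.{w} G),
      IsCoprod (fun c : p.Choice J => G.map (choiceHom i p c))
  | _, _, nil _, G, _ => fun T k => by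
    have e : ∀ m : G.obj [] ⟶ T, G.map (𝟙 []) ≫ m = m := fun m => by
      rw [G.map_id, Category.id_comp]
    exact ⟨k PUnit.unit, fun _ => e _, fun m hm => (e m).symm.trans (hm PUnit.unit)⟩
  | a, _, cons _ (b := b) p, G, hG => fun T k => by
    have h1 : IsCoprod (fun j : J a b => G.map (consHom (i a b j) (𝟙 (p.homs C)))) :=
      (hi a b).map (insertFunctor [] (p.homs C) ⋙ G) (hG [] (p.homs C) (J a b))
    have h2 : ∀ j : J a b, IsCoprod (fun c : p.Choice J =>
        G.map (consHom (𝟙 (f (g a b j))) (choiceHom i p c))) := fun j =>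
      choice_isCoprod i hi p (consFunctor (f (g a b j)) ⋙ G) (hG.cons _)
    have key : ∀ (j : J a b) (c : p.Choice J),
        G.map (choiceHom i (ObjSeq.cons a p) (j, c)) =
          G.map (consHom (𝟙 (f (g a b j))) (choiceHom i p c)) ≫
            G.map (consHom (i a b j) (𝟙 (p.homs C))) := by
      intro j c
      rw [← G.map_comp, consHom_comp, Category.id_comp, Category.comp_id]
      rfl
    refine ⟨h1.desc fun j => (h2 j).desc fun c => k (j, c), fun c => ?_, fun m hm => ?_⟩
    · refine (congrArg (· ≫ _) (key c.1 c.2)).trans ?_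
      refine (Category.assoc _ _ _).trans ?_
      refine (congrArg (_ ≫ ·) (h1.fac _ _)).trans ?_
      exact (h2 c.1).fac (fun c' => k (c.1, c')) c.2
    · refine h1.hom_ext fun j => (h2 j).hom_ext fun c => ?_
      refine (Category.assoc _ _ _).symm.trans ?_
      refine (congrArg (· ≫ m) (key j c).symm).trans ?_
      refine (hm (j, c)).trans ?_
      refine Eq.symm ((congrArg (_ ≫ ·) (h1.fac _ _)).trans ?_)
      exact (h2 j).fac (fun c' => k (j, c')) c

end Choice

open ObjSeq

/-! ### The monad `ΓE` -/

section HEqLemmas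

variable {V : Type u} [Category.{v} V]

lemma consHom_heq {a b : V} {as as' bs bs' : List V} (f : a ⟶ b) {fs : as ⟶ bs}
    {fs' : as' ⟶ bs'} (h : as = as') (h' : bs = bs') (e : HEq fs fs') :
    HEq (consHom f fs) (consHom f fs') := by
  subst h h' e; rfl

lemma appendHom_heq {a b as as' bs bs' : List V} (f : a ⟶ b) {fs : as ⟶ bs}
    {fs' : as' ⟶ bs'} (h : as = as') (h' : bs = bs') (e : HEq fs fs') :
    HEq (appendHom f fs) (appendHom f fs') := by
  subst h h' e; rfl

lemma comp_eqToHom_of_heq {C : Type u'} [Category.{v'} C] {X X' Y Y' : C} {f : X ⟶ Y}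
    {g : X' ⟶ Y'} (h : X = X') (h' : Y = Y') (e : HEq f g) :
    f ≫ eqToHom h' = eqToHom h ≫ g := by
  subst h h' e; simp

end HEqLemmas

section IdHoms

variable {V : Type u} [Category.{v} V] {S : Type w}

/-- The sequence of morphisms `C xᵢ₋₁ xᵢ ⟶ C' xᵢ₋₁ xᵢ`. -/
def idHoms {C C' : S → S → V} (m : ∀ a b, C a b ⟶ C' a b) :
    {a b : S} → (p : ObjSeq a b) → (p.homs C ⟶ p.homs C')
  | _, _, nil _ => 𝟙 _
  | _, _, cons _ p => consHom (m _ _) (idHoms m p)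

/-- The sequence of hom maps `C xᵢ₋₁ xᵢ ⟶ C' (f xᵢ₋₁) (f xᵢ)` of a morphism of graphs. -/
def homsHom {C : S → S → V} {T : Type w} {C' : T → T → V} {f : S → T}
    (m : ∀ a b, C a b ⟶ C' (f a) (f b)) :
    {a b : S} → (p : ObjSeq a b) → (p.homs C ⟶ (p.map f).homs C')
  | _, _, nil _ => 𝟙 _
  | _, _, cons _ p => consHom (m _ _) (homsHom m p)

lemma homsHom_heq_idHoms {C C' : S → S → V} (m : ∀ a b, C a b ⟶ C' a b) :
    {a b : S} → (p : ObjSeq a b) → HEq (homsHom (f := fun x => x) m p) (idHoms m p)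
  | _, _, nil _ => HEq.rfl
  | _, _, cons _ p => consHom_heq _ rfl (by rw [ObjSeq.map_id]) (homsHom_heq_idHoms m p)

lemma idHoms_id (C : S → S → V) : {a b : S} → (p : ObjSeq a b) →
    idHoms (fun a b => 𝟙 (C a b)) p = 𝟙 (p.homs C)
  | _, _, nil _ => rfl
  | _, _, cons _ p => congrArg (consHom (𝟙 _)) (idHoms_id C p)

lemma idHoms_comp {C C' C'' : S → S → V} (m : ∀ a b, C a b ⟶ C' a b)
    (m' : ∀ a b, C' a b ⟶ C'' a b) : {a b : S} → (p : ObjSeq a b) →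
    idHoms (fun a b => m a b ≫ m' a b) p = idHoms m p ≫ idHoms m' p
  | _, _, nil _ => rfl
  | _, _, cons _ p => congrArg (consHom (m _ _ ≫ m' _ _)) (idHoms_comp m m' p)

variable {T R : Type w} {C : S → S → V} {C' : T → T → V} {C'' : R → R → V} {f : S → T}
  {g : T → R}

lemma homsHom_comp_heq (m : ∀ a b, C a b ⟶ C' (f a) (f b))
    (m' : ∀ a b, C' a b ⟶ C'' (g a) (g b)) : {a b : S} → (p : ObjSeq a b) →
      HEq (homsHom (f := fun x => g (f x)) (fun a b => m a b ≫ m' (f a) (f b)) p)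
        (homsHom m p ≫ homsHom m' (p.map f))
  | _, _, nil _ => HEq.rfl
  | _, _, cons _ p => consHom_heq (m _ _ ≫ m' _ _) rfl
      (by rw [ObjSeq.map_map]) (homsHom_comp_heq m m' p)

lemma homsHom_append_heq (m : ∀ a b, C a b ⟶ C' (f a) (f b)) :
    {a b c : S} → (p : ObjSeq a b) → (q : ObjSeq b c) →
      HEq (homsHom m (p.comp q)) (appendHom (homsHom m p) (homsHom m q))
  | _, _, _, nil _, _ => HEq.rfl
  | _, _, _, cons _ p, q => consHom_heq (m _ _) (homs_comp _ _ _)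
      (by rw [ObjSeq.map_comp, homs_comp]; rfl) (homsHom_append_heq m p q)

end IdHoms

namespace Multitensor

lemma σ_cast {V : Type u} [Category.{v} V] (E : Multitensor V) {Z Z' : List (List V)} (h : Z = Z') (h' : Z.map E.E.obj = Z'.map E.E.obj) :
    E.E.map (eqToHom h') ≫ E.σ Z' = E.σ Z ≫ E.E.map (eqToHom (by rw [h])) := by
  subst h; simp

variable {V : Type u} [Category.{v} V] [HasCoproducts.{w} V] (E : Multitensor V)

section Homs

variable {S T R : Type w}

/-- The homs of the graph `ΓE(X)`, where `X` is the graph with object set `S` and homs `C`: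
`ΓE(X)(a,b) = ∐_{a = x₀, ..., xₙ = b} E(X(x₀,x₁), ..., X(xₙ₋₁,xₙ))`. -/
noncomputable def gammaHom (C : S → S → V) (a b : S) : V :=
  ∐ fun p : ObjSeq a b => E.E.obj (p.homs C)

/-- The coproduct inclusions of the homs of `ΓE(X)`. -/
noncomputable def incl (C : S → S → V) {a b : S} (p : ObjSeq a b) :
    E.E.obj (p.homs C) ⟶ E.gammaHom C a b :=
  Sigma.ι (fun p : ObjSeq a b => E.E.obj (p.homs C)) p

lemma incl_isCoprod (C : S → S → V) (a b : S) :
    IsCoprod (fun p : ObjSeq a b => E.incl C p) := IsCoprod.sigma _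

/-- The coproduct inclusion, on a sequence which is equal to the sequence of homs of `p`. -/
noncomputable def incl' (C : S → S → V) {a b : S} (Z : List V) (p : ObjSeq a b)
    (h : Z = p.homs C) : E.E.obj Z ⟶ E.gammaHom C a b :=
  E.E.map (eqToHom h) ≫ E.incl C p

lemma incl'_self (C : S → S → V) {a b : S} (p : ObjSeq a b) :
    E.incl' C _ p rfl = E.incl C p := by simp [incl']

lemma map_incl (C : S → S → V) {a b : S} {Z : List V} {p : ObjSeq a b}
    (h : Z = p.homs C) : E.E.map (eqToHom h) ≫ E.incl C p = E.incl' C Z p h := rfl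

lemma map_incl' (C : S → S → V) {a b : S} {Z Z' : List V} {p : ObjSeq a b}
    (h : Z = Z') (h' : Z' = p.homs C) :
    E.E.map (eqToHom h) ≫ E.incl' C Z' p h' = E.incl' C Z p (by rw [h, h']) := by
  subst h; simp

lemma incl'_congr (C : S → S → V) {a b : S} {Z : List V} {p p' : ObjSeq a b}
    (e : p = p') (h : Z = p.homs C) (h' : Z = p'.homs C) : E.incl' C Z p h = E.incl' C Z p' h' := by
  subst e; rfl

/-- The hom maps of the morphism of graphs induced by a morphism of graphs with object
function `f` and hom maps `m`. -/
noncomputable def gammaMap {C : S → S → V} {C' : T → T → V} {f : S → T}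
    (m : ∀ a b, C a b ⟶ C' (f a) (f b)) (a b : S) :
    E.gammaHom C a b ⟶ E.gammaHom C' (f a) (f b) :=
  Sigma.desc fun p => E.E.map (homsHom m p) ≫ E.incl C' (p.map f)

variable {C : S → S → V} {C' : T → T → V} {C'' : R → R → V} {f : S → T} {g : T → R}

lemma incl_gammaMap (m : ∀ a b, C a b ⟶ C' (f a) (f b)) {a b : S} (p : ObjSeq a b) :
    E.incl C p ≫ E.gammaMap m a b = E.E.map (homsHom m p) ≫ E.incl C' (p.map f) :=
  Sigma.ι_desc _ _

lemma incl_gammaMap_id {C C' : S → S → V} (m : ∀ a b, C a b ⟶ C' a b) {a b : S}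
    (p : ObjSeq a b) :
    E.incl C p ≫ E.gammaMap (f := fun x => x) m a b =
      E.E.map (idHoms m p) ≫ E.incl C' p := by
  rw [incl_gammaMap]
  have h := comp_eqToHom_of_heq rfl (by rw [ObjSeq.map_id]) (homsHom_heq_idHoms m p)
  rw [eqToHom_refl, Category.id_comp] at h
  rw [← h, E.E.map_comp, Category.assoc, map_incl,
    E.incl'_congr C' (ObjSeq.map_id p).symm _ rfl, incl'_self]

lemma gammaMap_id (C : S → S → V) (a b : S) :
    E.gammaMap (f := fun x => x) (fun a b => 𝟙 (C a b)) a b = 𝟙 (E.gammaHom C a b) :=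
  (E.incl_isCoprod C a b).hom_ext fun p => by
    rw [incl_gammaMap_id, idHoms_id, E.E.map_id, Category.id_comp, Category.comp_id]

lemma gammaMap_comp (m : ∀ a b, C a b ⟶ C' (f a) (f b))
    (m' : ∀ a b, C' a b ⟶ C'' (g a) (g b)) (a b : S) :
    E.gammaMap (f := fun x => g (f x)) (fun a b => m a b ≫ m' (f a) (f b)) a b =
      E.gammaMap m a b ≫ E.gammaMap m' (f a) (f b) :=
  (E.incl_isCoprod C a b).hom_ext fun p => by
    have h := comp_eqToHom_of_heq rfl (by rw [ObjSeq.map_map]) (homsHom_comp_heq m m' p)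
    rw [eqToHom_refl, Category.id_comp] at h
    rw [incl_gammaMap, ← Category.assoc, incl_gammaMap, Category.assoc, incl_gammaMap,
      ← Category.assoc, ← E.E.map_comp, ← h, E.E.map_comp, Category.assoc, map_incl,
      E.incl'_congr C'' (ObjSeq.map_map f g p) _ rfl, incl'_self]

end Homs

end Multitensor

open ObjSeq

section ChoiceLemmas

variable {S T : Type w}

namespace ObjSeq

def Choice.map {J J' : S → S → Type w} (t : ∀ a b, J a b → J' a b) :
    {a b : S} → (p : ObjSeq a b) → p.Choice J → p.Choice J'
  | _, _, nil _, c => c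
  | _, _, cons _ p, c => (t _ _ c.1, Choice.map t p c.2)

lemma Choice.list_map {J J' : S → S → Type w} {A : Type*} (t : ∀ a b, J a b → J' a b)
    (g : ∀ a b, J' a b → A) : {a b : S} → (p : ObjSeq a b) → (c : p.Choice J) →
      Choice.list g p (Choice.map t p c) = Choice.list (fun a b j => g a b (t a b j)) p c
  | _, _, nil _, _ => rfl
  | _, _, cons _ p, c => congrArg (List.cons _) (Choice.list_map t g p c.2)

lemma Choice.list_comp {J : S → S → Type w} {A B : Type*} (h : A → B)
    (g : ∀ a b, J a b → A) : {a b : S} → (p : ObjSeq a b) → (c : p.Choice J) →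
      Choice.list (fun a b j => h (g a b j)) p c = (Choice.list g p c).map h
  | _, _, nil _, _ => rfl
  | _, _, cons _ p, c => congrArg (List.cons _) (Choice.list_comp h g p c.2)

/-- The image of a doubly-nested sequence under a function. -/
def Nested.map (f : S → T) : {a b : S} → (p : ObjSeq a b) → p.Nested → (p.map f).Nested
  | _, _, nil _, c => c
  | _, _, cons _ p, c => (c.1.map f, Nested.map f p c.2)

lemma flat_map (f : S → T) : {a b : S} → (p : ObjSeq a b) → (c : p.Nested) →
    (p.map f).flat (Nested.map f p c) = (p.flat c).map f
  | _, _, nil _, _ => rfl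
  | _, _, cons _ p, c => by
    rw [flat, ObjSeq.map_comp, ← flat_map f p c.2]; rfl

/-- The concatenation of doubly-nested sequences. -/
def Nested.comp : {a b c : S} → (p : ObjSeq a b) → (q : ObjSeq b c) → p.Nested → q.Nested →
    (p.comp q).Nested
  | _, _, _, nil _, _, _, d => d
  | _, _, _, cons _ p, q, c, d => (c.1, Nested.comp p q c.2 d)

lemma nestedHoms_comp {A : Type*} (C : S → S → A) : {a b c : S} → (p : ObjSeq a b) →
    (q : ObjSeq b c) → (x : p.Nested) → (y : q.Nested) →
    (p.comp q).nestedHoms C (Nested.comp p q x y) = p.nestedHoms C x ++ q.nestedHoms C y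
  | _, _, _, nil _, _, _, _ => rfl
  | _, _, _, cons _ p, q, x, y => congrArg (List.cons _) (nestedHoms_comp C p q x.2 y)

lemma flat_comp : {a b c : S} → (p : ObjSeq a b) →
    (q : ObjSeq b c) → (x : p.Nested) → (y : q.Nested) →
    (p.comp q).flat (Nested.comp p q x y) = (p.flat x).comp (q.flat y)
  | _, _, _, nil _, _, _, _ => rfl
  | _, _, _, cons _ p, q, x, y => by
    rw [flat, ObjSeq.comp_assoc, ← flat_comp p q x.2 y]; rfl

/-- The doubly-nested sequence consisting of the sequences `xᵢ₋₁, xᵢ`. -/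
def singles : {a b : S} → (p : ObjSeq a b) → p.Nested
  | _, _, nil _ => PUnit.unit
  | _, _, cons a (b := b) p => (single a b, singles p)

lemma flat_singles : {a b : S} → (p : ObjSeq a b) → p.flat p.singles = p
  | _, _, nil _ => rfl
  | _, _, cons a p => congrArg (cons a) (flat_singles p)

lemma nestedHoms_singles {A : Type*} (C : S → S → A) : {a b : S} → (p : ObjSeq a b) →
    (p.homs C).map (fun z => [z]) = p.nestedHoms C p.singles
  | _, _, nil _ => rfl
  | _, _, cons _ p => congrArg (List.cons _) (nestedHoms_singles C p)

/-- The index set for triply-nested sequences. -/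
abbrev Nested₂ (a b : S) : Type w := Σ q : ObjSeq a b, q.Nested

def tripleHoms {A : Type*} (C : S → S → A) {a b : S} (p : ObjSeq a b)
    (c : p.Choice Nested₂) : List (List (List A)) :=
  Choice.list (fun _ _ j => j.1.nestedHoms C j.2) p c

/-- The outer two levels of a triply-nested sequence. -/
def outer {a b : S} (p : ObjSeq a b) (c : p.Choice Nested₂) : p.Nested :=
  Choice.map (fun _ _ j => j.1) p c

/-- The result of concatenating the two innermost levels of a triply-nested sequence. -/
def inner {a b : S} (p : ObjSeq a b) (c : p.Choice Nested₂) : p.Nested :=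
  Choice.map (fun _ _ j => j.1.flat j.2) p c

/-- The result of concatenating the two outermost levels of a triply-nested sequence. -/
def total : {a b : S} → (p : ObjSeq a b) → (c : p.Choice Nested₂) → (p.flat (p.outer c)).Nested
  | _, _, nil _, c => c
  | _, _, cons _ p, c => Nested.comp c.1.1 (p.flat (p.outer c.2)) c.1.2 (p.total c.2)

lemma flat_total : {a b : S} → (p : ObjSeq a b) → (c : p.Choice Nested₂) →
    (p.flat (p.outer c)).flat (p.total c) = p.flat (p.inner c)
  | _, _, nil _, _ => rfl
  | _, _, cons _ p, c => by
    refine (flat_comp c.1.1 (p.flat (p.outer c.2)) c.1.2 (p.total c.2)).trans ?_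
    exact congrArg (ObjSeq.comp (c.1.1.flat c.1.2)) (flat_total p c.2)

lemma nestedHoms_total {A : Type*} (C : S → S → A) : {a b : S} → (p : ObjSeq a b) →
    (c : p.Choice Nested₂) →
    (p.flat (p.outer c)).nestedHoms C (p.total c) = (p.tripleHoms C c).flatten
  | _, _, nil _, _ => rfl
  | _, _, cons _ p, c => by
    refine (nestedHoms_comp C c.1.1 (p.flat (p.outer c.2)) c.1.2 (p.total c.2)).trans ?_
    exact congrArg (fun l => c.1.1.nestedHoms C c.1.2 ++ l) (nestedHoms_total C p c.2)

lemma nestedHoms_inner {A : Type*} (C : S → S → A) : {a b : S} → (p : ObjSeq a b) →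
    (c : p.Choice Nested₂) →
    (p.tripleHoms C c).map List.flatten = p.nestedHoms C (p.inner c)
  | _, _, nil _, _ => rfl
  | _, _, cons _ p, c =>
    congrArg₂ List.cons (flatten_nestedHoms C c.1.1 c.1.2) (nestedHoms_inner C p c.2)

end ObjSeq

end ChoiceLemmas

section ChoiceHom₂

variable {S : Type w} {V : Type u} [Category.{v} V] {D : Type u'} [Category.{v'} D]

/-- A variant of `choiceHom`. -/
def choiceHom₂ {A B : Type*} {J : S → S → Type w} {g : ∀ a b, J a b → A} {f : A → B}
    {f' : B → V} {C : S → S → V} (i : ∀ a b (j : J a b), f' (f (g a b j)) ⟶ C a b) :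
    {a b : S} → (p : ObjSeq a b) → (c : p.Choice J) →
      (((Choice.list g p c).map f).map f' ⟶ p.homs C)
  | _, _, nil _, _ => 𝟙 _
  | _, _, cons _ p, c => consHom (i _ _ c.1) (choiceHom₂ i p c.2)

lemma choiceHom₂_eq {A B : Type*} {J : S → S → Type w} {g : ∀ a b, J a b → A} {f : A → B}
    {f' : B → V} {C : S → S → V} (i : ∀ a b (j : J a b), f' (f (g a b j)) ⟶ C a b) :
    {a b : S} → (p : ObjSeq a b) → (c : p.Choice J) → choiceHom₂ i p c =
      eqToHom (by rw [List.map_map]; rfl) ≫ choiceHom (f := fun x => f' (f x)) i p c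
  | _, _, nil _, _ => rfl
  | _, _, cons _ p, c => by
    refine (congrArg (consHom _) (choiceHom₂_eq i p c.2)).trans ?_
    refine Eq.trans ?_ (congrArg (· ≫ _) (consHom_eqToHom rfl
      (by rw [List.map_map]; rfl)))
    rw [eqToHom_refl]
    exact congrArg (fun t => consHom t _) (Category.id_comp _).symm

lemma choice₂_hom_ext {A B : Type*} {J : S → S → Type w} {g : ∀ a b, J a b → A} {f : A → B}
    {f' : B → V} {C : S → S → V} (i : ∀ a b (j : J a b), f' (f (g a b j)) ⟶ C a b)
    (hi : ∀ a b, IsCoprod (i a b)) {a b : S} (p : ObjSeq a b) (G : List V ⥤ D)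
    (hG : DistributiveFunctor.{w} G) {X : D} {m m' : G.obj (p.homs C) ⟶ X}
    (h : ∀ c : p.Choice J, G.map (choiceHom₂ i p c) ≫ m = G.map (choiceHom₂ i p c) ≫ m') :
    m = m' := by
  refine (choice_isCoprod (f := fun x => f' (f x)) i hi p G hG).hom_ext fun c => ?_
  have := h c
  rw [choiceHom₂_eq, G.map_comp, Category.assoc, Category.assoc] at this
  exact (cancel_epi _).1 this

end ChoiceHom₂

section NestedHom

variable {V : Type u} [Category.{v} V] {S T : Type w} {C : S → S → V} {C' : T → T → V}
  {f : S → T} (m : ∀ a b, C a b ⟶ C' (f a) (f b))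

/-- The morphism of nested sequences of homs induced by a morphism of graphs. -/
def nestedHom : {a b : S} → (p : ObjSeq a b) → (c : p.Nested) →
    (p.nestedHoms C c ⟶ (p.map f).nestedHoms C' (Nested.map f p c))
  | _, _, nil _, _ => 𝟙 _
  | _, _, cons _ p, c => consHom (homsHom m c.1) (nestedHom p c.2)

lemma flattenHom_nestedHom_heq : {a b : S} → (p : ObjSeq a b) → (c : p.Nested) →
    HEq (flattenHom (nestedHom m p c)) (homsHom m (p.flat c))
  | _, _, nil _, _ => HEq.rfl
  | _, _, cons _ p, c => by
    refine HEq.trans ?_ (homsHom_append_heq m c.1 (p.flat c.2)).symm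
    refine appendHom_heq (homsHom m c.1) (flatten_nestedHoms C p c.2) ?_
      (flattenHom_nestedHom_heq p c.2)
    exact (flatten_nestedHoms C' (p.map f) (Nested.map f p c.2)).trans
      (congrArg (homs C') (flat_map f p c.2))

end NestedHom

namespace Multitensor

variable {V : Type u} [Category.{v} V] [HasCoproducts.{w} V] (E : Multitensor V)

variable {S T : Type w}

/-- The coproduct inclusion for the sequence `a, b`. -/
noncomputable def inclSingle (C : S → S → V) (a b : S) : E.E.obj [C a b] ⟶ E.gammaHom C a b :=
  E.incl C (single a b)

/-- The hom maps of the unit of `ΓE`. -/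
noncomputable def gammaUnit (C : S → S → V) (a b : S) : C a b ⟶ E.gammaHom C a b :=
  E.u (C a b) ≫ E.inclSingle C a b

/-- The morphism `E(X(x_{1j-1}, x_{1j})), ..., E(X(x_{nj-1}, x_{nj})) ⟶ ΓE(X)(x₀,x₁), ...` given
by coproduct inclusions. -/
noncomputable def nestedIncl (C : S → S → V) {a b : S} (p : ObjSeq a b) (c : p.Nested) :
    (p.nestedHoms C c).map E.E.obj ⟶ p.homs (E.gammaHom C) :=
  choiceHom (J := fun a b => ObjSeq a b) (f := E.E.obj)
    (g := fun _ _ q => q.homs C) (fun _ _ q => E.incl C q) p c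

/-- The composite `E E X(x_{ij-1}, x_{ij}) ⟶ E (ΓE X)(x_{i-1},x_i) ⟶ (ΓE)²(X)(a,b)`. -/
noncomputable def incl₂ (C : S → S → V) {a b : S} (p : ObjSeq a b) (c : p.Nested) :
    E.E.obj ((p.nestedHoms C c).map E.E.obj) ⟶ E.gammaHom (E.gammaHom C) a b :=
  E.E.map (E.nestedIncl C p c) ≫ E.incl (E.gammaHom C) p

variable {E} (hE : Distributive.{w} E)

lemma nestedIncl_isCoprod (hE : Distributive.{w} E) (C : S → S → V) {a b : S} (p : ObjSeq a b) :
    IsCoprod (fun c : p.Nested => E.E.map (E.nestedIncl C p c)) :=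
  choice_isCoprod (J := fun a b => ObjSeq a b) (f := E.E.obj)
    (g := fun _ _ q => q.homs C) (fun _ _ q => E.incl C q)
    (fun a b => E.incl_isCoprod C a b) p E.E hE

/-- The hom maps of the multiplication of `ΓE`: the unique morphisms with
`incl₂ ≫ μ = σ ≫ incl`. -/
noncomputable def gammaMul (C : S → S → V) (a b : S) :
    E.gammaHom (E.gammaHom C) a b ⟶ E.gammaHom C a b :=
  Sigma.desc fun p : ObjSeq a b => (nestedIncl_isCoprod hE C p).desc fun c =>
    E.σ (p.nestedHoms C c) ≫ E.incl' C _ (p.flat c) (flatten_nestedHoms C p c)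

lemma incl₂_gammaMul (C : S → S → V) {a b : S} (p : ObjSeq a b) (c : p.Nested) :
    E.incl₂ C p c ≫ gammaMul hE C a b =
      E.σ (p.nestedHoms C c) ≫ E.incl' C _ (p.flat c) (flatten_nestedHoms C p c) := by
  have : E.incl (E.gammaHom C) p ≫ gammaMul hE C a b = _ := Sigma.ι_desc _ _
  rw [incl₂, Category.assoc, this]
  exact (nestedIncl_isCoprod hE C p).fac _ c

lemma incl₂_hom_ext (hE : Distributive.{w} E) (C : S → S → V) {a b : S} {X : V}
    {m m' : E.gammaHom (E.gammaHom C) a b ⟶ X}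
    (h : ∀ (p : ObjSeq a b) (c : p.Nested), E.incl₂ C p c ≫ m = E.incl₂ C p c ≫ m') : m = m' := by
  refine (E.incl_isCoprod _ a b).hom_ext fun p => (nestedIncl_isCoprod hE C p).hom_ext fun c => ?_
  have := h p c
  rwa [incl₂, Category.assoc, Category.assoc] at this

lemma incl₂_isCoprod (hE : Distributive.{w} E) (C : S → S → V) (a b : S) :
    IsCoprod (fun j : Nested₂ a b => E.incl₂ C j.1 j.2) := fun X k =>
  ⟨(E.incl_isCoprod _ a b).desc fun p => (nestedIncl_isCoprod hE C p).desc fun c => k ⟨p, c⟩,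
    fun j => by
      change E.incl₂ C j.1 j.2 ≫ _ = _
      rw [incl₂, Category.assoc, (E.incl_isCoprod _ a b).fac]
      exact (nestedIncl_isCoprod hE C j.1).fac (fun c => k ⟨j.1, c⟩) j.2,
    fun m hm => incl₂_hom_ext hE C fun p c => by
      refine (hm ⟨p, c⟩).trans ?_
      rw [incl₂, Category.assoc, (E.incl_isCoprod _ a b).fac]
      exact ((nestedIncl_isCoprod hE C p).fac (fun c => k ⟨p, c⟩) c).symm⟩

/-! #### Naturality -/

section Naturality

variable {C : S → S → V} {C' : T → T → V} {f : S → T} (m : ∀ a b, C a b ⟶ C' (f a) (f b))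

lemma gammaUnit_natural (a b : S) :
    m a b ≫ E.gammaUnit C' (f a) (f b) = E.gammaUnit C a b ≫ E.gammaMap m a b := by
  have h : E.inclSingle C a b ≫ E.gammaMap m a b =
      E.E.map (consHom (m a b) (𝟙 [])) ≫ E.inclSingle C' (f a) (f b) := E.incl_gammaMap m _
  rw [gammaUnit, gammaUnit, Category.assoc, h, ← Category.assoc, E.u_natural, Category.assoc]

lemma nestedIncl_homsHom : {a b : S} → (p : ObjSeq a b) → (c : p.Nested) →
    E.nestedIncl C p c ≫ homsHom (C' := E.gammaHom C') (f := f) (E.gammaMap m) p =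
      mapHom E.E (nestedHom m p c) ≫ E.nestedIncl C' (p.map f) (Nested.map f p c)
  | _, _, nil _, _ => rfl
  | _, _, cons _ p, c =>
    congrArg₂ consHom (E.incl_gammaMap m c.1) (nestedIncl_homsHom p c.2)

lemma gammaMul_natural (a b : S) :
    E.gammaMap (C' := E.gammaHom C') (f := f) (E.gammaMap m) a b ≫
        gammaMul hE C' (f a) (f b) =
      gammaMul hE C a b ≫ E.gammaMap m a b :=
  incl₂_hom_ext hE C fun p c => by
    have e1 : E.incl₂ C p c ≫ E.gammaMap (C' := E.gammaHom C') (f := f) (E.gammaMap m) a b =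
        E.E.map (mapHom E.E (nestedHom m p c)) ≫ E.incl₂ C' (p.map f) (Nested.map f p c) := by
      rw [incl₂, Category.assoc, incl_gammaMap, ← Category.assoc, ← E.E.map_comp,
        nestedIncl_homsHom, E.E.map_comp, Category.assoc]
      rfl
    have h := comp_eqToHom_of_heq (flatten_nestedHoms C p c)
      (by rw [flatten_nestedHoms, flat_map]) (flattenHom_nestedHom_heq m p c)
    rw [← Category.assoc, e1, Category.assoc, incl₂_gammaMul, ← Category.assoc, E.σ_natural,
      Category.assoc, ← Category.assoc _ (gammaMul hE C a b), incl₂_gammaMul, Category.assoc]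
    congr 1
    rw [E.incl'_congr C' (flat_map f p c) _ (by rw [flatten_nestedHoms, flat_map]), incl', incl',
      Category.assoc, incl_gammaMap, ← Category.assoc, ← E.E.map_comp, h,
      E.E.map_comp, Category.assoc]

end Naturality

/-! #### The monad laws -/

section Laws

variable (C : S → S → V)

lemma gamma_left_unit (a b : S) :
    E.gammaUnit (E.gammaHom C) a b ≫ gammaMul hE C a b = 𝟙 (E.gammaHom C a b) :=
  (E.incl_isCoprod C a b).hom_ext fun p => by
    have h : E.E.map (consHom (E.incl C p) (𝟙 [])) ≫ E.inclSingle (E.gammaHom C) a b ≫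
        gammaMul hE C a b = E.σ [p.homs C] ≫ E.incl' C _ (p.comp (nil b))
          (by rw [ObjSeq.comp_nil]; simp) :=
      (Category.assoc _ _ _).symm.trans (incl₂_gammaMul hE C (single a b) (p, PUnit.unit))
    rw [gammaUnit, Category.assoc, ← Category.assoc, E.u_natural, Category.assoc, h,
      ← Category.assoc, E.unit_left]
    rw [map_incl', Category.comp_id, E.incl'_congr C (ObjSeq.comp_nil p) _ rfl, incl'_self]

lemma idHoms_gammaUnit : {a b : S} → (p : ObjSeq a b) →
    idHoms (E.gammaUnit C) p = seqOf' E.u (p.homs C) ≫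
      eqToHom (by rw [nestedHoms_singles]) ≫ E.nestedIncl C p p.singles
  | _, _, nil _ => rfl
  | _, _, cons a (b := b) p => by
    refine (congrArg (consHom _) (idHoms_gammaUnit p)).trans ?_
    have := consHom_eqToHom (rfl : E.E.obj [C a b] = _)
      (congrArg (List.map E.E.obj) (nestedHoms_singles C p))
    refine Eq.trans ?_ (congrArg (fun t => seqOf' E.u ((ObjSeq.cons a p).homs C) ≫ t ≫
      E.nestedIncl C (ObjSeq.cons a p) (ObjSeq.cons a p).singles) this)
    rw [eqToHom_refl]
    exact congrArg (fun t => consHom t _)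
      (congrArg (fun t => E.u (C a b) ≫ t) (Category.id_comp _).symm)

lemma gamma_right_unit (a b : S) :
    E.gammaMap (f := fun x => x) (E.gammaUnit C) a b ≫ gammaMul hE C a b =
      𝟙 (E.gammaHom C a b) :=
  (E.incl_isCoprod C a b).hom_ext fun p => by
    have e := incl₂_gammaMul hE C p p.singles
    rw [incl₂, Category.assoc] at e
    rw [← Category.assoc, incl_gammaMap_id, idHoms_gammaUnit, E.E.map_comp, E.E.map_comp,
      Category.assoc, Category.assoc, Category.assoc, e,
      ← Category.assoc (E.E.map (eqToHom _)), σ_cast E (nestedHoms_singles C p),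
      Category.assoc, map_incl', ← Category.assoc, E.unit_right, map_incl', Category.comp_id,
      E.incl'_congr C (flat_singles p) _ rfl, incl'_self]

/-- The inclusions for triply-nested sequences. -/
noncomputable def tripleIncl {a b : S} (p : ObjSeq a b) (c : p.Choice Nested₂) :
    ((p.tripleHoms C c).map (List.map E.E.obj)).map E.E.obj ⟶
      p.homs (E.gammaHom (E.gammaHom C)) :=
  choiceHom₂ (f := List.map E.E.obj) (f' := E.E.obj) 
    (J := Nested₂) (g := fun _ _ j => j.1.nestedHoms C j.2)
    (fun _ _ j => E.incl₂ C j.1 j.2) p c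

lemma tripleIncl_idHoms : {a b : S} → (p : ObjSeq a b) → (c : p.Choice Nested₂) →
    tripleIncl (E := E) C p c ≫ idHoms (gammaMul hE C) p =
      seqOf₂ E.σ (p.tripleHoms C c) ≫ eqToHom (by rw [nestedHoms_inner]) ≫
        E.nestedIncl C p (p.inner c)
  | _, _, nil _, _ => rfl
  | _, _, cons a p, c => by
    have h1 : tripleIncl (E := E) C (ObjSeq.cons a p) c ≫ idHoms (gammaMul hE C) (ObjSeq.cons a p) =
      consHom (E.incl₂ C c.1.1 c.1.2 ≫ gammaMul hE C _ _)
        (tripleIncl (E := E) C p c.2 ≫ idHoms (gammaMul hE C) p) := rfl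
    have := consHom_eqToHom (congrArg E.E.obj (flatten_nestedHoms C c.1.1 c.1.2))
      (congrArg (List.map E.E.obj) (nestedHoms_inner C p c.2))
    refine Eq.trans ?_ (congrArg (fun t => seqOf₂ E.σ ((ObjSeq.cons a p).tripleHoms C c) ≫ t ≫
      E.nestedIncl C (ObjSeq.cons a p) ((ObjSeq.cons a p).inner c)) this)
    rw [h1, incl₂_gammaMul, tripleIncl_idHoms p c.2, incl', eqToHom_map]
    rfl

/-- The inclusions at the innermost level. -/
noncomputable def innerIncl : {a b : S} → (p : ObjSeq a b) → (c : p.Choice Nested₂) →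
    ((p.tripleHoms C c).map (List.map E.E.obj) ⟶ p.nestedHoms (E.gammaHom C) (p.outer c))
  | _, _, nil _, _ => 𝟙 _
  | _, _, cons _ p, c => consHom (E.nestedIncl C c.1.1 c.1.2) (innerIncl p c.2)

lemma tripleIncl_eq : {a b : S} → (p : ObjSeq a b) → (c : p.Choice Nested₂) →
    tripleIncl (E := E) C p c =
      mapHom E.E (innerIncl C p c) ≫ E.nestedIncl (E.gammaHom C) p (p.outer c)
  | _, _, nil _, _ => rfl
  | _, _, cons _ p, c => congrArg (consHom _) (tripleIncl_eq p c.2)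

lemma nestedIncl_comp_heq : {a b c : S} → (p : ObjSeq a b) → (q : ObjSeq b c) →
    (x : p.Nested) → (y : q.Nested) →
    HEq (E.nestedIncl C (p.comp q) (Nested.comp p q x y))
      (appendHom (E.nestedIncl C p x) (E.nestedIncl C q y))
  | _, _, _, nil _, _, _, _ => HEq.rfl
  | _, _, _, cons _ p, q, x, y => by
    refine consHom_heq (E.incl C x.1) ?_ (homs_comp _ _ _) (nestedIncl_comp_heq p q x.2 y)
    exact (congrArg _ (nestedHoms_comp C p q x.2 y)).trans List.map_append

lemma innerIncl_heq : {a b : S} → (p : ObjSeq a b) → (c : p.Choice Nested₂) →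
    HEq (flattenHom (innerIncl (E := E) C p c)) (E.nestedIncl C (p.flat (p.outer c)) (p.total c))
  | _, _, nil _, _ => HEq.rfl
  | _, _, cons _ p, c => by
    refine HEq.trans ?_ (nestedIncl_comp_heq C c.1.1 (p.flat (p.outer c.2)) c.1.2
      (p.total c.2)).symm
    refine appendHom_heq (E.nestedIncl C c.1.1 c.1.2) ?_ (flatten_nestedHoms _ p _)
      (innerIncl_heq p c.2)
    rw [nestedHoms_total, map_flatten_eq]
    rfl

lemma gamma_assoc (a b : S) :
    E.gammaMap (f := fun x => x) (gammaMul hE C) a b ≫ gammaMul hE C a b =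
      gammaMul hE (E.gammaHom C) a b ≫ gammaMul hE C a b :=
  (E.incl_isCoprod _ a b).hom_ext fun p =>
    choice₂_hom_ext (f := List.map E.E.obj) (f' := E.E.obj)
      (J := Nested₂) (g := fun _ _ j => j.1.nestedHoms C j.2)
      (fun _ _ j => E.incl₂ C j.1 j.2) (fun a b => incl₂_isCoprod hE C a b) p E.E hE fun c => by
    have e1 := incl₂_gammaMul hE C p (p.inner c)
    have e2 := incl₂_gammaMul hE (E.gammaHom C) p (p.outer c)
    have e3 := incl₂_gammaMul hE C (p.flat (p.outer c)) (p.total c)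
    rw [incl₂, Category.assoc] at e1 e2 e3
    have h1 : E.E.map (tripleIncl C p c) ≫ E.incl (E.gammaHom (E.gammaHom C)) p ≫
        E.gammaMap (f := fun x => x) (gammaMul hE C) a b ≫ gammaMul hE C a b =
        E.E.map (seqOf₂ E.σ (p.tripleHoms C c)) ≫
          E.σ ((p.tripleHoms C c).map List.flatten) ≫
            E.incl' C _ (p.flat (p.inner c)) (by rw [nestedHoms_inner, flatten_nestedHoms]) := by
      rw [← Category.assoc (E.incl _ _), incl_gammaMap_id, ← Category.assoc, ← Category.assoc,
        ← E.E.map_comp, tripleIncl_idHoms, E.E.map_comp, E.E.map_comp, Category.assoc,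
        Category.assoc, Category.assoc, e1, ← Category.assoc (E.E.map (eqToHom _)),
        σ_cast E (nestedHoms_inner C p c), Category.assoc, map_incl']
    have h2 : E.E.map (tripleIncl C p c) ≫ E.incl (E.gammaHom (E.gammaHom C)) p ≫
        gammaMul hE (E.gammaHom C) a b ≫ gammaMul hE C a b =
        E.σ ((p.tripleHoms C c).map (List.map E.E.obj)) ≫
          E.E.map (eqToHom (map_flatten_eq E.E.obj _)) ≫ E.σ (p.tripleHoms C c).flatten ≫
            E.incl' C _ (p.flat (p.inner c))
              (by rw [← flat_total, ← nestedHoms_total, flatten_nestedHoms]) := by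
      have h := comp_eqToHom_of_heq
        ((map_flatten_eq E.E.obj _).trans
          (congrArg (List.map E.E.obj) (nestedHoms_total C p c).symm))
        (flatten_nestedHoms _ p _) (innerIncl_heq (E := E) C p c)
      rw [tripleIncl_eq, E.E.map_comp, Category.assoc, ← Category.assoc (E.incl _ _),
        ← Category.assoc (E.E.map (E.nestedIncl _ _ _)), e2, Category.assoc,
        ← Category.assoc (E.E.map (mapHom _ _)), E.σ_natural, Category.assoc]
      congr 1
      rw [incl', Category.assoc, ← Category.assoc (E.E.map (flattenHom _)), ← E.E.map_comp, h,
        E.E.map_comp, Category.assoc, e3, ← eqToHom_trans (map_flatten_eq E.E.obj _)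
          (congrArg (List.map E.E.obj) (nestedHoms_total C p c).symm), E.E.map_comp,
        Category.assoc, ← Category.assoc (E.E.map (eqToHom (congrArg _ _))),
        σ_cast E (nestedHoms_total C p c).symm, Category.assoc, map_incl',
        E.incl'_congr C (flat_total p c)]
      exact (nestedHoms_total C p c).symm
    refine (h1.trans ?_).trans h2.symm
    have := E.assoc (p.tripleHoms C c)
    rw [← Category.assoc (E.E.map (eqToHom _)), ← Category.assoc (E.σ _)]
    rw [this, Category.assoc, Category.assoc, map_incl']

end Laws

end Multitensor

open ObjSeq

/-! ### Monads over `Set` -/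

section MonadsOverSet

variable {A : Type u} [Category.{v} A] {B : Type u'} [Category.{v'} B]
  {C : Type u''} [Category.{v''} C]

/-- A monad on the object `p : A ⥤ Set` of the 2-category `CAT/Set`. -/
structure SetMonad (p : A ⥤ Type w) where
  T : Monad A
  T_over : T.toFunctor ⋙ p = p
  η_over : ∀ X, p.map (T.η.app X) = eqToHom (Functor.congr_obj T_over X).symm
  μ_over : ∀ X, p.map (T.μ.app X) = eqToHom (Functor.congr_obj T_over (T.toFunctor.obj X))

/-- The data `ψ : SK ⟶ KT` making a functor `K` over `Set` into a monad functor
`(A, T) ⟶ (B, S)` in `CAT/Set`. -/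
@[ext]
structure MonadFunctorStr {p : A ⥤ Type w} {q : B ⥤ Type w} (T : SetMonad p) (S : SetMonad q)
    (K : A ⥤ B) (hK : K ⋙ q = p) where
  ψ : K ⋙ S.T.toFunctor ⟶ T.T.toFunctor ⋙ K
  over_set : ∀ X, q.map (ψ.app X) = eqToHom
    (((Functor.congr_obj S.T_over (K.obj X)).trans (Functor.congr_obj hK X)).trans
      ((Functor.congr_obj hK (T.T.obj X)).trans (Functor.congr_obj T.T_over X)).symm)
  unit : ∀ X, S.T.η.app (K.obj X) ≫ ψ.app X = K.map (T.T.η.app X)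
  mul : ∀ X, S.T.μ.app (K.obj X) ≫ ψ.app X =
    S.T.map (ψ.app X) ≫ ψ.app (T.T.obj X) ≫ K.map (T.T.μ.app X)

/-- The data `ψ : KT ⟶ SK` making a functor `K` over `Set` into a monad opfunctor
`(A, T) ⟶ (B, S)` in `CAT/Set`. -/
@[ext]
structure MonadOpfunctorStr {p : A ⥤ Type w} {q : B ⥤ Type w} (T : SetMonad p) (S : SetMonad q)
    (K : A ⥤ B) (hK : K ⋙ q = p) where
  ψ : T.T.toFunctor ⋙ K ⟶ K ⋙ S.T.toFunctor
  over_set : ∀ X, q.map (ψ.app X) = eqToHom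
    (((Functor.congr_obj hK (T.T.obj X)).trans (Functor.congr_obj T.T_over X)).trans
      ((Functor.congr_obj S.T_over (K.obj X)).trans (Functor.congr_obj hK X)).symm)
  unit : ∀ X, K.map (T.T.η.app X) ≫ ψ.app X = S.T.η.app (K.obj X)
  mul : ∀ X, K.map (T.T.μ.app X) ≫ ψ.app X =
    ψ.app (T.T.obj X) ≫ S.T.map (ψ.app X) ≫ S.T.μ.app (K.obj X)

@[simps] def MonadFunctorStr.id {p : A ⥤ Type w} (T : SetMonad p) :
    MonadFunctorStr T T (𝟭 A) rfl where
  ψ := { app := fun X => 𝟙 (T.T.obj X) }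
  over_set X := by simp
  unit X := by simp
  mul X := by simp

@[simps] def MonadFunctorStr.comp {p : A ⥤ Type w} {q : B ⥤ Type w} {r : C ⥤ Type w}
    {T : SetMonad p} {S : SetMonad q} {R : SetMonad r} {K : A ⥤ B} {hK : K ⋙ q = p}
    {L : B ⥤ C} {hL : L ⋙ r = q} (f : MonadFunctorStr T S K hK) (g : MonadFunctorStr S R L hL) :
    MonadFunctorStr T R (K ⋙ L) ((congrArg (K ⋙ ·) hL).trans hK) where
  ψ := {
    app := fun X => g.ψ.app (K.obj X) ≫ L.map (f.ψ.app X)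
    naturality := fun X Y h => by
      have h1 := g.ψ.naturality (K.map h)
      have h2 := congrArg L.map (f.ψ.naturality h)
      dsimp at h1 h2 ⊢
      rw [L.map_comp, L.map_comp] at h2
      rw [← Category.assoc, h1, Category.assoc, h2, Category.assoc] }
  over_set X := by
    subst hL
    have h1 := g.over_set (K.obj X)
    have h2 := f.over_set X
    refine (r.map_comp _ _).trans ?_
    rw [h1]
    refine (congrArg (_ ≫ ·) h2).trans ?_
    exact eqToHom_trans _ _
  unit X := by
    have h1 := g.unit (K.obj X)
    have h2 := f.unit X
    dsimp at h1 h2 ⊢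
    rw [← Category.assoc, h1, ← L.map_comp, h2]
  mul X := by
    have h1 := g.mul (K.obj X)
    have h2 := congrArg L.map (f.mul X)
    have h3 := g.ψ.naturality (f.ψ.app X)
    dsimp at h1 h2 h3 ⊢
    simp only [Functor.map_comp] at h2 ⊢
    rw [← Category.assoc, h1]
    simp only [Category.assoc]
    rw [h2, ← Category.assoc (R.T.map (L.map _)), h3]
    simp only [Category.assoc]

@[simps] def MonadOpfunctorStr.id {p : A ⥤ Type w} (T : SetMonad p) :
    MonadOpfunctorStr T T (𝟭 A) rfl where
  ψ := { app := fun X => 𝟙 (T.T.obj X) }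
  over_set X := by simp
  unit X := by simp
  mul X := by simp

@[simps] def MonadOpfunctorStr.comp {p : A ⥤ Type w} {q : B ⥤ Type w} {r : C ⥤ Type w}
    {T : SetMonad p} {S : SetMonad q} {R : SetMonad r} {K : A ⥤ B} {hK : K ⋙ q = p}
    {L : B ⥤ C} {hL : L ⋙ r = q} (f : MonadOpfunctorStr T S K hK)
    (g : MonadOpfunctorStr S R L hL) :
    MonadOpfunctorStr T R (K ⋙ L) ((congrArg (K ⋙ ·) hL).trans hK) where
  ψ := {
    app := fun X => L.map (f.ψ.app X) ≫ g.ψ.app (K.obj X)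
    naturality := fun X Y h => by
      have h1 := g.ψ.naturality (K.map h)
      have h2 := congrArg L.map (f.ψ.naturality h)
      dsimp at h1 h2 ⊢
      rw [L.map_comp, L.map_comp] at h2
      rw [← Category.assoc, h2, Category.assoc, h1, Category.assoc] }
  over_set X := by
    subst hL
    have h1 := g.over_set (K.obj X)
    have h2 := f.over_set X
    refine (r.map_comp _ _).trans ?_
    rw [h1]
    refine (congrArg (· ≫ _) h2).trans ?_
    exact eqToHom_trans _ _
  unit X := by
    have h1 := g.unit (K.obj X)
    have h2 := f.unit X
    dsimp at h1 h2 ⊢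
    rw [← Category.assoc, ← L.map_comp, h2, h1]
  mul X := by
    have h1 := g.mul (K.obj X)
    have h2 := congrArg L.map (f.mul X)
    have h3 := g.ψ.naturality (f.ψ.app X)
    dsimp at h1 h2 h3 ⊢
    simp only [Functor.map_comp] at h2 ⊢
    rw [← Category.assoc, h2]
    simp only [Category.assoc]
    rw [h1, ← Category.assoc (L.map (S.T.map _)), h3]
    simp only [Category.assoc]

end MonadsOverSet

section GammaMonad

variable {V : Type u} [Category.{v} V] [HasCoproducts.{w} V]

/-- The monad `ΓE` on `𝒢V`. -/
noncomputable def Multitensor.gammaMonad (E : Multitensor V) (hE : Distributive.{w} E) :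
    Monad (EGraph.{w} V) where
  obj X := ⟨X.obj, E.gammaHom X.hom⟩
  map f := ⟨f.obj, E.gammaMap f.hom⟩
  map_id X := EGraph.hom_ext fun a b => E.gammaMap_id X.hom a b
  map_comp f g := EGraph.hom_ext fun a b => E.gammaMap_comp f.hom g.hom a b
  η := {
    app := fun X => ⟨fun a => a, E.gammaUnit X.hom⟩
    naturality := fun _ _ f => EGraph.hom_ext fun a b => E.gammaUnit_natural f.hom a b }
  μ := {
    app := fun X => ⟨fun a => a, gammaMul hE X.hom⟩
    naturality := fun _ _ f => EGraph.hom_ext fun a b => gammaMul_natural hE f.hom a b }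
  assoc X := EGraph.hom_ext fun a b => gamma_assoc hE X.hom a b
  left_unit X := EGraph.hom_ext fun a b => gamma_left_unit hE X.hom a b
  right_unit X := EGraph.hom_ext fun a b => gamma_right_unit hE X.hom a b

/-- The monad `ΓE` on `𝒢V` over `Set`. -/
noncomputable def Multitensor.gamma (E : Multitensor V) (hE : Distributive.{w} E) :
    SetMonad (EGraph.ob.{w} V) where
  T := E.gammaMonad hE
  T_over := rfl
  η_over _ := rfl
  μ_over _ := rfl

end GammaMonad

/-! ### Lax and oplax monoidal functors -/

section Lax

variable {V : Type u} [Category.{v} V] {W : Type u'} [Category.{v'} W]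
  {U : Type u''} [Category.{v''} U]

/-- The coherence data of a lax monoidal functor `(H, ψ) : (V, E) ⟶ (W, F)`. -/
@[ext]
structure LaxStr (E : Multitensor V) (F : Multitensor W) (H : V ⥤ W) where
  ψ : ∀ Z : List V, F.E.obj (Z.map H.obj) ⟶ H.obj (E.E.obj Z)
  natural : ∀ {Z Z' : List V} (f : Z ⟶ Z'),
    F.E.map (mapHom H f) ≫ ψ Z' = ψ Z ≫ H.map (E.E.map f)
  unit : ∀ X : V, F.u (H.obj X) ≫ ψ [X] = H.map (E.u X)
  subst : ∀ Z : List (List V),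
    F.E.map (seqOf₂ ψ Z) ≫ ψ (Z.map E.E.obj) ≫ H.map (E.σ Z) =
      F.σ (Z.map (List.map H.obj)) ≫ F.E.map (eqToHom (map_flatten_eq H.obj Z)) ≫ ψ Z.flatten

/-- The coherence data of an oplax monoidal functor `(H, ψ) : (V, E) ⟶ (W, F)`. -/
@[ext]
structure OplaxStr (E : Multitensor V) (F : Multitensor W) (H : V ⥤ W) where
  ψ : ∀ Z : List V, H.obj (E.E.obj Z) ⟶ F.E.obj (Z.map H.obj)
  natural : ∀ {Z Z' : List V} (f : Z ⟶ Z'),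
    H.map (E.E.map f) ≫ ψ Z' = ψ Z ≫ F.E.map (mapHom H f)
  unit : ∀ X : V, H.map (E.u X) ≫ ψ [X] = F.u (H.obj X)
  subst : ∀ Z : List (List V),
    ψ (Z.map E.E.obj) ≫ F.E.map (seqOf₂ ψ Z) ≫ F.σ (Z.map (List.map H.obj)) ≫
        F.E.map (eqToHom (map_flatten_eq H.obj Z)) =
      H.map (E.σ Z) ≫ ψ Z.flatten

end Lax

section MapIncl

variable {V : Type u} [Category.{v} V] [HasCoproducts.{w} V] {W : Type u'} [Category.{v'} W]
  {S : Type w}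

lemma map_incl_hom_ext {E : Multitensor V} {H : V ⥤ W}
    (hH : ∀ J : Type w, PreservesColimitsOfShape (Discrete J) H) (C : S → S → V) {a b : S} {X : W} {m m' : H.obj (E.gammaHom C a b) ⟶ X}
    (h : ∀ p : ObjSeq a b, H.map (E.incl C p) ≫ m = H.map (E.incl C p) ≫ m') : m = m' :=
  ((E.incl_isCoprod C a b).map H (hH _)).hom_ext h

lemma map_incl₂_hom_ext {E : Multitensor V} {H : V ⥤ W}
    (hH : ∀ J : Type w, PreservesColimitsOfShape (Discrete J) H) (hE : Multitensor.Distributive.{w} E) (C : S → S → V) {a b : S} {X : W}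
    {m m' : H.obj (E.gammaHom (E.gammaHom C) a b) ⟶ X}
    (h : ∀ (p : ObjSeq a b) (c : p.Nested),
      H.map (E.incl₂ C p c) ≫ m = H.map (E.incl₂ C p c) ≫ m') : m = m' :=
  ((Multitensor.incl₂_isCoprod hE C a b).map H (hH _)).hom_ext fun j => h j.1 j.2

end MapIncl

section GammaLax

variable {V : Type u} [Category.{v} V] {W : Type u'} [Category.{v'} W]
  {S T : Type w}

lemma homsHom_map_heq (H : V ⥤ W) {C : S → S → V} {C' : T → T → V} {f : S → T}
    (m : ∀ a b, C a b ⟶ C' (f a) (f b)) : {a b : S} → (p : ObjSeq a b) →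
      HEq (homsHom (C := fun x y => H.obj (C x y)) (C' := fun x y => H.obj (C' x y)) (f := f)
        (fun a b => H.map (m a b)) p) (mapHom H (homsHom m p))
  | _, _, nil _ => HEq.rfl
  | _, _, cons _ p => consHom_heq (H.map (m _ _)) (homs_map _ _ _) (homs_map _ _ _)
      (homsHom_map_heq H m p)

lemma nestedHoms_map {A B : Type*} (C : S → S → A) (h : A → B) : {a b : S} → (p : ObjSeq a b) →
    (c : p.Nested) → p.nestedHoms (fun x y => h (C x y)) c = (p.nestedHoms C c).map (List.map h)
  | _, _, nil _, _ => rfl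
  | _, _, cons _ p, c => congrArg₂ List.cons (homs_map C h c.1) (nestedHoms_map C h p c.2)

lemma LaxStr.map_ψ {E : Multitensor V} {F : Multitensor W} {H : V ⥤ W} (L : LaxStr E F H) {Z Z' : List V} (h : Z = Z') (h' : Z.map H.obj = Z'.map H.obj) :
    F.E.map (eqToHom h') ≫ L.ψ Z' = L.ψ Z ≫ H.map (E.E.map (eqToHom h)) := by
  subst h; simp

variable [HasCoproducts.{w} V] [HasCoproducts.{w} W] {E : Multitensor V} {F : Multitensor W}
  {H : V ⥤ W}

namespace LaxStr

variable (L : LaxStr E F H)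

/-- The hom maps of `Γ(ψ)`. -/
noncomputable def gammaHom (C : S → S → V) (a b : S) :
    F.gammaHom (fun x y => H.obj (C x y)) a b ⟶ H.obj (E.gammaHom C a b) :=
  Limits.Sigma.map (fun p : ObjSeq a b =>
    F.E.map (eqToHom (homs_map C H.obj p)) ≫ L.ψ (p.homs C)) ≫
      sigmaComparison H (fun p : ObjSeq a b => E.E.obj (p.homs C))

lemma incl_gammaHom (C : S → S → V) {a b : S} (p : ObjSeq a b) :
    F.incl _ p ≫ L.gammaHom C a b =
      F.E.map (eqToHom (homs_map C H.obj p)) ≫ L.ψ (p.homs C) ≫ H.map (E.incl C p) := by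
  have h := Sigma.ι_map_assoc (fun p : ObjSeq a b =>
    F.E.map (eqToHom (homs_map C H.obj p)) ≫ L.ψ (p.homs C)) p
      (sigmaComparison H (fun p : ObjSeq a b => E.E.obj (p.homs C)))
  rw [ι_comp_sigmaComparison, Category.assoc] at h
  exact h

lemma incl'_gammaHom (C : S → S → V) {a b : S} {Z : List W} (p : ObjSeq a b) (h) :
    F.incl' _ Z p h ≫ L.gammaHom C a b =
      F.E.map (eqToHom (h.trans (homs_map C H.obj p))) ≫ L.ψ (p.homs C) ≫
        H.map (E.incl C p) := by
  rw [Multitensor.incl', Category.assoc, incl_gammaHom, ← Category.assoc, ← F.E.map_comp,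
    eqToHom_trans]

lemma gammaHom_natural {C : S → S → V} {C' : T → T → V} {f : S → T}
    (m : ∀ a b, C a b ⟶ C' (f a) (f b)) (a b : S) :
    F.gammaMap (C' := fun x y => H.obj (C' x y)) (f := f) (fun a b => H.map (m a b)) a b ≫
        L.gammaHom C' (f a) (f b) = L.gammaHom C a b ≫ H.map (E.gammaMap m a b) :=
  (F.incl_isCoprod _ a b).hom_ext fun p => by
    have h := comp_eqToHom_of_heq (homs_map _ _ _) (homs_map _ _ _) (homsHom_map_heq H m p)
    rw [← Category.assoc, Multitensor.incl_gammaMap, Category.assoc, incl_gammaHom,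
      ← Category.assoc, ← F.E.map_comp, h, F.E.map_comp, Category.assoc,
      ← Category.assoc _ (L.gammaHom C a b), incl_gammaHom, Category.assoc, Category.assoc,
      ← H.map_comp, Multitensor.incl_gammaMap, ← Category.assoc (F.E.map (mapHom _ _)),
      L.natural, H.map_comp, Category.assoc]

lemma gammaHom_unit (C : S → S → V) (a b : S) :
    F.gammaUnit (fun x y => H.obj (C x y)) a b ≫ L.gammaHom C a b =
      H.map (E.gammaUnit C a b) := by
  have h : F.inclSingle (fun x y => H.obj (C x y)) a b ≫ L.gammaHom C a b =
      L.ψ [C a b] ≫ H.map (E.inclSingle C a b) := by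
    refine (L.incl_gammaHom C (single a b)).trans ?_
    exact (congrArg (· ≫ _) (F.E.map_id _)).trans (Category.id_comp _)
  rw [Multitensor.gammaUnit, Category.assoc, h, ← Category.assoc, L.unit, ← H.map_comp]
  rfl

lemma nestedIncl_idHoms (C : S → S → V) : {a b : S} → (p : ObjSeq a b) → (c : p.Nested) →
    F.nestedIncl _ p c ≫ idHoms (L.gammaHom C) p ≫ eqToHom (homs_map (E.gammaHom C) H.obj p) =
      eqToHom (by rw [nestedHoms_map]) ≫ seqOf₂ L.ψ (p.nestedHoms C c) ≫
        mapHom H (E.nestedIncl C p c)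
  | _, _, nil _, _ => rfl
  | _, _, cons a (b := b) p, c => by
    have h1 := consHom_eqToHom (rfl : H.obj (E.gammaHom C a b) = _)
      (homs_map (E.gammaHom C) H.obj p)
    have h2 := consHom_eqToHom (congrArg F.E.obj (homs_map C H.obj c.1))
      (congrArg (List.map F.E.obj) (nestedHoms_map C H.obj p c.2))
    refine (congrArg (fun t => F.nestedIncl _ (ObjSeq.cons a p) c ≫
      idHoms (L.gammaHom C) (ObjSeq.cons a p) ≫ t) h1.symm).trans ?_
    refine Eq.trans ?_ (congrArg (fun t => t ≫ seqOf₂ L.ψ ((ObjSeq.cons a p).nestedHoms C c) ≫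
        mapHom H (E.nestedIncl C (ObjSeq.cons a p) c)) h2)
    refine congrArg₂ consHom ?_ (nestedIncl_idHoms C p c.2)
    rw [eqToHom_refl, Category.comp_id, incl_gammaHom, eqToHom_map]

lemma gammaHom_mul (hE : Multitensor.Distributive.{w} E) (hF : Multitensor.Distributive.{w} F)
    (C : S → S → V) (a b : S) :
    Multitensor.gammaMul hF (fun x y => H.obj (C x y)) a b ≫ L.gammaHom C a b =
      F.gammaMap (f := fun x => x) (L.gammaHom C) a b ≫ L.gammaHom (E.gammaHom C) a b ≫
        H.map (Multitensor.gammaMul hE C a b) :=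
  Multitensor.incl₂_hom_ext hF _ fun p c => by
    have e := Multitensor.incl₂_gammaMul hE C p c
    rw [← Category.assoc, Multitensor.incl₂_gammaMul, Category.assoc, incl'_gammaHom]
    have h1 : F.incl₂ _ p c ≫ F.gammaMap (f := fun x => x) (L.gammaHom C) a b ≫
        L.gammaHom (E.gammaHom C) a b =
        F.E.map (eqToHom (by rw [nestedHoms_map])) ≫ F.E.map (seqOf₂ L.ψ (p.nestedHoms C c)) ≫
          L.ψ ((p.nestedHoms C c).map E.E.obj) ≫ H.map (E.incl₂ C p c) := by
      rw [Multitensor.incl₂, Category.assoc, ← Category.assoc (F.incl _ _),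
        Multitensor.incl_gammaMap_id, Category.assoc, incl_gammaHom,
        ← Category.assoc (F.E.map (idHoms _ _)), ← F.E.map_comp, ← Category.assoc,
        ← F.E.map_comp, nestedIncl_idHoms, F.E.map_comp, F.E.map_comp, Category.assoc,
        Category.assoc, ← Category.assoc (F.E.map (mapHom _ _)), L.natural, Category.assoc,
        ← H.map_comp]
      rfl
    have h2 := congrArg (· ≫ H.map (Multitensor.gammaMul hE C a b)) h1
    simp only [Category.assoc] at h2
    rw [h2, ← H.map_comp, e, H.map_comp,
      ← Category.assoc (L.ψ _), ← Category.assoc (F.E.map (seqOf₂ _ _)), L.subst,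
      Category.assoc, Category.assoc, ← Category.assoc (F.E.map (eqToHom _)) (F.σ _),
      Multitensor.σ_cast F (nestedHoms_map C H.obj p c), Category.assoc,
      Multitensor.incl', H.map_comp, ← Category.assoc (L.ψ _),
      ← L.map_ψ (flatten_nestedHoms C p c) (by rw [flatten_nestedHoms]), Category.assoc]
    simp only [eqToHom_map, eqToHom_trans_assoc]

/-- The monad functor `(𝒢H, Γ(ψ)) : (𝒢V, ΓE) ⟶ (𝒢W, ΓF)`. -/
noncomputable def gamma (hE : Multitensor.Distributive.{w} E)
    (hF : Multitensor.Distributive.{w} F) :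
    MonadFunctorStr (E.gamma hE) (F.gamma hF) (EGraph.map H) (EGraph.map_over H) where
  ψ := {
    app := fun X => ⟨fun a => a, L.gammaHom X.hom⟩
    naturality := fun _ _ f => EGraph.hom_ext fun a b => L.gammaHom_natural f.hom a b }
  over_set _ := rfl
  unit X := EGraph.hom_ext fun a b => L.gammaHom_unit X.hom a b
  mul X := EGraph.hom_ext fun a b => L.gammaHom_mul hE hF X.hom a b

end LaxStr

namespace OplaxStr

variable (L : OplaxStr E F H) (hH : ∀ J : Type w, PreservesColimitsOfShape (Discrete J) H)

/-- The hom maps of `Γ'(ψ)`. -/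
noncomputable def gammaHom (C : S → S → V) (a b : S) :
    H.obj (E.gammaHom C a b) ⟶ F.gammaHom (fun x y => H.obj (C x y)) a b :=
  haveI := hH (ObjSeq a b)
  (PreservesCoproduct.iso H (fun p : ObjSeq a b => E.E.obj (p.homs C))).hom ≫
    Limits.Sigma.map (fun p : ObjSeq a b =>
      L.ψ (p.homs C) ≫ F.E.map (eqToHom (homs_map C H.obj p).symm))

lemma incl_gammaHom (C : S → S → V) {a b : S} (p : ObjSeq a b) :
    H.map (E.incl C p) ≫ L.gammaHom hH C a b =
      L.ψ (p.homs C) ≫ F.E.map (eqToHom (homs_map C H.obj p).symm) ≫ F.incl _ p := by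
  have := hH (ObjSeq a b)
  have h : H.map (Sigma.ι (fun p : ObjSeq a b => E.E.obj (p.homs C)) p) ≫
      (PreservesCoproduct.iso H (fun p : ObjSeq a b => E.E.obj (p.homs C))).hom =
      Sigma.ι (fun p : ObjSeq a b => H.obj (E.E.obj (p.homs C))) p := by
    rw [← Iso.eq_comp_inv, PreservesCoproduct.inv_hom, ι_comp_sigmaComparison]
  have h' := congrArg (· ≫ Limits.Sigma.map (fun p : ObjSeq a b =>
      L.ψ (p.homs C) ≫ F.E.map (eqToHom (homs_map C H.obj p).symm))) h
  refine ((Category.assoc _ _ _).symm.trans h').trans ?_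
  refine (Sigma.ι_map _ p).trans ?_
  exact Category.assoc _ _ _

lemma incl'_gammaHom (C : S → S → V) {a b : S} {Z : List V} (p : ObjSeq a b)
    (h : Z = p.homs C) :
    H.map (E.incl' C Z p h) ≫ L.gammaHom hH C a b =
      L.ψ Z ≫ F.incl' _ _ p (by rw [h, homs_map C H.obj p]) := by
  subst h
  rw [Multitensor.incl'_self, incl_gammaHom]
  rfl

lemma gammaHom_natural {C : S → S → V} {C' : T → T → V} {f : S → T}
    (m : ∀ a b, C a b ⟶ C' (f a) (f b)) (a b : S) :
    H.map (E.gammaMap m a b) ≫ L.gammaHom hH C' (f a) (f b) =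
      L.gammaHom hH C a b ≫ F.gammaMap (C' := fun x y => H.obj (C' x y)) (f := f)
        (fun a b => H.map (m a b)) a b :=
  map_incl_hom_ext hH C fun p => by
    have h := comp_eqToHom_of_heq (homs_map _ _ _).symm (homs_map _ _ _).symm
      (homsHom_map_heq H m p).symm
    rw [← Category.assoc, ← H.map_comp, Multitensor.incl_gammaMap, H.map_comp, Category.assoc,
      incl_gammaHom, ← Category.assoc (H.map (E.E.map _)), L.natural, Category.assoc,
      ← Category.assoc (F.E.map (mapHom _ _)), ← F.E.map_comp, h, F.E.map_comp, Category.assoc,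
      ← Category.assoc _ (L.gammaHom hH C a b), incl_gammaHom, Category.assoc, Category.assoc,
      Multitensor.incl_gammaMap]

lemma gammaHom_unit (C : S → S → V) (a b : S) :
    H.map (E.gammaUnit C a b) ≫ L.gammaHom hH C a b =
      F.gammaUnit (fun x y => H.obj (C x y)) a b := by
  have h : H.map (E.inclSingle C a b) ≫ L.gammaHom hH C a b =
      L.ψ [C a b] ≫ F.inclSingle (fun x y => H.obj (C x y)) a b := by
    refine (L.incl_gammaHom hH C (single a b)).trans ?_
    exact congrArg (_ ≫ ·) ((congrArg (· ≫ _) (F.E.map_id _)).trans (Category.id_comp _))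
  rw [Multitensor.gammaUnit, H.map_comp, Category.assoc, h, ← Category.assoc, L.unit]
  rfl

lemma nestedIncl_idHoms (C : S → S → V) : {a b : S} → (p : ObjSeq a b) → (c : p.Nested) →
    mapHom H (E.nestedIncl C p c) ≫ eqToHom (homs_map (E.gammaHom C) H.obj p).symm ≫
        idHoms (L.gammaHom hH C) p =
      seqOf₂ L.ψ (p.nestedHoms C c) ≫ eqToHom (by rw [nestedHoms_map]) ≫ F.nestedIncl _ p c
  | _, _, nil _, _ => rfl
  | _, _, cons a (b := b) p, c => by
    have h1 := consHom_eqToHom (rfl : H.obj (E.gammaHom C a b) = _)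
      (homs_map (E.gammaHom C) H.obj p).symm
    have h2 := consHom_eqToHom (congrArg F.E.obj (homs_map C H.obj c.1).symm)
      (congrArg (List.map F.E.obj) (nestedHoms_map C H.obj p c.2).symm)
    refine (congrArg (fun t => mapHom H (E.nestedIncl C (ObjSeq.cons a p) c) ≫ t ≫
      idHoms (L.gammaHom hH C) (ObjSeq.cons a p)) h1.symm).trans ?_
    refine Eq.trans ?_ (congrArg (fun t => seqOf₂ L.ψ ((ObjSeq.cons a p).nestedHoms C c) ≫ t ≫
        F.nestedIncl _ (ObjSeq.cons a p) c) h2)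
    refine congrArg₂ consHom ?_ (nestedIncl_idHoms C p c.2)
    rw [eqToHom_refl, Category.id_comp, incl_gammaHom, eqToHom_map]

lemma gammaHom_mul (hE : Multitensor.Distributive.{w} E) (hF : Multitensor.Distributive.{w} F)
    (C : S → S → V) (a b : S) :
    H.map (Multitensor.gammaMul hE C a b) ≫ L.gammaHom hH C a b =
      L.gammaHom hH (E.gammaHom C) a b ≫ F.gammaMap (f := fun x => x) (L.gammaHom hH C) a b ≫
        Multitensor.gammaMul hF (fun x y => H.obj (C x y)) a b :=
  map_incl₂_hom_ext hH hE C fun p c => by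
    have e := Multitensor.incl₂_gammaMul hF (fun x y => H.obj (C x y)) p c
    have h1 : H.map (E.incl₂ C p c) ≫ L.gammaHom hH (E.gammaHom C) a b ≫
        F.gammaMap (f := fun x => x) (L.gammaHom hH C) a b =
        L.ψ ((p.nestedHoms C c).map E.E.obj) ≫ F.E.map (seqOf₂ L.ψ (p.nestedHoms C c)) ≫
          F.E.map (eqToHom (by rw [nestedHoms_map])) ≫ F.incl₂ _ p c := by
      rw [Multitensor.incl₂, H.map_comp, Category.assoc, ← Category.assoc (H.map (E.incl _ _)),
        incl_gammaHom, Category.assoc, Category.assoc, Multitensor.incl_gammaMap_id,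
        ← Category.assoc, L.natural, Category.assoc, ← Category.assoc (F.E.map (eqToHom _)),
        ← F.E.map_comp, ← Category.assoc (F.E.map (mapHom _ _)), ← F.E.map_comp,
        nestedIncl_idHoms, F.E.map_comp, F.E.map_comp, Category.assoc, Category.assoc]
      rfl
    have h2 := congrArg (· ≫ Multitensor.gammaMul hF (fun x y => H.obj (C x y)) a b) h1
    simp only [Category.assoc] at h2
    rw [← Category.assoc, ← H.map_comp, Multitensor.incl₂_gammaMul, H.map_comp, Category.assoc,
      incl'_gammaHom, h2, e,
      ← Category.assoc (F.E.map (eqToHom _)),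
      Multitensor.σ_cast F (nestedHoms_map C H.obj p c).symm, Category.assoc,
      Multitensor.map_incl', ← Category.assoc, ← L.subst, Category.assoc, Category.assoc,
      Category.assoc, Multitensor.map_incl']

/-- The monad opfunctor `(𝒢H, Γ'(ψ)) : (𝒢V, ΓE) ⟶ (𝒢W, ΓF)`. -/
noncomputable def gamma (hE : Multitensor.Distributive.{w} E)
    (hF : Multitensor.Distributive.{w} F) :
    MonadOpfunctorStr (E.gamma hE) (F.gamma hF) (EGraph.map H) (EGraph.map_over H) where
  ψ := {
    app := fun X => ⟨fun a => a, L.gammaHom hH X.hom⟩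
    naturality := fun _ _ f => EGraph.hom_ext fun a b => L.gammaHom_natural hH f.hom a b }
  over_set _ := rfl
  unit X := EGraph.hom_ext fun a b => L.gammaHom_unit hH X.hom a b
  mul X := EGraph.hom_ext fun a b => L.gammaHom_mul hH hE hF X.hom a b

end OplaxStr

end GammaLax

/-! ### The 2-categories of distributive multitensors -/

section SeqLemmas

variable {V : Type u} [Category.{v} V] {W : Type u'} [Category.{v'} W]

lemma seqOf_id {A : Type*} (f : A → V) : (l : List A) → seqOf (fun a => 𝟙 (f a)) l = 𝟙 (l.map f)
  | [] => rfl
  | a :: l => congrArg (consHom (𝟙 (f a))) (seqOf_id f l)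

lemma seqOf_comp {A : Type*} {f g h : A → V} (α : ∀ a, f a ⟶ g a) (β : ∀ a, g a ⟶ h a) :
    (l : List A) → seqOf (fun a => α a ≫ β a) l = seqOf α l ≫ seqOf β l
  | [] => rfl
  | a :: l => congrArg (consHom (α a ≫ β a)) (seqOf_comp α β l)

lemma seqOf_map {A B : Type*} (h : A → B) {f g : B → V} (α : ∀ b, f b ⟶ g b) :
    (l : List A) → HEq (seqOf (fun a => α (h a)) l) (seqOf α (l.map h))
  | [] => HEq.rfl
  | a :: l => consHom_heq (α (h a)) (by rw [List.map_map]; rfl) (by rw [List.map_map]; rfl)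
      (seqOf_map h α l)

lemma seqOf_functor {A : Type*} (K : V ⥤ W) {f g : A → V} (α : ∀ a, f a ⟶ g a) :
    (l : List A) → HEq (seqOf (fun a => K.map (α a)) l) (mapHom K (seqOf α l))
  | [] => HEq.rfl
  | a :: l => consHom_heq (K.map (α a)) (by rw [List.map_map]; rfl) (by rw [List.map_map]; rfl)
      (seqOf_functor K α l)

lemma mapHom_id_heq : {X Y : List V} → (f : X ⟶ Y) → HEq (mapHom (𝟭 V) f) f
  | _, _, SeqHom.nil => HEq.rfl
  | _, _, SeqHom.cons f fs => consHom_heq f (List.map_id _) (List.map_id _) (mapHom_id_heq fs)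

lemma mapHom_comp_heq {U : Type u''} [Category.{v''} U] (H : V ⥤ W) (K : W ⥤ U) :
    {X Y : List V} → (f : X ⟶ Y) → HEq (mapHom (H ⋙ K) f) (mapHom K (mapHom H f))
  | _, _, SeqHom.nil => HEq.rfl
  | _, _, SeqHom.cons f fs => consHom_heq (K.map (H.map f)) (by rw [List.map_map]; rfl)
      (by rw [List.map_map]; rfl) (mapHom_comp_heq H K fs)

lemma seqOf₂_eqToHom {A B C : Type*} {f : A → B} {f' : B → V} {g : A → C} {g' : C → V}
    (h : ∀ a, f' (f a) = g' (g a)) : (l : List A) →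
    seqOf₂ (fun a => eqToHom (h a)) l = eqToHom (by simp [h])
  | [] => rfl
  | a :: l => by
    refine (congrArg (consHom _) (seqOf₂_eqToHom h l)).trans ?_
    exact consHom_eqToHom _ _

end SeqLemmas

section LaxComp

variable {V : Type u} [Category.{v} V] {W : Type u'} [Category.{v'} W]
  {U : Type u''} [Category.{v''} U]

lemma map_id_obj_eq (Z : List V) : Z.map (𝟭 V).obj = Z := List.map_id Z

lemma map_comp_obj_eq (H : V ⥤ W) (K : W ⥤ U) (Z : List V) :
    Z.map (H ⋙ K).obj = (Z.map H.obj).map K.obj := by rw [List.map_map]; rfl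

lemma map_map_id_obj_eq (Z : List (List V)) : Z.map (List.map (𝟭 V).obj) = Z := by
  rw [show List.map (𝟭 V).obj = id from funext map_id_obj_eq, List.map_id]

lemma map_map_comp_obj_eq (H : V ⥤ W) (K : W ⥤ U) (Z : List (List V)) :
    Z.map (List.map (H ⋙ K).obj) = (Z.map (List.map H.obj)).map (List.map K.obj) := by
  rw [List.map_map]
  exact congrArg (fun f => Z.map f) (funext (map_comp_obj_eq H K))

lemma mapHom_eqToHom (H : V ⥤ W) {Z Z' : List V} (h : Z = Z') :
    mapHom H (eqToHom h) = eqToHom (congrArg (List.map H.obj) h) := by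
  subst h
  induction Z with
  | nil => rfl
  | cons a Z ih => exact congrArg₂ consHom (H.map_id a) ih

/-- The identity lax monoidal functor. -/
def LaxStr.id (E : Multitensor V) : LaxStr E E (𝟭 V) where
  ψ Z := E.E.map (eqToHom (map_id_obj_eq Z))
  natural f := by
    have h := comp_eqToHom_of_heq (map_id_obj_eq _) (map_id_obj_eq _) (mapHom_id_heq f)
    rw [← E.E.map_comp, h, E.E.map_comp]
    rfl
  unit X := (congrArg (E.u X ≫ ·) (E.E.map_id _)).trans (Category.comp_id _)
  subst Z := by
    have h : seqOf₂ (f := List.map (𝟭 V).obj) (f' := E.E.obj) (g := E.E.obj) (g' := (𝟭 V).obj)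
        (fun Y => E.E.map (eqToHom (map_id_obj_eq Y))) Z =
        eqToHom (by rw [map_map_id_obj_eq, map_id_obj_eq]) := by
      refine Eq.trans ?_ (seqOf₂_eqToHom (f := List.map (𝟭 V).obj) (f' := E.E.obj)
        (g := E.E.obj) (g' := (𝟭 V).obj) (fun Y => congrArg E.E.obj (map_id_obj_eq Y)) Z)
      exact congrArg (fun t => seqOf₂ t Z) (funext fun Y => eqToHom_map E.E _)
    rw [h, Functor.id_map, ← Category.assoc, ← E.E.map_comp, eqToHom_trans,
      Multitensor.σ_cast E (map_map_id_obj_eq Z), ← E.E.map_comp, eqToHom_trans]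

lemma seqOf₂_comp_ψ {E : Multitensor V} {F : Multitensor W} {G : Multitensor U} {H : V ⥤ W}
    {K : W ⥤ U} (L : LaxStr E F H) (M : LaxStr F G K) : (Z : List (List V)) →
    seqOf₂ (f := List.map (H ⋙ K).obj) (f' := G.E.obj) (g := E.E.obj) (g' := (H ⋙ K).obj)
      (fun Y => G.E.map (eqToHom (map_comp_obj_eq H K Y)) ≫ M.ψ (Y.map H.obj) ≫ K.map (L.ψ Y)) Z =
      eqToHom (congrArg (List.map G.E.obj) (map_map_comp_obj_eq H K Z)) ≫ seqOf₂ M.ψ (Z.map (List.map H.obj)) ≫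
        mapHom K (seqOf₂ L.ψ Z) ≫ eqToHom (map_comp_obj_eq H K (Z.map E.E.obj)).symm
  | [] => rfl
  | Y :: Z => by
    have h1 := consHom_eqToHom (congrArg G.E.obj (map_comp_obj_eq H K Y))
      (congrArg (List.map G.E.obj) (map_map_comp_obj_eq H K Z))
    have h2 := consHom_eqToHom (rfl : K.obj (H.obj (E.E.obj Y)) = _)
      (map_comp_obj_eq H K (Z.map E.E.obj)).symm
    refine Eq.trans ?_ (congrArg₂ (fun s t => s ≫ seqOf₂ M.ψ ((Y :: Z).map (List.map H.obj)) ≫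
        mapHom K (seqOf₂ L.ψ (Y :: Z)) ≫ t) h1 h2)
    refine congrArg₂ consHom ?_ (seqOf₂_comp_ψ L M Z)
    rw [eqToHom_refl _ rfl, Category.comp_id]
    exact congrArg (· ≫ _) (eqToHom_map G.E _)

/-- The composite of two lax monoidal functors. -/
def LaxStr.comp {E : Multitensor V} {F : Multitensor W} {G : Multitensor U} {H : V ⥤ W}
    {K : W ⥤ U} (L : LaxStr E F H) (M : LaxStr F G K) : LaxStr E G (H ⋙ K) where
  ψ Z := G.E.map (eqToHom (map_comp_obj_eq H K Z)) ≫ M.ψ (Z.map H.obj) ≫ K.map (L.ψ Z)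
  natural f := by
    have h := comp_eqToHom_of_heq (map_comp_obj_eq H K _) (map_comp_obj_eq H K _)
      (mapHom_comp_heq H K f)
    rw [← Category.assoc, ← G.E.map_comp, h, G.E.map_comp, Category.assoc,
      ← Category.assoc (G.E.map (mapHom _ _)), M.natural, Category.assoc, ← K.map_comp,
      L.natural, K.map_comp, Category.assoc, Category.assoc]
    rfl
  unit X := by
    have h : G.E.map (eqToHom (map_comp_obj_eq H K [X])) ≫ M.ψ ([X].map H.obj) ≫
      K.map (L.ψ [X]) = M.ψ [H.obj X] ≫ K.map (L.ψ [X]) :=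
      (congrArg (· ≫ _) (G.E.map_id _)).trans (Category.id_comp _)
    refine (congrArg (G.u _ ≫ ·) h).trans ?_
    refine (Category.assoc _ _ _).symm.trans ?_
    refine (congrArg (· ≫ _) (M.unit (H.obj X))).trans ?_
    refine (K.map_comp _ _).symm.trans ?_
    exact congrArg K.map (L.unit X)
  subst Z := by
    rw [seqOf₂_comp_ψ]
    have h1 := congrArg K.map (L.subst Z)
    have h2 := M.subst (Z.map (List.map H.obj))
    have h3 := M.natural (seqOf₂ L.ψ Z)
    simp only [K.map_comp] at h1
    have h4 := Multitensor.σ_cast G (map_map_comp_obj_eq H K Z)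
      (congrArg (List.map G.E.obj) (map_map_comp_obj_eq H K Z))
    have h5 := M.natural (eqToHom (map_flatten_eq H.obj Z))
    rw [mapHom_eqToHom] at h5
    have h6 : G.E.map (eqToHom (map_comp_obj_eq H K (Z.map E.E.obj)).symm) ≫
      G.E.map (eqToHom (map_comp_obj_eq H K (Z.map E.E.obj))) = 𝟙 _ := by
      rw [← G.E.map_comp, eqToHom_trans, eqToHom_refl, G.E.map_id]
    simp only [G.E.map_comp, Category.assoc, Functor.comp_map]
    rw [← Category.assoc (G.E.map _) (G.E.map _) (M.ψ _ ≫ _), h6, Category.id_comp,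
      ← Category.assoc _ (M.ψ _), h3, Category.assoc, h1, ← Category.assoc (M.ψ _),
      ← Category.assoc (G.E.map (seqOf₂ _ _)), h2, Category.assoc, Category.assoc,
      ← Category.assoc (M.ψ _), ← h5, ← Category.assoc _ (G.σ _), h4]
    simp only [eqToHom_map, Category.assoc, eqToHom_trans_assoc]

@[ext]
lemma LaxStr.ext' {E : Multitensor V} {F : Multitensor W} {H : V ⥤ W} {L M : LaxStr E F H}
    (h : ∀ Z, L.ψ Z = M.ψ Z) : L = M := LaxStr.ext (funext h)

/-- The identity oplax monoidal functor. -/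
def OplaxStr.id (E : Multitensor V) : OplaxStr E E (𝟭 V) where
  ψ Z := E.E.map (eqToHom (map_id_obj_eq Z).symm)
  natural f := by
    have h := comp_eqToHom_of_heq (map_id_obj_eq _).symm (map_id_obj_eq _).symm
      (mapHom_id_heq f).symm
    rw [← E.E.map_comp, ← h, E.E.map_comp]
    rfl
  unit X := (congrArg (E.u X ≫ ·) (E.E.map_id _)).trans (Category.comp_id _)
  subst Z := by
    have h : seqOf₂ (f := E.E.obj) (f' := (𝟭 V).obj) (g := List.map (𝟭 V).obj) (g' := E.E.obj)
        (fun Y => E.E.map (eqToHom (map_id_obj_eq Y).symm)) Z =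
        eqToHom (by rw [map_map_id_obj_eq, map_id_obj_eq]) := by
      refine Eq.trans ?_ (seqOf₂_eqToHom (f := E.E.obj) (f' := (𝟭 V).obj)
        (g := List.map (𝟭 V).obj) (g' := E.E.obj)
        (fun Y => congrArg E.E.obj (map_id_obj_eq Y).symm) Z)
      exact congrArg (fun t => seqOf₂ t Z) (funext fun Y => eqToHom_map E.E _)
    rw [h, Functor.id_map, ← Category.assoc, ← E.E.map_comp, eqToHom_trans, ← Category.assoc,
      Multitensor.σ_cast E (map_map_id_obj_eq Z).symm, Category.assoc, ← E.E.map_comp,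
      eqToHom_trans]

lemma OplaxStr.seqOf₂_comp_ψ {E : Multitensor V} {F : Multitensor W} {G : Multitensor U}
    {H : V ⥤ W} {K : W ⥤ U} (L : OplaxStr E F H) (M : OplaxStr F G K) : (Z : List (List V)) →
    seqOf₂ (f := E.E.obj) (f' := (H ⋙ K).obj) (g := List.map (H ⋙ K).obj) (g' := G.E.obj)
      (fun Y => K.map (L.ψ Y) ≫ M.ψ (Y.map H.obj) ≫
        G.E.map (eqToHom (map_comp_obj_eq H K Y).symm)) Z =
      eqToHom (map_comp_obj_eq H K (Z.map E.E.obj)) ≫ mapHom K (seqOf₂ L.ψ Z) ≫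
        seqOf₂ M.ψ (Z.map (List.map H.obj)) ≫
          eqToHom (congrArg (List.map G.E.obj) (map_map_comp_obj_eq H K Z).symm)
  | [] => rfl
  | Y :: Z => by
    have h1 := consHom_eqToHom (congrArg G.E.obj (map_comp_obj_eq H K Y).symm)
      (congrArg (List.map G.E.obj) (map_map_comp_obj_eq H K Z).symm)
    have h2 := consHom_eqToHom (rfl : K.obj (H.obj (E.E.obj Y)) = _)
      (map_comp_obj_eq H K (Z.map E.E.obj))
    refine Eq.trans ?_ (congrArg₂ (fun s t => s ≫ mapHom K (seqOf₂ L.ψ (Y :: Z)) ≫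
      seqOf₂ M.ψ ((Y :: Z).map (List.map H.obj)) ≫ t) h2 h1)
    refine congrArg₂ consHom ?_ (OplaxStr.seqOf₂_comp_ψ L M Z)
    rw [eqToHom_refl _ rfl, Category.id_comp]
    exact congrArg (fun t => K.map (L.ψ Y) ≫ M.ψ (Y.map H.obj) ≫ t) (eqToHom_map G.E _)

/-- The composite of two oplax monoidal functors. -/
def OplaxStr.comp {E : Multitensor V} {F : Multitensor W} {G : Multitensor U} {H : V ⥤ W}
    {K : W ⥤ U} (L : OplaxStr E F H) (M : OplaxStr F G K) : OplaxStr E G (H ⋙ K) where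
  ψ Z := K.map (L.ψ Z) ≫ M.ψ (Z.map H.obj) ≫ G.E.map (eqToHom (map_comp_obj_eq H K Z).symm)
  natural f := by
    have h := comp_eqToHom_of_heq (map_comp_obj_eq H K _).symm (map_comp_obj_eq H K _).symm
      (mapHom_comp_heq H K f).symm
    rw [Category.assoc, Category.assoc, ← G.E.map_comp, ← h, G.E.map_comp,
      ← Category.assoc (M.ψ _) (G.E.map (mapHom _ _)), ← M.natural, Category.assoc,
      ← Category.assoc (K.map _) (K.map _), ← K.map_comp, ← L.natural, K.map_comp,
      Category.assoc]
    rfl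
  unit X := by
    have h : K.map (L.ψ [X]) ≫ M.ψ ([X].map H.obj) ≫
      G.E.map (eqToHom (map_comp_obj_eq H K [X]).symm) = K.map (L.ψ [X]) ≫ M.ψ [H.obj X] :=
      congrArg (K.map (L.ψ [X]) ≫ ·)
        ((congrArg (_ ≫ ·) (G.E.map_id _)).trans (Category.comp_id _))
    refine (congrArg (_ ≫ ·) h).trans ?_
    refine (Category.assoc _ _ _).symm.trans ?_
    refine (congrArg (· ≫ _) (K.map_comp _ _).symm).trans ?_
    refine (congrArg (fun t => K.map t ≫ _) (L.unit X)).trans ?_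
    exact M.unit (H.obj X)
  subst Z := by
    rw [OplaxStr.seqOf₂_comp_ψ]
    have h1 := congrArg K.map (L.subst Z)
    have h2 := M.subst (Z.map (List.map H.obj))
    have h3 := M.natural (seqOf₂ L.ψ Z)
    simp only [K.map_comp] at h1
    have h4 := Multitensor.σ_cast G (map_map_comp_obj_eq H K Z).symm
      (congrArg (List.map G.E.obj) (map_map_comp_obj_eq H K Z).symm)
    have h5 := M.natural (eqToHom (map_flatten_eq H.obj Z))
    rw [mapHom_eqToHom] at h5
    have h6 : G.E.map (eqToHom (map_comp_obj_eq H K (Z.map E.E.obj)).symm) ≫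
      G.E.map (eqToHom (map_comp_obj_eq H K (Z.map E.E.obj))) = 𝟙 _ := by
      rw [← G.E.map_comp, eqToHom_trans, eqToHom_refl, G.E.map_id]
    simp only [G.E.map_comp, Category.assoc, Functor.comp_map]
    rw [← Category.assoc (G.E.map _) (G.E.map _) (G.E.map (mapHom _ _) ≫ _), h6,
      Category.id_comp, ← Category.assoc (M.ψ _) (G.E.map (mapHom _ _)), ← h3, Category.assoc,
      ← Category.assoc _ (G.σ _), h4, Category.assoc,
      ← Category.assoc (K.map (H.map _)), ← h1, Category.assoc, Category.assoc, Category.assoc,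
      ← Category.assoc (K.map (F.E.map (eqToHom _))) (M.ψ _), h5, Category.assoc,
      ← Category.assoc (K.map (F.σ _)), ← h2]
    simp only [eqToHom_map, Category.assoc, eqToHom_trans]

@[ext]
lemma OplaxStr.ext' {E : Multitensor V} {F : Multitensor W} {H : V ⥤ W} {L M : OplaxStr E F H}
    (h : ∀ Z, L.ψ Z = M.ψ Z) : L = M := OplaxStr.ext (funext h)

end LaxComp

section Cells

variable {V : Type u} [Category.{v} V] {W : Type u'} [Category.{v'} W]
  {U : Type u''} [Category.{v''} U] {E : Multitensor V} {F : Multitensor W} {G : Multitensor U}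

/-- Monoidal natural transformations between lax monoidal functors. -/
def LaxStr.IsMonoidal {H K : V ⥤ W} (L : LaxStr E F H) (M : LaxStr E F K) (φ : H ⟶ K) : Prop :=
  ∀ Z : List V, L.ψ Z ≫ φ.app (E.E.obj Z) = F.E.map (seqOf (fun X => φ.app X) Z) ≫ M.ψ Z

/-- Monoidal natural transformations between oplax monoidal functors. -/
def OplaxStr.IsMonoidal {H K : V ⥤ W} (L : OplaxStr E F H) (M : OplaxStr E F K) (φ : H ⟶ K) :
    Prop :=
  ∀ Z : List V, φ.app (E.E.obj Z) ≫ M.ψ Z = L.ψ Z ≫ F.E.map (seqOf (fun X => φ.app X) Z)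

lemma LaxStr.IsMonoidal.id {H : V ⥤ W} (L : LaxStr E F H) : L.IsMonoidal L (𝟙 H) := fun Z => by
  have h : seqOf (fun X => (𝟙 H : H ⟶ H).app X) Z = 𝟙 (Z.map H.obj) := seqOf_id H.obj Z
  rw [h, F.E.map_id, Category.id_comp]
  exact Category.comp_id _

lemma LaxStr.IsMonoidal.comp {H K J : V ⥤ W} {L : LaxStr E F H} {M : LaxStr E F K}
    {N : LaxStr E F J} {φ : H ⟶ K} {χ : K ⟶ J} (hφ : L.IsMonoidal M φ) (hχ : M.IsMonoidal N χ) :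
    L.IsMonoidal N (φ ≫ χ) := fun Z => by
  have h : seqOf (fun X => (φ ≫ χ).app X) Z = _ :=
    seqOf_comp (fun X => φ.app X) (fun X => χ.app X) Z
  rw [h, F.E.map_comp, Category.assoc, ← hχ Z, ← Category.assoc, ← hφ Z, Category.assoc]
  rfl

lemma LaxStr.IsMonoidal.whiskerLeft {H : V ⥤ W} (L : LaxStr E F H) {K J : W ⥤ U}
    {M : LaxStr F G K} {N : LaxStr F G J} {φ : K ⟶ J} (hφ : M.IsMonoidal N φ) :
    (L.comp M).IsMonoidal (L.comp N) (Functor.whiskerLeft H φ) := fun Z => by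
  have h := comp_eqToHom_of_heq (map_comp_obj_eq H K Z) (map_comp_obj_eq H J Z)
    (seqOf_map H.obj (fun X => φ.app X) Z)
  change (G.E.map _ ≫ M.ψ _ ≫ K.map (L.ψ Z)) ≫ φ.app (H.obj (E.E.obj Z)) =
    G.E.map (seqOf (fun X => φ.app (H.obj X)) Z) ≫ G.E.map _ ≫ N.ψ _ ≫ J.map (L.ψ Z)
  rw [← Category.assoc (G.E.map (seqOf _ _)), ← G.E.map_comp]
  refine Eq.trans ?_ (congrArg (fun t => G.E.map t ≫ N.ψ (Z.map H.obj) ≫ J.map (L.ψ Z)) h).symm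
  rw [G.E.map_comp, Category.assoc, Category.assoc, Category.assoc, φ.naturality,
    ← Category.assoc (M.ψ _), hφ, Category.assoc]

lemma LaxStr.IsMonoidal.whiskerRight {H J : V ⥤ W} {L : LaxStr E F H} {N : LaxStr E F J}
    {φ : H ⟶ J} (hφ : L.IsMonoidal N φ) {K : W ⥤ U} (M : LaxStr F G K) :
    (L.comp M).IsMonoidal (N.comp M) (Functor.whiskerRight φ K) := fun Z => by
  have h := comp_eqToHom_of_heq (map_comp_obj_eq H K Z) (map_comp_obj_eq J K Z)
    (seqOf_functor K (fun X => φ.app X) Z)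
  change (G.E.map _ ≫ M.ψ _ ≫ K.map (L.ψ Z)) ≫ K.map (φ.app (E.E.obj Z)) =
    G.E.map (seqOf (fun X => K.map (φ.app X)) Z) ≫ G.E.map _ ≫ M.ψ _ ≫ K.map (N.ψ Z)
  rw [← Category.assoc (G.E.map (seqOf _ _)), ← G.E.map_comp]
  refine Eq.trans ?_ (congrArg (fun t => G.E.map t ≫ M.ψ (Z.map J.obj) ≫ K.map (N.ψ Z)) h).symm
  rw [G.E.map_comp, Category.assoc, Category.assoc, Category.assoc, ← K.map_comp, hφ,
    ← Category.assoc _ (M.ψ _) (K.map (N.ψ Z)), M.natural, Category.assoc, K.map_comp]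

lemma OplaxStr.IsMonoidal.id {H : V ⥤ W} (L : OplaxStr E F H) : L.IsMonoidal L (𝟙 H) :=
  fun Z => by
  have h : seqOf (fun X => (𝟙 H : H ⟶ H).app X) Z = 𝟙 (Z.map H.obj) := seqOf_id H.obj Z
  rw [h, F.E.map_id, Category.comp_id]
  exact Category.id_comp _

lemma OplaxStr.IsMonoidal.comp {H K J : V ⥤ W} {L : OplaxStr E F H} {M : OplaxStr E F K}
    {N : OplaxStr E F J} {φ : H ⟶ K} {χ : K ⟶ J} (hφ : L.IsMonoidal M φ)
    (hχ : M.IsMonoidal N χ) : L.IsMonoidal N (φ ≫ χ) := fun Z => by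
  have h : seqOf (fun X => (φ ≫ χ).app X) Z = _ :=
    seqOf_comp (fun X => φ.app X) (fun X => χ.app X) Z
  rw [h, F.E.map_comp, ← Category.assoc, ← hφ Z, Category.assoc, ← hχ Z, ← Category.assoc]
  rfl

lemma OplaxStr.IsMonoidal.whiskerLeft {H : V ⥤ W} (L : OplaxStr E F H) {K J : W ⥤ U}
    {M : OplaxStr F G K} {N : OplaxStr F G J} {φ : K ⟶ J} (hφ : M.IsMonoidal N φ) :
    (L.comp M).IsMonoidal (L.comp N) (Functor.whiskerLeft H φ) := fun Z => by
  have h := comp_eqToHom_of_heq (map_comp_obj_eq H K Z).symm (map_comp_obj_eq H J Z).symm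
    (seqOf_map H.obj (fun X => φ.app X) Z).symm
  change φ.app (H.obj (E.E.obj Z)) ≫ J.map (L.ψ Z) ≫ N.ψ _ ≫ G.E.map _ =
    (K.map (L.ψ Z) ≫ M.ψ _ ≫ G.E.map _) ≫ G.E.map (seqOf (fun X => φ.app (H.obj X)) Z)
  rw [Category.assoc, Category.assoc, ← G.E.map_comp]
  refine Eq.trans ?_ (congrArg (fun t => K.map (L.ψ Z) ≫ M.ψ (Z.map H.obj) ≫ G.E.map t) h)
  rw [G.E.map_comp, ← Category.assoc, ← φ.naturality, Category.assoc, ← Category.assoc (φ.app _),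
    hφ, Category.assoc]

lemma OplaxStr.IsMonoidal.whiskerRight {H J : V ⥤ W} {L : OplaxStr E F H} {N : OplaxStr E F J}
    {φ : H ⟶ J} (hφ : L.IsMonoidal N φ) {K : W ⥤ U} (M : OplaxStr F G K) :
    (L.comp M).IsMonoidal (N.comp M) (Functor.whiskerRight φ K) := fun Z => by
  have h := comp_eqToHom_of_heq (map_comp_obj_eq H K Z).symm (map_comp_obj_eq J K Z).symm
    (seqOf_functor K (fun X => φ.app X) Z).symm
  change K.map (φ.app (E.E.obj Z)) ≫ K.map (N.ψ Z) ≫ M.ψ _ ≫ G.E.map _ =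
    (K.map (L.ψ Z) ≫ M.ψ _ ≫ G.E.map _) ≫ G.E.map (seqOf (fun X => K.map (φ.app X)) Z)
  rw [Category.assoc, Category.assoc, ← G.E.map_comp]
  refine Eq.trans ?_ (congrArg (fun t => K.map (L.ψ Z) ≫ M.ψ (Z.map H.obj) ≫ G.E.map t) h)
  rw [G.E.map_comp, ← Category.assoc, ← K.map_comp, hφ, K.map_comp, Category.assoc,
    ← Category.assoc _ (M.ψ _), M.natural, Category.assoc]

lemma LaxStr.id_comp {H : V ⥤ W} (L : LaxStr E F H) : (LaxStr.id E).comp L = L :=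
  LaxStr.ext' fun Z => by
    change F.E.map _ ≫ L.ψ _ ≫ H.map (E.E.map _) = L.ψ Z
    rw [← L.natural, mapHom_eqToHom, ← Category.assoc, ← F.E.map_comp, eqToHom_trans]
    exact (congrArg (· ≫ L.ψ Z) (F.E.map_id _)).trans (Category.id_comp _)

lemma LaxStr.comp_id {H : V ⥤ W} (L : LaxStr E F H) : L.comp (LaxStr.id F) = L :=
  LaxStr.ext' fun Z => by
    change F.E.map _ ≫ F.E.map _ ≫ L.ψ Z = L.ψ Z
    rw [← Category.assoc, ← F.E.map_comp, eqToHom_trans]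
    exact (congrArg (· ≫ L.ψ Z) (F.E.map_id _)).trans (Category.id_comp _)

lemma OplaxStr.id_comp {H : V ⥤ W} (L : OplaxStr E F H) : (OplaxStr.id E).comp L = L :=
  OplaxStr.ext' fun Z => by
    change H.map (E.E.map _) ≫ L.ψ _ ≫ F.E.map _ = L.ψ Z
    rw [← Category.assoc, L.natural, mapHom_eqToHom, Category.assoc, ← F.E.map_comp,
      eqToHom_trans]
    exact (congrArg (L.ψ Z ≫ ·) (F.E.map_id _)).trans (Category.comp_id _)

lemma OplaxStr.comp_id {H : V ⥤ W} (L : OplaxStr E F H) : L.comp (OplaxStr.id F) = L :=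
  OplaxStr.ext' fun Z => by
    change L.ψ Z ≫ F.E.map _ ≫ F.E.map _ = L.ψ Z
    rw [← F.E.map_comp, eqToHom_trans]
    exact (congrArg (L.ψ Z ≫ ·) (F.E.map_id _)).trans (Category.comp_id _)

variable {T : Type*} [Category* T] {D : Multitensor T}

lemma LaxStr.assoc {H : V ⥤ W} {K : W ⥤ U} {J : U ⥤ T} (L : LaxStr E F H) (M : LaxStr F G K)
    (N : LaxStr G D J) : (L.comp M).comp N = L.comp (M.comp N) :=
  LaxStr.ext' fun Z => by
    change D.E.map _ ≫ N.ψ (Z.map (H ⋙ K).obj) ≫ J.map (G.E.map _ ≫ M.ψ _ ≫ K.map (L.ψ Z)) =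
      D.E.map _ ≫ (D.E.map _ ≫ N.ψ ((Z.map H.obj).map K.obj) ≫ J.map (M.ψ _)) ≫
        J.map (K.map (L.ψ Z))
    rw [J.map_comp, J.map_comp, ← Category.assoc (N.ψ _), ← N.natural, mapHom_eqToHom]
    simp only [Category.assoc, eqToHom_map, eqToHom_trans_assoc]

lemma OplaxStr.assoc {H : V ⥤ W} {K : W ⥤ U} {J : U ⥤ T} (L : OplaxStr E F H)
    (M : OplaxStr F G K) (N : OplaxStr G D J) : (L.comp M).comp N = L.comp (M.comp N) :=
  OplaxStr.ext' fun Z => by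
    change J.map (K.map (L.ψ Z) ≫ M.ψ _ ≫ G.E.map _) ≫ N.ψ (Z.map (H ⋙ K).obj) ≫ D.E.map _ =
      J.map (K.map (L.ψ Z)) ≫ (J.map (M.ψ _) ≫ N.ψ ((Z.map H.obj).map K.obj) ≫ D.E.map _) ≫
        D.E.map _
    rw [J.map_comp, J.map_comp]
    simp only [Category.assoc]
    rw [← Category.assoc (J.map (G.E.map _)), N.natural, mapHom_eqToHom]
    simp only [Category.assoc, eqToHom_map, eqToHom_trans]

end Cells

/-! #### `DISTMULT` -/

/-- A distributive multitensor: a category `V` with coproducts, together with a distributive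
multitensor on `V`. -/
structure DistMult where
  V : Type u
  [cat : Category.{v} V]
  [coprod : HasCoproducts.{w} V]
  E : Multitensor V
  dist : Multitensor.Distributive.{w} E

attribute [instance] DistMult.cat DistMult.coprod

namespace DistMult

/-- Lax monoidal functors. -/
structure Hom (X Y : DistMult.{w, v, u}) where
  H : X.V ⥤ Y.V
  str : LaxStr X.E Y.E H

/-- Monoidal natural transformations. -/
@[ext] structure Hom₂ {X Y : DistMult.{w, v, u}} (f g : Hom X Y) where
  φ : f.H ⟶ g.H
  monoidal : f.str.IsMonoidal g.str φ

instance : CategoryStruct DistMult.{w, v, u} where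
  Hom := Hom
  id X := ⟨𝟭 X.V, LaxStr.id X.E⟩
  comp f g := ⟨f.H ⋙ g.H, f.str.comp g.str⟩

instance homCat (X Y : DistMult.{w, v, u}) : Category (X ⟶ Y) where
  Hom f g := Hom₂ f g
  id f := ⟨𝟙 f.H, .id f.str⟩
  comp α β := ⟨α.φ ≫ β.φ, α.monoidal.comp β.monoidal⟩
  id_comp α := Hom₂.ext (Category.id_comp α.φ)
  comp_id α := Hom₂.ext (Category.comp_id α.φ)
  assoc α β γ := Hom₂.ext (Category.assoc α.φ β.φ γ.φ)

@[ext] lemma hom₂_ext {X Y : DistMult.{w, v, u}} {f g : X ⟶ Y} {α β : f ⟶ g}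
    (h : ∀ Z : X.V, α.φ.app Z = β.φ.app Z) : α = β := Hom₂.ext (NatTrans.ext (funext h))

lemma comp_app {X Y : DistMult.{w, v, u}} {f g h : X ⟶ Y} (α : f ⟶ g) (β : g ⟶ h) (Z : X.V) :
    (α ≫ β).φ.app Z = α.φ.app Z ≫ β.φ.app Z := rfl

lemma eqToHom_app {X Y : DistMult.{w, v, u}} {f g : X ⟶ Y} (h : f = g) (Z : X.V) :
    (eqToHom h).φ.app Z = eqToHom (by rw [h]) := by
  subst h; rfl

lemma hom_assoc {X Y Z W : DistMult.{w, v, u}} (f : X ⟶ Y) (g : Y ⟶ Z) (h : Z ⟶ W) :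
    (f ≫ g) ≫ h = f ≫ g ≫ h :=
  congrArg (Hom.mk (f.H ⋙ g.H ⋙ h.H)) (LaxStr.assoc f.str g.str h.str)

lemma hom_id_comp {X Y : DistMult.{w, v, u}} (f : X ⟶ Y) : 𝟙 X ≫ f = f :=
  congrArg (Hom.mk f.H) (LaxStr.id_comp f.str)

lemma hom_comp_id {X Y : DistMult.{w, v, u}} (f : X ⟶ Y) : f ≫ 𝟙 Y = f :=
  congrArg (Hom.mk f.H) (LaxStr.comp_id f.str)

/-- Whiskering on the left. -/
def wl {X Y Z : DistMult.{w, v, u}} (f : X ⟶ Y) {g h : Y ⟶ Z} (η : g ⟶ h) : f ≫ g ⟶ f ≫ h :=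
  Hom₂.mk (Functor.whiskerLeft f.H η.φ) (.whiskerLeft f.str η.monoidal)

/-- Whiskering on the right. -/
def wr {X Y Z : DistMult.{w, v, u}} {f g : X ⟶ Y} (η : f ⟶ g) (h : Y ⟶ Z) : f ≫ h ⟶ g ≫ h :=
  Hom₂.mk (Functor.whiskerRight η.φ h.H) (.whiskerRight η.monoidal h.str)

lemma wl_app {X Y Z : DistMult.{w, v, u}} (f : X ⟶ Y) {g h : Y ⟶ Z} (η : g ⟶ h) (A : X.V) :
    (wl f η).φ.app A = η.φ.app (f.H.obj A) := rfl

lemma wr_app {X Y Z : DistMult.{w, v, u}} {f g : X ⟶ Y} (η : f ⟶ g) (h : Y ⟶ Z) (A : X.V) :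
    (wr η h).φ.app A = h.H.map (η.φ.app A) := rfl

/-- The 2-category `DISTMULT`. -/
instance bicategory : Bicategory DistMult.{w, v, u} where
  homCategory X Y := homCat X Y
  whiskerLeft f _ _ η := wl f η
  whiskerRight η g := wr η g
  associator f g h := eqToIso (hom_assoc f g h)
  leftUnitor f := eqToIso (hom_id_comp f)
  rightUnitor f := eqToIso (hom_comp_id f)
  whiskerLeft_id f g := hom₂_ext fun Z => rfl
  whiskerLeft_comp f g h i η θ := hom₂_ext fun Z => rfl
  id_whiskerLeft η := hom₂_ext fun Z => by
    simp only [comp_app, eqToIso.hom, eqToIso.inv, eqToHom_app]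
    exact ((Category.id_comp _).trans (Category.comp_id _)).symm
  comp_whiskerLeft f g h h' η := hom₂_ext fun Z => by
    simp only [comp_app, eqToIso.hom, eqToIso.inv, eqToHom_app]
    exact ((Category.id_comp _).trans (Category.comp_id _)).symm
  id_whiskerRight f g := hom₂_ext fun Z => g.H.map_id _
  comp_whiskerRight η θ i := hom₂_ext fun Z => i.H.map_comp _ _
  whiskerRight_id η := hom₂_ext fun Z => by
    simp only [comp_app, eqToIso.hom, eqToIso.inv, eqToHom_app]
    exact ((Category.id_comp _).trans (Category.comp_id _)).symm
  whiskerRight_comp η g h := hom₂_ext fun Z => by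
    simp only [comp_app, eqToIso.hom, eqToIso.inv, eqToHom_app]
    exact ((Category.id_comp _).trans (Category.comp_id _)).symm
  whisker_assoc f g g' η h := hom₂_ext fun Z => by
    simp only [comp_app, eqToIso.hom, eqToIso.inv, eqToHom_app]
    exact ((Category.id_comp _).trans (Category.comp_id _)).symm
  whisker_exchange {_ _ _ _ _ _ _} η θ := hom₂_ext fun Z => ((θ : Hom₂ _ _).φ.naturality _).symm
  pentagon f g h i := hom₂_ext fun Z => by
    simp only [comp_app, wl_app, wr_app, eqToIso.hom, eqToHom_app, eqToHom_map,
      eqToHom_trans]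
  triangle f g := hom₂_ext fun Z => by
    simp only [comp_app, wl_app, wr_app, eqToIso.hom, eqToHom_app, eqToHom_map,
      eqToHom_trans]

instance : Bicategory.Strict DistMult.{w, v, u} where
  id_comp := hom_id_comp
  comp_id := hom_comp_id
  assoc := hom_assoc

end DistMult

/-! #### `OpDISTMULT` -/

/-- A distributive multitensor, as an object of `OpDISTMULT`. -/
structure OpDistMult where
  V : Type u
  [cat : Category.{v} V]
  [coprod : HasCoproducts.{w} V]
  E : Multitensor V
  dist : Multitensor.Distributive.{w} E

attribute [instance] OpDistMult.cat OpDistMult.coprod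

namespace OpDistMult

/-- Oplax monoidal functors `(H, ψ)` such that `H` preserves coproducts. -/
structure Hom (X Y : OpDistMult.{w, v, u}) where
  H : X.V ⥤ Y.V
  pres : ∀ J : Type w, PreservesColimitsOfShape (Discrete J) H
  str : OplaxStr X.E Y.E H

/-- Monoidal natural transformations. -/
@[ext] structure Hom₂ {X Y : OpDistMult.{w, v, u}} (f g : Hom X Y) where
  φ : f.H ⟶ g.H
  monoidal : f.str.IsMonoidal g.str φ

instance : CategoryStruct OpDistMult.{w, v, u} where
  Hom := Hom
  id X := ⟨𝟭 X.V, fun _ => inferInstance, OplaxStr.id X.E⟩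
  comp f g := ⟨f.H ⋙ g.H, fun J =>
    have := f.pres J
    have := g.pres J
    inferInstance, f.str.comp g.str⟩

instance homCat (X Y : OpDistMult.{w, v, u}) : Category (X ⟶ Y) where
  Hom f g := Hom₂ f g
  id f := ⟨𝟙 f.H, .id f.str⟩
  comp α β := ⟨α.φ ≫ β.φ, α.monoidal.comp β.monoidal⟩
  id_comp α := Hom₂.ext (Category.id_comp α.φ)
  comp_id α := Hom₂.ext (Category.comp_id α.φ)
  assoc α β γ := Hom₂.ext (Category.assoc α.φ β.φ γ.φ)

@[ext] lemma hom₂_ext {X Y : OpDistMult.{w, v, u}} {f g : X ⟶ Y} {α β : f ⟶ g}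
    (h : ∀ Z : X.V, α.φ.app Z = β.φ.app Z) : α = β := Hom₂.ext (NatTrans.ext (funext h))

lemma comp_app {X Y : OpDistMult.{w, v, u}} {f g h : X ⟶ Y} (α : f ⟶ g) (β : g ⟶ h) (Z : X.V) :
    (α ≫ β).φ.app Z = α.φ.app Z ≫ β.φ.app Z := rfl

lemma eqToHom_app {X Y : OpDistMult.{w, v, u}} {f g : X ⟶ Y} (h : f = g) (Z : X.V) :
    (eqToHom h).φ.app Z = eqToHom (by rw [h]) := by
  subst h; rfl

lemma hom_assoc {X Y Z W : OpDistMult.{w, v, u}} (f : X ⟶ Y) (g : Y ⟶ Z) (h : Z ⟶ W) :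
    (f ≫ g) ≫ h = f ≫ g ≫ h :=
  congrArg (Hom.mk (f.H ⋙ g.H ⋙ h.H) (f ≫ g ≫ h).pres) (OplaxStr.assoc f.str g.str h.str)

lemma hom_id_comp {X Y : OpDistMult.{w, v, u}} (f : X ⟶ Y) : 𝟙 X ≫ f = f :=
  congrArg (Hom.mk f.H f.pres) (OplaxStr.id_comp f.str)

lemma hom_comp_id {X Y : OpDistMult.{w, v, u}} (f : X ⟶ Y) : f ≫ 𝟙 Y = f :=
  congrArg (Hom.mk f.H f.pres) (OplaxStr.comp_id f.str)

/-- Whiskering on the left. -/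
def wl {X Y Z : OpDistMult.{w, v, u}} (f : X ⟶ Y) {g h : Y ⟶ Z} (η : g ⟶ h) : f ≫ g ⟶ f ≫ h :=
  Hom₂.mk (Functor.whiskerLeft f.H η.φ) (.whiskerLeft f.str η.monoidal)

/-- Whiskering on the right. -/
def wr {X Y Z : OpDistMult.{w, v, u}} {f g : X ⟶ Y} (η : f ⟶ g) (h : Y ⟶ Z) : f ≫ h ⟶ g ≫ h :=
  Hom₂.mk (Functor.whiskerRight η.φ h.H) (.whiskerRight η.monoidal h.str)

lemma wl_app {X Y Z : OpDistMult.{w, v, u}} (f : X ⟶ Y) {g h : Y ⟶ Z} (η : g ⟶ h) (A : X.V) :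
    (wl f η).φ.app A = η.φ.app (f.H.obj A) := rfl

lemma wr_app {X Y Z : OpDistMult.{w, v, u}} {f g : X ⟶ Y} (η : f ⟶ g) (h : Y ⟶ Z) (A : X.V) :
    (wr η h).φ.app A = h.H.map (η.φ.app A) := rfl

/-- The 2-category `OpDISTMULT`. -/
instance bicategory : Bicategory OpDistMult.{w, v, u} where
  homCategory X Y := homCat X Y
  whiskerLeft f _ _ η := wl f η
  whiskerRight η g := wr η g
  associator f g h := eqToIso (hom_assoc f g h)
  leftUnitor f := eqToIso (hom_id_comp f)
  rightUnitor f := eqToIso (hom_comp_id f)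
  whiskerLeft_id f g := hom₂_ext fun Z => rfl
  whiskerLeft_comp f g h i η θ := hom₂_ext fun Z => rfl
  id_whiskerLeft η := hom₂_ext fun Z => by
    simp only [comp_app, eqToIso.hom, eqToIso.inv, eqToHom_app]
    exact ((Category.id_comp _).trans (Category.comp_id _)).symm
  comp_whiskerLeft f g h h' η := hom₂_ext fun Z => by
    simp only [comp_app, eqToIso.hom, eqToIso.inv, eqToHom_app]
    exact ((Category.id_comp _).trans (Category.comp_id _)).symm
  id_whiskerRight f g := hom₂_ext fun Z => g.H.map_id _
  comp_whiskerRight η θ i := hom₂_ext fun Z => i.H.map_comp _ _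
  whiskerRight_id η := hom₂_ext fun Z => by
    simp only [comp_app, eqToIso.hom, eqToIso.inv, eqToHom_app]
    exact ((Category.id_comp _).trans (Category.comp_id _)).symm
  whiskerRight_comp η g h := hom₂_ext fun Z => by
    simp only [comp_app, eqToIso.hom, eqToIso.inv, eqToHom_app]
    exact ((Category.id_comp _).trans (Category.comp_id _)).symm
  whisker_assoc f g g' η h := hom₂_ext fun Z => by
    simp only [comp_app, eqToIso.hom, eqToIso.inv, eqToHom_app]
    exact ((Category.id_comp _).trans (Category.comp_id _)).symm
  whisker_exchange {_ _ _ _ _ _ _} η θ := hom₂_ext fun Z => ((θ : Hom₂ _ _).φ.naturality _).symm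
  pentagon f g h i := hom₂_ext fun Z => by
    simp only [comp_app, wl_app, wr_app, eqToIso.hom, eqToHom_app, eqToHom_map,
      eqToHom_trans]
  triangle f g := hom₂_ext fun Z => by
    simp only [comp_app, wl_app, wr_app, eqToIso.hom, eqToHom_app, eqToHom_map,
      eqToHom_trans]

instance : Bicategory.Strict OpDistMult.{w, v, u} where
  id_comp := hom_id_comp
  comp_id := hom_comp_id
  assoc := hom_assoc

end OpDistMult

section MonadCells

variable {A : Type u} [Category.{v} A] {B : Type u'} [Category.{v'} B]
  {C : Type u''} [Category.{v''} C] {p : A ⥤ Type w} {q : B ⥤ Type w} {r : C ⥤ Type w}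
  {T : SetMonad p} {S : SetMonad q} {R : SetMonad r}

/-- The condition for a natural transformation between monad functors to be a monad 2-cell. -/
def MonadFunctorStr.IsCell {K K' : A ⥤ B} {hK : K ⋙ q = p} {hK' : K' ⋙ q = p}
    (f : MonadFunctorStr T S K hK) (g : MonadFunctorStr T S K' hK') (α : K ⟶ K') : Prop :=
  ∀ X, f.ψ.app X ≫ α.app (T.T.obj X) = S.T.map (α.app X) ≫ g.ψ.app X

/-- The condition for a natural transformation between monad opfunctors to be a monad 2-cell. -/
def MonadOpfunctorStr.IsCell {K K' : A ⥤ B} {hK : K ⋙ q = p} {hK' : K' ⋙ q = p}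
    (f : MonadOpfunctorStr T S K hK) (g : MonadOpfunctorStr T S K' hK') (α : K ⟶ K') : Prop :=
  ∀ X, α.app (T.T.obj X) ≫ g.ψ.app X = f.ψ.app X ≫ S.T.map (α.app X)

lemma MonadFunctorStr.IsCell.id {K : A ⥤ B} {hK : K ⋙ q = p} (f : MonadFunctorStr T S K hK) :
    f.IsCell f (𝟙 K) := fun X => by simp

lemma MonadFunctorStr.IsCell.comp {K K' K'' : A ⥤ B} {hK : K ⋙ q = p} {hK' : K' ⋙ q = p}
    {hK'' : K'' ⋙ q = p} {f : MonadFunctorStr T S K hK} {g : MonadFunctorStr T S K' hK'}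
    {h : MonadFunctorStr T S K'' hK''} {α : K ⟶ K'} {β : K' ⟶ K''} (hα : f.IsCell g α)
    (hβ : g.IsCell h β) : f.IsCell h (α ≫ β) := fun X => by
  rw [NatTrans.comp_app, NatTrans.comp_app, S.T.map_comp, Category.assoc, ← hβ X,
    ← Category.assoc, hα X, Category.assoc]

lemma MonadFunctorStr.IsCell.whiskerLeft {K : A ⥤ B} {hK : K ⋙ q = p} {L L' : B ⥤ C}
    {hL : L ⋙ r = q} {hL' : L' ⋙ r = q} (f : MonadFunctorStr T S K hK)
    {g : MonadFunctorStr S R L hL} {g' : MonadFunctorStr S R L' hL'} {α : L ⟶ L'}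
    (hα : g.IsCell g' α) : (f.comp g).IsCell (f.comp g') (Functor.whiskerLeft K α) := fun X => by
  have h1 := hα (K.obj X)
  have h2 := α.naturality (f.ψ.app X)
  dsimp at h1 h2
  change (g.ψ.app (K.obj X) ≫ L.map (f.ψ.app X)) ≫ α.app (K.obj (T.T.obj X)) =
    R.T.map (α.app (K.obj X)) ≫ g'.ψ.app (K.obj X) ≫ L'.map (f.ψ.app X)
  rw [Category.assoc, h2, ← Category.assoc, h1, Category.assoc]

lemma MonadFunctorStr.IsCell.whiskerRight {K K' : A ⥤ B} {hK : K ⋙ q = p} {hK' : K' ⋙ q = p}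
    {L : B ⥤ C} {hL : L ⋙ r = q} {f : MonadFunctorStr T S K hK} {f' : MonadFunctorStr T S K' hK'}
    {α : K ⟶ K'} (hα : f.IsCell f' α) (g : MonadFunctorStr S R L hL) :
    (f.comp g).IsCell (f'.comp g) (Functor.whiskerRight α L) := fun X => by
  have h1 := congrArg L.map (hα X)
  have h2 := g.ψ.naturality (α.app X)
  dsimp at h1 h2
  change (g.ψ.app (K.obj X) ≫ L.map (f.ψ.app X)) ≫ L.map (α.app (T.T.obj X)) =
    R.T.map (L.map (α.app X)) ≫ g.ψ.app (K'.obj X) ≫ L.map (f'.ψ.app X)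
  rw [L.map_comp, L.map_comp] at h1
  rw [Category.assoc, h1, ← Category.assoc, ← h2, Category.assoc]

lemma MonadOpfunctorStr.IsCell.id {K : A ⥤ B} {hK : K ⋙ q = p}
    (f : MonadOpfunctorStr T S K hK) : f.IsCell f (𝟙 K) := fun X => by simp

lemma MonadOpfunctorStr.IsCell.comp {K K' K'' : A ⥤ B} {hK : K ⋙ q = p} {hK' : K' ⋙ q = p}
    {hK'' : K'' ⋙ q = p} {f : MonadOpfunctorStr T S K hK} {g : MonadOpfunctorStr T S K' hK'}
    {h : MonadOpfunctorStr T S K'' hK''} {α : K ⟶ K'} {β : K' ⟶ K''} (hα : f.IsCell g α)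
    (hβ : g.IsCell h β) : f.IsCell h (α ≫ β) := fun X => by
  rw [NatTrans.comp_app, NatTrans.comp_app, S.T.map_comp, Category.assoc, hβ X,
    ← Category.assoc, hα X, Category.assoc]

lemma MonadOpfunctorStr.IsCell.whiskerLeft {K : A ⥤ B} {hK : K ⋙ q = p} {L L' : B ⥤ C}
    {hL : L ⋙ r = q} {hL' : L' ⋙ r = q} (f : MonadOpfunctorStr T S K hK)
    {g : MonadOpfunctorStr S R L hL} {g' : MonadOpfunctorStr S R L' hL'} {α : L ⟶ L'}
    (hα : g.IsCell g' α) : (f.comp g).IsCell (f.comp g') (Functor.whiskerLeft K α) := fun X => by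
  have h1 := hα (K.obj X)
  have h2 := α.naturality (f.ψ.app X)
  dsimp at h1 h2
  change α.app (K.obj (T.T.obj X)) ≫ L'.map (f.ψ.app X) ≫ g'.ψ.app (K.obj X) =
    (L.map (f.ψ.app X) ≫ g.ψ.app (K.obj X)) ≫ R.T.map (α.app (K.obj X))
  rw [Category.assoc, ← h1, ← Category.assoc, ← h2, Category.assoc]

lemma MonadOpfunctorStr.IsCell.whiskerRight {K K' : A ⥤ B} {hK : K ⋙ q = p} {hK' : K' ⋙ q = p}
    {L : B ⥤ C} {hL : L ⋙ r = q} {f : MonadOpfunctorStr T S K hK}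
    {f' : MonadOpfunctorStr T S K' hK'} {α : K ⟶ K'} (hα : f.IsCell f' α)
    (g : MonadOpfunctorStr S R L hL) :
    (f.comp g).IsCell (f'.comp g) (Functor.whiskerRight α L) := fun X => by
  have h1 := congrArg L.map (hα X)
  have h2 := g.ψ.naturality (α.app X)
  dsimp at h1 h2
  change L.map (α.app (T.T.obj X)) ≫ L.map (f'.ψ.app X) ≫ g.ψ.app (K'.obj X) =
    (L.map (f.ψ.app X) ≫ g.ψ.app (K.obj X)) ≫ R.T.map (L.map (α.app X))
  rw [L.map_comp, L.map_comp] at h1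
  rw [Category.assoc, ← h2, ← Category.assoc, h1, Category.assoc]

variable {D : Type*} [Category* D] {s : D ⥤ Type w} {Q : SetMonad s}

lemma MonadFunctorStr.ext_app {K : A ⥤ B} {hK : K ⋙ q = p} {f g : MonadFunctorStr T S K hK}
    (h : ∀ X, f.ψ.app X = g.ψ.app X) : f = g := MonadFunctorStr.ext (NatTrans.ext (funext h))

lemma MonadFunctorStr.comp_id {K : A ⥤ B} {hK : K ⋙ q = p} (f : MonadFunctorStr T S K hK) :
    f.comp (MonadFunctorStr.id S) = f := MonadFunctorStr.ext_app fun _ => Category.id_comp _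

lemma MonadFunctorStr.id_comp {K : A ⥤ B} {hK : K ⋙ q = p} (f : MonadFunctorStr T S K hK) :
    (MonadFunctorStr.id T).comp f = f := MonadFunctorStr.ext_app fun X => (congrArg (f.ψ.app X ≫ ·) (K.map_id _)).trans (Category.comp_id _)

lemma MonadFunctorStr.assoc {K : A ⥤ B} {hK : K ⋙ q = p} {L : B ⥤ C} {hL : L ⋙ r = q}
    {J : C ⥤ D} {hJ : J ⋙ s = r} (f : MonadFunctorStr T S K hK) (g : MonadFunctorStr S R L hL)
    (h : MonadFunctorStr R Q J hJ) : (f.comp g).comp h = f.comp (g.comp h) :=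
  MonadFunctorStr.ext_app fun X =>
    (congrArg (h.ψ.app (L.obj (K.obj X)) ≫ ·) (J.map_comp _ _)).trans (Category.assoc _ _ _).symm

lemma MonadOpfunctorStr.ext_app {K : A ⥤ B} {hK : K ⋙ q = p} {f g : MonadOpfunctorStr T S K hK}
    (h : ∀ X, f.ψ.app X = g.ψ.app X) : f = g := MonadOpfunctorStr.ext (NatTrans.ext (funext h))

lemma MonadOpfunctorStr.comp_id {K : A ⥤ B} {hK : K ⋙ q = p} (f : MonadOpfunctorStr T S K hK) :
    f.comp (MonadOpfunctorStr.id S) = f := MonadOpfunctorStr.ext_app fun _ => Category.comp_id _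

lemma MonadOpfunctorStr.id_comp {K : A ⥤ B} {hK : K ⋙ q = p} (f : MonadOpfunctorStr T S K hK) :
    (MonadOpfunctorStr.id T).comp f = f := MonadOpfunctorStr.ext_app fun X => (congrArg (· ≫ f.ψ.app X) (K.map_id _)).trans (Category.id_comp _)

lemma MonadOpfunctorStr.assoc {K : A ⥤ B} {hK : K ⋙ q = p} {L : B ⥤ C} {hL : L ⋙ r = q}
    {J : C ⥤ D} {hJ : J ⋙ s = r} (f : MonadOpfunctorStr T S K hK) (g : MonadOpfunctorStr S R L hL)
    (h : MonadOpfunctorStr R Q J hJ) : (f.comp g).comp h = f.comp (g.comp h) :=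
  MonadOpfunctorStr.ext_app fun X =>
    (congrArg (· ≫ h.ψ.app (L.obj (K.obj X))) (J.map_comp _ _)).trans (Category.assoc _ _ _)

end MonadCells

/-! #### `𝒢-MND` -/

/-- A category `V` with coproducts together with a monad on `𝒢V` over `Set`. -/
structure GMnd where
  V : Type u
  [cat : Category.{v} V]
  [coprod : HasCoproducts.{w} V]
  T : SetMonad (EGraph.ob.{w} V)

attribute [instance] GMnd.cat GMnd.coprod

namespace GMnd

/-- Functors `H` together with a monad functor structure on `𝒢H` over `Set`. -/
structure Hom (X Y : GMnd.{w, v, u}) where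
  H : X.V ⥤ Y.V
  str : MonadFunctorStr X.T Y.T (EGraph.map H) (EGraph.map_over H)

/-- Natural transformations `φ` such that `𝒢φ` is a monad 2-cell. -/
@[ext] structure Hom₂ {X Y : GMnd.{w, v, u}} (f g : Hom X Y) where
  φ : f.H ⟶ g.H
  cell : f.str.IsCell g.str (EGraph.mapNat φ)

instance : CategoryStruct GMnd.{w, v, u} where
  Hom := Hom
  id X := ⟨𝟭 X.V, MonadFunctorStr.id X.T⟩
  comp f g := ⟨f.H ⋙ g.H, f.str.comp g.str⟩

instance homCat (X Y : GMnd.{w, v, u}) : Category (X ⟶ Y) where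
  Hom f g := Hom₂ f g
  id f := ⟨𝟙 f.H, MonadFunctorStr.IsCell.id f.str⟩
  comp α β := ⟨α.φ ≫ β.φ, MonadFunctorStr.IsCell.comp α.cell β.cell⟩
  id_comp α := Hom₂.ext (Category.id_comp α.φ)
  comp_id α := Hom₂.ext (Category.comp_id α.φ)
  assoc α β γ := Hom₂.ext (Category.assoc α.φ β.φ γ.φ)

@[ext] lemma hom₂_ext {X Y : GMnd.{w, v, u}} {f g : X ⟶ Y} {α β : f ⟶ g}
    (h : ∀ Z : X.V, α.φ.app Z = β.φ.app Z) : α = β := Hom₂.ext (NatTrans.ext (funext h))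

lemma comp_app {X Y : GMnd.{w, v, u}} {f g h : X ⟶ Y} (α : f ⟶ g) (β : g ⟶ h) (Z : X.V) :
    (α ≫ β).φ.app Z = α.φ.app Z ≫ β.φ.app Z := rfl

lemma eqToHom_app {X Y : GMnd.{w, v, u}} {f g : X ⟶ Y} (h : f = g) (Z : X.V) :
    (eqToHom h).φ.app Z = eqToHom (by rw [h]) := by
  subst h; rfl

lemma hom_assoc {X Y Z W : GMnd.{w, v, u}} (f : X ⟶ Y) (g : Y ⟶ Z) (h : Z ⟶ W) :
    (f ≫ g) ≫ h = f ≫ g ≫ h :=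
  congrArg (Hom.mk (f.H ⋙ g.H ⋙ h.H)) (MonadFunctorStr.assoc f.str g.str h.str)

lemma hom_id_comp {X Y : GMnd.{w, v, u}} (f : X ⟶ Y) : 𝟙 X ≫ f = f :=
  congrArg (Hom.mk f.H) (MonadFunctorStr.id_comp f.str)

lemma hom_comp_id {X Y : GMnd.{w, v, u}} (f : X ⟶ Y) : f ≫ 𝟙 Y = f :=
  congrArg (Hom.mk f.H) (MonadFunctorStr.comp_id f.str)

/-- Whiskering on the left. -/
def wl {X Y Z : GMnd.{w, v, u}} (f : X ⟶ Y) {g h : Y ⟶ Z} (η : g ⟶ h) : f ≫ g ⟶ f ≫ h :=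
  Hom₂.mk (Functor.whiskerLeft f.H η.φ) (MonadFunctorStr.IsCell.whiskerLeft f.str η.cell)

/-- Whiskering on the right. -/
def wr {X Y Z : GMnd.{w, v, u}} {f g : X ⟶ Y} (η : f ⟶ g) (h : Y ⟶ Z) : f ≫ h ⟶ g ≫ h :=
  Hom₂.mk (Functor.whiskerRight η.φ h.H) (MonadFunctorStr.IsCell.whiskerRight η.cell h.str)

lemma wl_app {X Y Z : GMnd.{w, v, u}} (f : X ⟶ Y) {g h : Y ⟶ Z} (η : g ⟶ h) (A : X.V) :
    (wl f η).φ.app A = η.φ.app (f.H.obj A) := rfl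

lemma wr_app {X Y Z : GMnd.{w, v, u}} {f g : X ⟶ Y} (η : f ⟶ g) (h : Y ⟶ Z) (A : X.V) :
    (wr η h).φ.app A = h.H.map (η.φ.app A) := rfl

/-- The 2-category `𝒢-MND`. -/
instance bicategory : Bicategory GMnd.{w, v, u} where
  homCategory X Y := homCat X Y
  whiskerLeft f _ _ η := wl f η
  whiskerRight η g := wr η g
  associator f g h := eqToIso (hom_assoc f g h)
  leftUnitor f := eqToIso (hom_id_comp f)
  rightUnitor f := eqToIso (hom_comp_id f)
  whiskerLeft_id f g := hom₂_ext fun Z => rfl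
  whiskerLeft_comp f g h i η θ := hom₂_ext fun Z => rfl
  id_whiskerLeft η := hom₂_ext fun Z => by
    simp only [comp_app, eqToIso.hom, eqToIso.inv, eqToHom_app]
    exact ((Category.id_comp _).trans (Category.comp_id _)).symm
  comp_whiskerLeft f g h h' η := hom₂_ext fun Z => by
    simp only [comp_app, eqToIso.hom, eqToIso.inv, eqToHom_app]
    exact ((Category.id_comp _).trans (Category.comp_id _)).symm
  id_whiskerRight f g := hom₂_ext fun Z => g.H.map_id _
  comp_whiskerRight η θ i := hom₂_ext fun Z => i.H.map_comp _ _
  whiskerRight_id η := hom₂_ext fun Z => by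
    simp only [comp_app, eqToIso.hom, eqToIso.inv, eqToHom_app]
    exact ((Category.id_comp _).trans (Category.comp_id _)).symm
  whiskerRight_comp η g h := hom₂_ext fun Z => by
    simp only [comp_app, eqToIso.hom, eqToIso.inv, eqToHom_app]
    exact ((Category.id_comp _).trans (Category.comp_id _)).symm
  whisker_assoc f g g' η h := hom₂_ext fun Z => by
    simp only [comp_app, eqToIso.hom, eqToIso.inv, eqToHom_app]
    exact ((Category.id_comp _).trans (Category.comp_id _)).symm
  whisker_exchange {_ _ _ _ _ _ _} η θ := hom₂_ext fun Z => ((θ : Hom₂ _ _).φ.naturality _).symm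
  pentagon f g h i := hom₂_ext fun Z => by
    simp only [comp_app, wl_app, wr_app, eqToIso.hom, eqToHom_app, eqToHom_map,
      eqToHom_trans]
  triangle f g := hom₂_ext fun Z => by
    simp only [comp_app, wl_app, wr_app, eqToIso.hom, eqToHom_app, eqToHom_map,
      eqToHom_trans]

instance : Bicategory.Strict GMnd.{w, v, u} where
  id_comp := hom_id_comp
  comp_id := hom_comp_id
  assoc := hom_assoc

end GMnd

/-! #### `𝒢-OpMND` -/

/-- A category `V` with coproducts together with a monad on `𝒢V` over `Set`. -/
structure GOpMnd where
  V : Type u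
  [cat : Category.{v} V]
  [coprod : HasCoproducts.{w} V]
  T : SetMonad (EGraph.ob.{w} V)

attribute [instance] GOpMnd.cat GOpMnd.coprod

namespace GOpMnd

/-- Functors `H` preserving coproducts, together with a monad opfunctor structure on `𝒢H`
over `Set`. -/
structure Hom (X Y : GOpMnd.{w, v, u}) where
  H : X.V ⥤ Y.V
  pres : ∀ J : Type w, PreservesColimitsOfShape (Discrete J) H
  str : MonadOpfunctorStr X.T Y.T (EGraph.map H) (EGraph.map_over H)

/-- Natural transformations `φ` such that `𝒢φ` is a monad 2-cell. -/
@[ext] structure Hom₂ {X Y : GOpMnd.{w, v, u}} (f g : Hom X Y) where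
  φ : f.H ⟶ g.H
  cell : f.str.IsCell g.str (EGraph.mapNat φ)

instance : CategoryStruct GOpMnd.{w, v, u} where
  Hom := Hom
  id X := ⟨𝟭 X.V, fun _ => inferInstance, MonadOpfunctorStr.id X.T⟩
  comp f g := ⟨f.H ⋙ g.H, fun J =>
    have := f.pres J
    have := g.pres J
    inferInstance, f.str.comp g.str⟩

instance homCat (X Y : GOpMnd.{w, v, u}) : Category (X ⟶ Y) where
  Hom f g := Hom₂ f g
  id f := ⟨𝟙 f.H, MonadOpfunctorStr.IsCell.id f.str⟩
  comp α β := ⟨α.φ ≫ β.φ, MonadOpfunctorStr.IsCell.comp α.cell β.cell⟩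
  id_comp α := Hom₂.ext (Category.id_comp α.φ)
  comp_id α := Hom₂.ext (Category.comp_id α.φ)
  assoc α β γ := Hom₂.ext (Category.assoc α.φ β.φ γ.φ)

@[ext] lemma hom₂_ext {X Y : GOpMnd.{w, v, u}} {f g : X ⟶ Y} {α β : f ⟶ g}
    (h : ∀ Z : X.V, α.φ.app Z = β.φ.app Z) : α = β := Hom₂.ext (NatTrans.ext (funext h))

lemma comp_app {X Y : GOpMnd.{w, v, u}} {f g h : X ⟶ Y} (α : f ⟶ g) (β : g ⟶ h) (Z : X.V) :
    (α ≫ β).φ.app Z = α.φ.app Z ≫ β.φ.app Z := rfl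

lemma eqToHom_app {X Y : GOpMnd.{w, v, u}} {f g : X ⟶ Y} (h : f = g) (Z : X.V) :
    (eqToHom h).φ.app Z = eqToHom (by rw [h]) := by
  subst h; rfl

lemma hom_assoc {X Y Z W : GOpMnd.{w, v, u}} (f : X ⟶ Y) (g : Y ⟶ Z) (h : Z ⟶ W) :
    (f ≫ g) ≫ h = f ≫ g ≫ h :=
  congrArg (Hom.mk (f.H ⋙ g.H ⋙ h.H) (f ≫ g ≫ h).pres) (MonadOpfunctorStr.assoc f.str g.str h.str)

lemma hom_id_comp {X Y : GOpMnd.{w, v, u}} (f : X ⟶ Y) : 𝟙 X ≫ f = f :=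
  congrArg (Hom.mk f.H f.pres) (MonadOpfunctorStr.id_comp f.str)

lemma hom_comp_id {X Y : GOpMnd.{w, v, u}} (f : X ⟶ Y) : f ≫ 𝟙 Y = f :=
  congrArg (Hom.mk f.H f.pres) (MonadOpfunctorStr.comp_id f.str)

/-- Whiskering on the left. -/
def wl {X Y Z : GOpMnd.{w, v, u}} (f : X ⟶ Y) {g h : Y ⟶ Z} (η : g ⟶ h) : f ≫ g ⟶ f ≫ h :=
  Hom₂.mk (Functor.whiskerLeft f.H η.φ) (MonadOpfunctorStr.IsCell.whiskerLeft f.str η.cell)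

/-- Whiskering on the right. -/
def wr {X Y Z : GOpMnd.{w, v, u}} {f g : X ⟶ Y} (η : f ⟶ g) (h : Y ⟶ Z) : f ≫ h ⟶ g ≫ h :=
  Hom₂.mk (Functor.whiskerRight η.φ h.H) (MonadOpfunctorStr.IsCell.whiskerRight η.cell h.str)

lemma wl_app {X Y Z : GOpMnd.{w, v, u}} (f : X ⟶ Y) {g h : Y ⟶ Z} (η : g ⟶ h) (A : X.V) :
    (wl f η).φ.app A = η.φ.app (f.H.obj A) := rfl

lemma wr_app {X Y Z : GOpMnd.{w, v, u}} {f g : X ⟶ Y} (η : f ⟶ g) (h : Y ⟶ Z) (A : X.V) :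
    (wr η h).φ.app A = h.H.map (η.φ.app A) := rfl

/-- The 2-category `𝒢-OpMND`. -/
instance bicategory : Bicategory GOpMnd.{w, v, u} where
  homCategory X Y := homCat X Y
  whiskerLeft f _ _ η := wl f η
  whiskerRight η g := wr η g
  associator f g h := eqToIso (hom_assoc f g h)
  leftUnitor f := eqToIso (hom_id_comp f)
  rightUnitor f := eqToIso (hom_comp_id f)
  whiskerLeft_id f g := hom₂_ext fun Z => rfl
  whiskerLeft_comp f g h i η θ := hom₂_ext fun Z => rfl
  id_whiskerLeft η := hom₂_ext fun Z => by
    simp only [comp_app, eqToIso.hom, eqToIso.inv, eqToHom_app]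
    exact ((Category.id_comp _).trans (Category.comp_id _)).symm
  comp_whiskerLeft f g h h' η := hom₂_ext fun Z => by
    simp only [comp_app, eqToIso.hom, eqToIso.inv, eqToHom_app]
    exact ((Category.id_comp _).trans (Category.comp_id _)).symm
  id_whiskerRight f g := hom₂_ext fun Z => g.H.map_id _
  comp_whiskerRight η θ i := hom₂_ext fun Z => i.H.map_comp _ _
  whiskerRight_id η := hom₂_ext fun Z => by
    simp only [comp_app, eqToIso.hom, eqToIso.inv, eqToHom_app]
    exact ((Category.id_comp _).trans (Category.comp_id _)).symm
  whiskerRight_comp η g h := hom₂_ext fun Z => by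
    simp only [comp_app, eqToIso.hom, eqToIso.inv, eqToHom_app]
    exact ((Category.id_comp _).trans (Category.comp_id _)).symm
  whisker_assoc f g g' η h := hom₂_ext fun Z => by
    simp only [comp_app, eqToIso.hom, eqToIso.inv, eqToHom_app]
    exact ((Category.id_comp _).trans (Category.comp_id _)).symm
  whisker_exchange {_ _ _ _ _ _ _} η θ := hom₂_ext fun Z => ((θ : Hom₂ _ _).φ.naturality _).symm
  pentagon f g h i := hom₂_ext fun Z => by
    simp only [comp_app, wl_app, wr_app, eqToIso.hom, eqToHom_app, eqToHom_map,
      eqToHom_trans]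
  triangle f g := hom₂_ext fun Z => by
    simp only [comp_app, wl_app, wr_app, eqToIso.hom, eqToHom_app, eqToHom_map,
      eqToHom_trans]

instance : Bicategory.Strict GOpMnd.{w, v, u} where
  id_comp := hom_id_comp
  comp_id := hom_comp_id
  assoc := hom_assoc

end GOpMnd

/-! ### The 2-functors `Ψ` and `Ψ'` -/

section GammaFunctoriality

variable {V : Type u} [Category.{v} V] [HasCoproducts.{w} V] {W : Type u'} [Category.{v'} W]
  [HasCoproducts.{w} W] {U : Type u''} [Category.{v''} U] [HasCoproducts.{w} U] {S : Type w}
  {E : Multitensor V} {F : Multitensor W} {G : Multitensor U}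

lemma LaxStr.gammaHom_id (C : S → S → V) (a b : S) :
    (LaxStr.id E).gammaHom C a b = 𝟙 (E.gammaHom C a b) :=
  (E.incl_isCoprod _ a b).hom_ext fun p => by
    refine ((LaxStr.id E).incl_gammaHom C p).trans ?_
    change E.E.map _ ≫ E.E.map _ ≫ E.incl C p = E.incl C p ≫ 𝟙 _
    rw [← Category.assoc, ← E.E.map_comp, eqToHom_trans, Category.comp_id]
    exact (congrArg (· ≫ E.incl C p) (E.E.map_id _)).trans (Category.id_comp _)

lemma LaxStr.gammaHom_comp {H : V ⥤ W} {K : W ⥤ U} (L : LaxStr E F H) (M : LaxStr F G K)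
    (C : S → S → V) (a b : S) :
    (L.comp M).gammaHom C a b =
      M.gammaHom (fun x y => H.obj (C x y)) a b ≫ K.map (L.gammaHom C a b) :=
  (G.incl_isCoprod _ a b).hom_ext fun p => by
    refine ((L.comp M).incl_gammaHom C p).trans ?_
    refine Eq.trans ?_ (Category.assoc _ _ _)
    refine Eq.trans ?_ (congrArg (· ≫ K.map (L.gammaHom C a b))
      (M.incl_gammaHom (fun x y => H.obj (C x y)) p).symm)
    change G.E.map _ ≫ (G.E.map _ ≫ M.ψ _ ≫ K.map (L.ψ _)) ≫ K.map (H.map (E.incl C p)) = _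
    simp only [Category.assoc]
    rw [← K.map_comp (F.incl _ p), incl_gammaHom, K.map_comp, K.map_comp,
      ← Category.assoc (M.ψ _) (K.map (F.E.map _)), ← M.natural, mapHom_eqToHom]
    simp only [Category.assoc, eqToHom_map, eqToHom_trans_assoc]

lemma seqOf_homs {H K : V ⥤ W} (φ : H ⟶ K) (C : S → S → V) : {a b : S} → (p : ObjSeq a b) →
    HEq (idHoms (C := fun x y => H.obj (C x y)) (C' := fun x y => K.obj (C x y))
      (fun x y => φ.app (C x y)) p) (seqOf (fun X => φ.app X) (p.homs C))
  | _, _, nil _ => HEq.rfl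
  | _, _, cons _ p => consHom_heq (φ.app _) (homs_map _ _ _) (homs_map _ _ _) (seqOf_homs φ C p)

lemma LaxStr.IsMonoidal.gamma {H K : V ⥤ W} {L : LaxStr E F H} {M : LaxStr E F K} {φ : H ⟶ K}
    (hφ : L.IsMonoidal M φ) (C : S → S → V) (a b : S) :
    L.gammaHom C a b ≫ φ.app (E.gammaHom C a b) =
      F.gammaMap (f := fun x => x) (fun x y => φ.app (C x y)) a b ≫ M.gammaHom C a b :=
  (F.incl_isCoprod _ a b).hom_ext fun p => by
    have h := comp_eqToHom_of_heq (homs_map _ _ _) (homs_map _ _ _) (seqOf_homs φ C p)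
    rw [← Category.assoc, incl_gammaHom, Category.assoc, Category.assoc, φ.naturality,
      ← Category.assoc (L.ψ _), hφ, ← Category.assoc (F.incl _ p),
      Multitensor.incl_gammaMap_id, Category.assoc, Category.assoc, incl_gammaHom,
      ← Category.assoc (F.E.map (idHoms _ _)), ← F.E.map_comp, h, F.E.map_comp]
    simp only [Category.assoc]

lemma OplaxStr.gammaHom_id (C : S → S → V) (a b : S)
    (h : ∀ J : Type w, PreservesColimitsOfShape (Discrete J) (𝟭 V)) :
    (OplaxStr.id E).gammaHom h C a b = 𝟙 (E.gammaHom C a b) :=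
  map_incl_hom_ext h C fun p => by
    refine ((OplaxStr.id E).incl_gammaHom h C p).trans ?_
    change E.E.map _ ≫ E.E.map _ ≫ E.incl C p = E.incl C p ≫ 𝟙 _
    rw [← Category.assoc, ← E.E.map_comp, eqToHom_trans, Category.comp_id]
    exact (congrArg (· ≫ E.incl C p) (E.E.map_id _)).trans (Category.id_comp _)

lemma OplaxStr.gammaHom_comp {H : V ⥤ W} {K : W ⥤ U} (L : OplaxStr E F H) (M : OplaxStr F G K)
    (hH : ∀ J : Type w, PreservesColimitsOfShape (Discrete J) H)
    (hK : ∀ J : Type w, PreservesColimitsOfShape (Discrete J) K)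
    (hHK : ∀ J : Type w, PreservesColimitsOfShape (Discrete J) (H ⋙ K))
    (C : S → S → V) (a b : S) :
    (L.comp M).gammaHom hHK C a b =
      K.map (L.gammaHom hH C a b) ≫ M.gammaHom hK (fun x y => H.obj (C x y)) a b :=
  map_incl_hom_ext hHK C fun p => by
    refine ((L.comp M).incl_gammaHom hHK C p).trans ?_
    change (K.map (L.ψ _) ≫ M.ψ _ ≫ G.E.map _) ≫ G.E.map _ ≫ G.incl _ p =
      K.map (H.map (E.incl C p)) ≫ K.map (L.gammaHom hH C a b) ≫ M.gammaHom hK _ a b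
    rw [← Category.assoc (K.map (H.map _)), ← K.map_comp, incl_gammaHom, K.map_comp, K.map_comp]
    simp only [Category.assoc]
    rw [incl_gammaHom, ← Category.assoc (K.map (F.E.map _)), M.natural, mapHom_eqToHom]
    simp only [Category.assoc, eqToHom_map, eqToHom_trans_assoc]

lemma OplaxStr.IsMonoidal.gamma {H K : V ⥤ W} {L : OplaxStr E F H} {M : OplaxStr E F K}
    {φ : H ⟶ K} (hφ : L.IsMonoidal M φ)
    (hH : ∀ J : Type w, PreservesColimitsOfShape (Discrete J) H)
    (hK : ∀ J : Type w, PreservesColimitsOfShape (Discrete J) K) (C : S → S → V) (a b : S) :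
    φ.app (E.gammaHom C a b) ≫ M.gammaHom hK C a b =
      L.gammaHom hH C a b ≫ F.gammaMap (f := fun x => x) (fun x y => φ.app (C x y)) a b :=
  map_incl_hom_ext hH C fun p => by
    have h := comp_eqToHom_of_heq (homs_map C H.obj p).symm (homs_map C K.obj p).symm
      (seqOf_homs φ C p).symm
    rw [← Category.assoc, φ.naturality, Category.assoc, incl_gammaHom, ← Category.assoc, hφ,
      ← Category.assoc (H.map (E.incl _ _)), incl_gammaHom]
    simp only [Category.assoc]
    rw [Multitensor.incl_gammaMap_id, ← Category.assoc (F.E.map (seqOf _ _)), ← F.E.map_comp, h,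
      F.E.map_comp]
    simp only [Category.assoc]

lemma LaxStr.gamma_id (hE : Multitensor.Distributive.{w} E) :
    (LaxStr.id E).gamma hE hE = MonadFunctorStr.id (E.gamma hE) :=
  MonadFunctorStr.ext_app (K := EGraph.map (𝟭 V)) (hK := EGraph.map_over (𝟭 V)) fun A =>
    EGraph.hom_ext fun a b => LaxStr.gammaHom_id A.hom a b

lemma LaxStr.gamma_comp {H : V ⥤ W} {K : W ⥤ U} (L : LaxStr E F H) (M : LaxStr F G K)
    (hE : Multitensor.Distributive.{w} E) (hF : Multitensor.Distributive.{w} F)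
    (hG : Multitensor.Distributive.{w} G) :
    (L.comp M).gamma hE hG = (L.gamma hE hF).comp (M.gamma hF hG) :=
  MonadFunctorStr.ext_app (K := EGraph.map (H ⋙ K)) (hK := EGraph.map_over (H ⋙ K)) fun A =>
    EGraph.hom_ext fun a b => LaxStr.gammaHom_comp L M A.hom a b

lemma OplaxStr.gamma_id (hE : Multitensor.Distributive.{w} E)
    (h : ∀ J : Type w, PreservesColimitsOfShape (Discrete J) (𝟭 V)) :
    (OplaxStr.id E).gamma h hE hE = MonadOpfunctorStr.id (E.gamma hE) :=
  MonadOpfunctorStr.ext_app (K := EGraph.map (𝟭 V)) (hK := EGraph.map_over (𝟭 V)) fun A =>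
    EGraph.hom_ext fun a b => OplaxStr.gammaHom_id A.hom a b h

lemma OplaxStr.gamma_comp {H : V ⥤ W} {K : W ⥤ U} (L : OplaxStr E F H) (M : OplaxStr F G K)
    (hH : ∀ J : Type w, PreservesColimitsOfShape (Discrete J) H)
    (hK : ∀ J : Type w, PreservesColimitsOfShape (Discrete J) K)
    (hHK : ∀ J : Type w, PreservesColimitsOfShape (Discrete J) (H ⋙ K))
    (hE : Multitensor.Distributive.{w} E) (hF : Multitensor.Distributive.{w} F)
    (hG : Multitensor.Distributive.{w} G) :
    (L.comp M).gamma hHK hE hG = (L.gamma hH hE hF).comp (M.gamma hK hF hG) :=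
  MonadOpfunctorStr.ext_app (K := EGraph.map (H ⋙ K)) (hK := EGraph.map_over (H ⋙ K)) fun A =>
    EGraph.hom_ext fun a b => OplaxStr.gammaHom_comp L M hH hK hHK A.hom a b

end GammaFunctoriality

/-- The 2-functor `Ψ : DISTMULT ⟶ 𝒢-MND`, which sends `(V, E)` to `(V, ΓE)`, `(H, ψ)` to
`(H, Γψ)` and is the identity on 2-cells. -/
noncomputable def Psi : StrictPseudofunctor DistMult.{w, v, u} GMnd.{w, v, u} :=
  StrictPseudofunctor.mk'' {
    obj := fun X => GMnd.mk X.V (X.E.gamma X.dist)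
    map := fun {X Y} f => GMnd.Hom.mk f.H (f.str.gamma X.dist Y.dist)
    map₂ := fun {X Y f g} α => GMnd.Hom₂.mk α.φ
      fun A => EGraph.hom_ext fun a b => α.monoidal.gamma A.hom a b
    map₂_id := fun f => rfl
    map₂_comp := fun α β => rfl
    map_id := fun X => congrArg
      (fun t => (GMnd.Hom.mk (𝟭 X.V) t :
        GMnd.Hom (GMnd.mk X.V (X.E.gamma X.dist)) (GMnd.mk X.V (X.E.gamma X.dist))))
      (LaxStr.gamma_id X.dist)
    map_comp := fun {X Y Z} f g => congrArg
      (fun t => (GMnd.Hom.mk (f.H ⋙ g.H) t :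
        GMnd.Hom (GMnd.mk X.V (X.E.gamma X.dist)) (GMnd.mk Z.V (Z.E.gamma Z.dist))))
      (LaxStr.gamma_comp f.str g.str X.dist Y.dist Z.dist)
    map₂_whisker_left := fun f g h η => GMnd.hom₂_ext fun Z => by
      simp only [GMnd.comp_app, GMnd.eqToHom_app]
      exact ((Category.id_comp _).trans (Category.comp_id _)).symm
    map₂_whisker_right := fun η h => GMnd.hom₂_ext fun Z => by
      simp only [GMnd.comp_app, GMnd.eqToHom_app]
      exact ((Category.id_comp _).trans (Category.comp_id _)).symm }

/-- The 2-functor `Ψ' : OpDISTMULT ⟶ 𝒢-OpMND`, which sends `(V, E)` to `(V, ΓE)`, `(H, ψ)` to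
`(H, Γ'ψ)` and is the identity on 2-cells. -/
noncomputable def PsiOp : StrictPseudofunctor OpDistMult.{w, v, u} GOpMnd.{w, v, u} :=
  StrictPseudofunctor.mk'' {
    obj := fun X => GOpMnd.mk X.V (X.E.gamma X.dist)
    map := fun {X Y} f => GOpMnd.Hom.mk f.H f.pres (f.str.gamma f.pres X.dist Y.dist)
    map₂ := fun {X Y f g} α => GOpMnd.Hom₂.mk α.φ
      fun A => EGraph.hom_ext fun a b => α.monoidal.gamma f.pres g.pres A.hom a b
    map₂_id := fun f => rfl
    map₂_comp := fun α β => rfl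
    map_id := fun X => congrArg
      (fun t => (GOpMnd.Hom.mk (𝟭 X.V) (𝟙 X : X ⟶ X).pres t :
        GOpMnd.Hom (GOpMnd.mk X.V (X.E.gamma X.dist)) (GOpMnd.mk X.V (X.E.gamma X.dist))))
      (OplaxStr.gamma_id X.dist _)
    map_comp := fun {X Y Z} f g => congrArg
      (fun t => (GOpMnd.Hom.mk (f.H ⋙ g.H) (f ≫ g).pres t :
        GOpMnd.Hom (GOpMnd.mk X.V (X.E.gamma X.dist)) (GOpMnd.mk Z.V (Z.E.gamma Z.dist))))
      (OplaxStr.gamma_comp f.str g.str f.pres g.pres _ X.dist Y.dist Z.dist)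
    map₂_whisker_left := fun f g h η => GOpMnd.hom₂_ext fun Z => by
      simp only [GOpMnd.comp_app, GOpMnd.eqToHom_app]
      exact ((Category.id_comp _).trans (Category.comp_id _)).symm
    map₂_whisker_right := fun η h => GOpMnd.hom₂_ext fun Z => by
      simp only [GOpMnd.comp_app, GOpMnd.eqToHom_app]
      exact ((Category.id_comp _).trans (Category.comp_id _)).symm }

/-- A 2-functor is 2-fully faithful when its hom functors are isomorphisms of categories. -/
def TwoFullyFaithful {B : Type u} [Bicategory.{w, v} B] {C : Type u'} [Bicategory.{v'', v'} C]
    (F : StrictPseudofunctor B C) : Prop :=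
  ∀ X Y : B, (F.mapFunctor X Y).Full ∧ (F.mapFunctor X Y).Faithful ∧
    Function.Bijective (F.mapFunctor X Y).obj

end EnrichedGraphs

open EnrichedGraphs

namespace EnrichedGraphs

open ObjSeq

/-! ### Linear graphs -/

/-! A lax structure on `H` has one component for each finite sequence `Z`. A monad functor structure
over `Set` has one hom map for each graph and each pair of objects, defined on a coproduct over all
sequences of objects. The two carry the same information because a sequence of objects of `V` is
itself a graph.

Let `stepGraph Z` have vertices 0, 1, 2, ..., the entries of `Z` as homs along the steps 0, 1, ...,
n, and initial homs everywhere else. All of ℕ serves as vertex set, so that the object set does not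
depend on `Z`. Distributivity covers the empty coproduct, so `E` of a sequence with an initial entry
is initial. Hence every summand of the hom of `ΓE` from 0 to n is initial except the one indexed by
0, 1, ..., n, and the inclusion of `E Z` is invertible (`IsLinearGraph.isIso_incl`). Restricting the
hom map of a monad functor `M` along this summand gives the candidate `laxMap` for the component at
`Z`.

The step graph is also universal: a sequence of objects with homs `Z` in any graph is the image of
0, 1, ..., n under a morphism from `stepGraph Z` that is the identity along this sequence
(`exists_hom_of_stepGraph`). Naturality of `M` therefore expresses its restriction to every summand,
in every graph, through `laxMap` (`incl'_homMap`), so `M` is `Γ` of `laxMap` once the latter is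
known to be a lax structure. Each axiom for `laxMap` is read off from the corresponding property of
`M` in a suitable linear graph, where the inclusion of the relevant summand is invertible and can be
cancelled: naturality from a morphism of linear graphs, the unit law from the step graph of a single
object, and substitution from a doubly-nested sequence whose homs are the given sequence of
sequences.

The same cancellation shows that `φ` is monoidal whenever `𝒢φ` is a monad 2-cell. This is fullness
on 2-cells, and its case `φ = 𝟙` is injectivity of `Γ` on structures. Faithfulness is immediate,
since 2-cells are left unchanged.

In the oplax case the arrows are reversed, and the inclusion to cancel is that of `F` in the image
graph under `𝒢H`. This graph is linear because `H` preserves initial objects. Preservation of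
coproducts is used once more to test equality of maps out of `H` of a coproduct on its summands. -/

/-- The natural numbers, as a type in an arbitrary universe. -/
inductive Vertex : Type w
  | zero : Vertex
  | succ (x : Vertex) : Vertex

def Vertex.toNat : Vertex.{w} → ℕ
  | zero => 0
  | succ x => x.toNat + 1

/-! ### Linear sequences, and cutting sequences of objects into pieces. -/

namespace ObjSeq

/-- All the steps of the sequence are of the form `x, x + 1`. -/
def IsLinear : {x y : Vertex.{w}} → ObjSeq x y → Prop
  | _, _, nil _ => True
  | _, _, cons a (b := b) p => b = a.succ ∧ p.IsLinear

lemma IsLinear.toNat_le : {x y : Vertex.{w}} → {p : ObjSeq x y} → p.IsLinear →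
    x.toNat ≤ y.toNat
  | _, _, nil _, _ => le_rfl
  | x, _, cons _ p, h => by
    have h1 := IsLinear.toNat_le (p := p) h.2
    rw [h.1] at h1
    exact (Nat.le_succ _).trans h1

/-- Every step of a linear sequence is forced by its starting point. The lengths agree as well: a
nonempty linear sequence from `x` back to `x` would give `x + 1 ≤ x`, which excludes the two mixed
cases. -/
lemma IsLinear.unique : {x y : Vertex.{w}} → {p q : ObjSeq x y} → p.IsLinear → q.IsLinear → p = q
  | _, _, nil _, nil _, _, _ => rfl
  | _, _, nil _, cons _ q, _, h => by
    have h1 := IsLinear.toNat_le (p := q) h.2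
    rw [h.1] at h1
    exact absurd h1 (Nat.not_succ_le_self _)
  | _, _, cons _ p, nil _, h, _ => by
    have h1 := IsLinear.toNat_le (p := p) h.2
    rw [h.1] at h1
    exact absurd h1 (Nat.not_succ_le_self _)
  | _, _, cons x (b := b) p, cons _ (b := b') q, h, h' => by
    have hb : b = b' := h.1.trans h'.1.symm
    subst hb
    exact congrArg (cons x) (IsLinear.unique (p := p) (q := q) h.2 h'.2)

lemma IsLinear.map_succ : {x y : Vertex.{w}} → {p : ObjSeq x y} → p.IsLinear →
    (p.map Vertex.succ).IsLinear
  | _, _, nil _, _ => trivial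
  | _, _, cons _ _, h => ⟨congrArg Vertex.succ h.1, IsLinear.map_succ h.2⟩

variable {S T : Type w}

lemma homs_map_obj {A : Type*} (f : S → T) (C : T → T → A) : {a b : S} → (p : ObjSeq a b) →
    (p.map f).homs C = p.homs (fun x y => C (f x) (f y))
  | _, _, nil _ => rfl
  | _, _, cons _ p => congrArg (List.cons _) (homs_map_obj f C p)

/-- A decomposition of the sequence of homs of a sequence of objects comes from a decomposition
of this sequence. -/
lemma exists_comp_of_homs_eq_append {A : Type*} (C : S → S → A) : {a c : S} →
    (q : ObjSeq a c) → (L L' : List A) → q.homs C = L ++ L' →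
      ∃ (b : S) (q₁ : ObjSeq a b) (q₂ : ObjSeq b c), q = q₁.comp q₂ ∧ q₁.homs C = L ∧
        q₂.homs C = L'
  | _, _, q, [], _, h => ⟨_, nil _, q, rfl, rfl, h⟩
  | _, _, cons a q, X :: L, L', h => by
    obtain ⟨h1, h2⟩ := List.cons.inj h
    obtain ⟨b, q₁, q₂, rfl, h3, h4⟩ := exists_comp_of_homs_eq_append C q L L' h2
    exact ⟨b, cons a q₁, q₂, rfl, congrArg₂ List.cons h1 h3, h4⟩

/-- A decomposition of the sequence of homs of a sequence of objects into a sequence of sequences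
comes from a doubly-nested sequence. -/
lemma exists_nested_of_homs_eq_flatten {A : Type*} (C : S → S → A) : (Z : List (List A)) →
    {a b : S} → (q : ObjSeq a b) → q.homs C = Z.flatten →
      ∃ (p : ObjSeq a b) (c : p.Nested), p.nestedHoms C c = Z ∧ p.flat c = q
  | [], _, _, nil a, _ => ⟨nil a, PUnit.unit, rfl, rfl⟩
  | L :: Z, _, _, q, h => by
    obtain ⟨b, q₁, q₂, rfl, h1, h2⟩ := exists_comp_of_homs_eq_append C q L Z.flatten h
    obtain ⟨p, c, h3, rfl⟩ := exists_nested_of_homs_eq_flatten C Z q₂ h2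
    -- The outer sequence lists the break points. An empty list in `Z` repeats a break point, so the
    -- outer sequence need not be linear even when `q` is.
    exact ⟨cons _ p, (q₁, c), congrArg₂ List.cons h1 h3, rfl⟩

end ObjSeq

/-- Only the length of the list matters. Recursion on the list, with a shift by `succ` at each
stage, keeps `lastVertex`, `chain` and `stepGraph` in step definitionally. -/
def lastVertex {A : Type u} : List A → Vertex.{w}
  | [] => .zero
  | _ :: Z => .succ (lastVertex Z)

/-- The sequence `0, 1, ..., n`. -/
def chain {A : Type u} : (Z : List A) → ObjSeq Vertex.zero.{w} (lastVertex Z)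
  | [] => nil _
  | _ :: Z => cons _ ((chain Z).map Vertex.succ)

lemma isLinear_chain {A : Type u} : (Z : List A) → (chain.{w} Z).IsLinear
  | [] => trivial
  | _ :: Z => ⟨rfl, (isLinear_chain Z).map_succ⟩

/-! ### Initial objects as empty coproducts. -/

section Initial

variable {V : Type u} [Category.{v} V] {D : Type u'} [Category.{v'} D]

lemma IsCoprod.nonempty_isInitial {J : Type w} [IsEmpty J] {F : J → V} {P : V}
    {i : ∀ j, F j ⟶ P} (h : IsCoprod i) : Nonempty (IsInitial P) :=
  ⟨IsInitial.ofUniqueHom (fun _ => h.desc fun j => isEmptyElim j)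
    fun _ _ => h.hom_ext fun j => isEmptyElim j⟩

lemma IsCoprod.of_isInitial {J : Type w} [IsEmpty J] {F : J → V} {P : V}
    (i : ∀ j, F j ⟶ P) (h : IsInitial P) : IsCoprod i := fun T _ =>
  ⟨h.to T, fun j => isEmptyElim j, fun _ _ => h.hom_ext _ _⟩

/-- An initial object is the coproduct of the family indexed by `PEmpty`, so this is the empty case
of preservation of coproducts. -/
lemma nonempty_isInitial_obj {G : V ⥤ D}
    (hG : ∀ J : Type w, PreservesColimitsOfShape (Discrete J) G) {X : V}
    (hX : Nonempty (IsInitial X)) : Nonempty (IsInitial (G.obj X)) :=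
  ((IsCoprod.of_isInitial (F := fun _ : PEmpty.{w + 1} => X) (fun j => j.elim) hX.some).map G
    (hG _)).nonempty_isInitial

/-- With the other entries fixed, `G` is a functor of the entry `X` alone and preserves the empty
coproduct. This is what makes the unwanted summands of `ΓE` vanish. -/
lemma DistributiveFunctor.nonempty_isInitial {G : List V ⥤ D} (hG : DistributiveFunctor.{w} G)
    {Z : List V} {X : V} (hZ : X ∈ Z) (hX : Nonempty (IsInitial X)) :
    Nonempty (IsInitial (G.obj Z)) := by
  obtain ⟨P, Q, rfl⟩ := List.append_of_mem hZ
  exact nonempty_isInitial_obj (hG P Q) hX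

variable (V) in
/-- The empty coproduct. -/
noncomputable def emptyCoprod [HasCoproducts.{w} V] : V := ∐ fun j : PEmpty.{w + 1} => j.elim

variable (V) in
noncomputable def emptyCoprodIsInitial [HasCoproducts.{w} V] :
    IsInitial (emptyCoprod.{w} V) :=
  (IsCoprod.sigma fun j : PEmpty.{w + 1} => (j.elim : V)).nonempty_isInitial.some

end Initial

/-! ### Linear graphs, and the realisation of sequences by them. -/

section LinearGraph

variable {V : Type u} [Category.{v} V] {W : Type u'} [Category.{v'} W]

/-- The homs `C x y` of a graph with vertices `0, 1, ...` are initial unless `y = x + 1`. -/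
def IsLinearGraph (C : Vertex.{w} → Vertex.{w} → V) : Prop :=
  ∀ x y, y ≠ x.succ → Nonempty (IsInitial (C x y))

/-- Serves the oplax case, where the inclusion to be inverted belongs to `F` and to the image of the
graph under `𝒢H`. -/
lemma IsLinearGraph.map {C : Vertex.{w} → Vertex.{w} → V} (hC : IsLinearGraph C) {H : V ⥤ W}
    (hH : ∀ J : Type w, PreservesColimitsOfShape (Discrete J) H) :
    IsLinearGraph (fun x y => H.obj (C x y)) :=
  fun x y h => nonempty_isInitial_obj hH (hC x y h)

lemma IsLinearGraph.exists_isInitial {C : Vertex.{w} → Vertex.{w} → V} (hC : IsLinearGraph C) :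
    {x y : Vertex.{w}} → (p : ObjSeq x y) → ¬ p.IsLinear →
      ∃ X ∈ p.homs C, Nonempty (IsInitial X)
  | _, _, nil _, h => absurd trivial h
  | _, _, cons a (b := b) p, h => by
    by_cases hb : b = a.succ
    · obtain ⟨X, hX, h'⟩ := hC.exists_isInitial p fun h' => h ⟨hb, h'⟩
      exact ⟨X, List.mem_cons_of_mem _ hX, h'⟩
    · exact ⟨C a b, List.mem_cons_self, hC a b hb⟩

/-- Reindexing a sequence along `g` agrees with pulling the graph back along `g`. The lists of homs
agree only propositionally, hence the heterogeneous equality. It is used with `g = succ`, to pass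
from an extended graph to the graph it extends. -/
lemma homsHom_map_obj_heq {S T R : Type w} {C : S → S → V} {C' : T → T → V} {g : R → S}
    {f : S → T} (m : ∀ a b, C a b ⟶ C' (f a) (f b)) : {a b : R} → (p : ObjSeq a b) →
    HEq (homsHom (C' := C') m (p.map g))
      (homsHom (C := fun x y => C (g x) (g y)) (C' := C') (f := fun x => f (g x))
        (fun x y => m (g x) (g y)) p)
  | _, _, nil _ => HEq.rfl
  | _, _, cons _ p => consHom_heq (m _ _) (homs_map_obj g C p)
      (by rw [ObjSeq.map_map]) (homsHom_map_obj_heq m p)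

lemma idHoms_map_obj_heq {S R : Type w} {C C' : S → S → V} {g : R → S}
    (m : ∀ a b, C a b ⟶ C' a b) : {a b : R} → (p : ObjSeq a b) →
    HEq (idHoms m (p.map g))
      (idHoms (C := fun x y => C (g x) (g y)) (C' := fun x y => C' (g x) (g y))
        (fun x y => m (g x) (g y)) p)
  | _, _, nil _ => HEq.rfl
  | _, _, cons _ p => consHom_heq (m _ _) (homs_map_obj g C p) (homs_map_obj g C' p)
      (idHoms_map_obj_heq m p)

lemma heq_eqToHom_of_eq {C : Type u} [Category.{v} C] {X Y X' Y' : C} (h : X = Y) (hX : X = X')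
    (hY : Y = Y') : HEq (eqToHom h) (eqToHom (hX.symm.trans (h.trans hY))) := by
  subst hX hY h; rfl

variable [HasCoproducts.{w} V]

/-- In a linear graph, only the linear sequence contributes to `ΓE`. -/
theorem IsLinearGraph.isIso_incl {E : Multitensor V} (hE : Multitensor.Distributive.{w} E)
    {C : Vertex.{w} → Vertex.{w} → V} (hC : IsLinearGraph C) {x y : Vertex.{w}}
    {p : ObjSeq x y} (hp : p.IsLinear) : IsIso (E.incl C p) := by
  classical
  -- By uniqueness, any sequence other than `p` is not linear; it then has an initial entry, which
  -- makes its whole summand initial.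
  have hq : ∀ q : ObjSeq x y, q ≠ p → Nonempty (IsInitial (E.E.obj (q.homs C))) := fun q h => by
    obtain ⟨X, hX, h'⟩ := hC.exists_isInitial q fun hq => h (hq.unique hp)
    exact DistributiveFunctor.nonempty_isInitial.{w} hE hX h'
  have hd := E.incl_isCoprod C x y
  -- The candidate inverse: the identity on the summand `p`, and the unique map out of an initial
  -- object on every other summand.
  let k : ∀ q : ObjSeq x y, E.E.obj (q.homs C) ⟶ E.E.obj (p.homs C) := fun q =>
    if h : q = p then eqToHom (by rw [h]) else (hq q h).some.to _
  have hk : E.incl C p ≫ hd.desc k = 𝟙 _ := (hd.fac k p).trans (by simp [k])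
  refine ⟨hd.desc k, hk, hd.hom_ext fun q => ?_⟩
  -- The other composite is tested on each summand: on `p` it reduces to `hk`, and elsewhere two
  -- maps out of an initial object are compared.
  by_cases h : q = p
  · subst h
    rw [← Category.assoc, hk, Category.id_comp, Category.comp_id]
  · exact (hq q h).some.hom_ext _ _

lemma IsLinearGraph.isIso_incl' {E : Multitensor V} (hE : Multitensor.Distributive.{w} E)
    {C : Vertex.{w} → Vertex.{w} → V} (hC : IsLinearGraph C) {x y : Vertex.{w}}
    {p : ObjSeq x y} (hp : p.IsLinear) {Z : List V} (h : Z = p.homs C) :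
    IsIso (E.incl' C Z p h) := by
  have := hC.isIso_incl hE hp
  unfold Multitensor.incl'
  infer_instance

/-- The graph obtained from a graph with vertices `0, 1, ...` by shifting the vertices by one and
placing `X` between `0` and `1`. -/
noncomputable def extend (X : V) (C : Vertex.{w} → Vertex.{w} → V) :
    Vertex.{w} → Vertex.{w} → V
  | .zero, .succ .zero => X
  | .succ x, .succ y => C x y
  | .zero, .succ (.succ _) => emptyCoprod.{w} V
  | _, .zero => emptyCoprod.{w} V

lemma IsLinearGraph.extend (X : V) {C : Vertex.{w} → Vertex.{w} → V} (hC : IsLinearGraph C) :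
    IsLinearGraph (extend X C)
  | .zero, .succ .zero, h => absurd rfl h
  | .succ x, .succ y, h => hC x y fun h' => h (congrArg _ h')
  | .zero, .succ (.succ _), _ => ⟨emptyCoprodIsInitial V⟩
  | .zero, .zero, _ => ⟨emptyCoprodIsInitial V⟩
  | .succ _, .zero, _ => ⟨emptyCoprodIsInitial V⟩

/-- A morphism out of an extended graph. -/
noncomputable def extendDesc {T : Type w} {C' : T → T → V} {X : V}
    {C : Vertex.{w} → Vertex.{w} → V} (f : Vertex.{w} → T) (k : X ⟶ C' (f .zero) (f (.succ .zero)))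
    (m : ∀ x y, C x y ⟶ C' (f x.succ) (f y.succ)) :
    ∀ x y, extend X C x y ⟶ C' (f x) (f y)
  | .zero, .succ .zero => k
  | .succ x, .succ y => m x y
  | .zero, .succ (.succ _) => (emptyCoprodIsInitial V).to _
  | .zero, .zero => (emptyCoprodIsInitial V).to _
  | .succ _, .zero => (emptyCoprodIsInitial V).to _

variable (V) in
/-- The graph with vertices `0, 1, ...` and initial homs. -/
noncomputable def emptyGraph : Vertex.{w} → Vertex.{w} → V := fun _ _ => emptyCoprod.{w} V

lemma isLinearGraph_emptyGraph : IsLinearGraph (emptyGraph.{w} V) :=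
  fun _ _ _ => ⟨emptyCoprodIsInitial V⟩

/-- The graph `0 ⟶ 1 ⟶ ...` whose homs are the entries of a sequence. -/
noncomputable def stepGraph : List V → Vertex.{w} → Vertex.{w} → V
  | [] => emptyGraph V
  | X :: Z => extend X (stepGraph Z)

lemma isLinearGraph_stepGraph : (Z : List V) → IsLinearGraph (stepGraph.{w} Z)
  | [] => isLinearGraph_emptyGraph
  | X :: Z => (isLinearGraph_stepGraph Z).extend X

/-- Oriented with `Z` on the left because this is the form of equality that `Multitensor.incl'`
takes. -/
lemma chain_homs : (Z : List V) → Z = (chain.{w} Z).homs (stepGraph Z)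
  | [] => rfl
  | X :: Z => congrArg (List.cons X) ((chain_homs Z).trans
      (homs_map_obj Vertex.succ (stepGraph (X :: Z)) (chain Z)).symm)

/-- Every sequence of objects of a graph with sequence of homs `Z` is the image of the sequence
`0, 1, ..., n` under a morphism of graphs whose hom maps on this sequence are identities. -/
theorem exists_hom_of_stepGraph {T : Type w} (C' : T → T → V) : {c d : T} → (q : ObjSeq c d) →
    (Z : List V) → Z = q.homs C' → ∃ (f : Vertex.{w} → T)
      (m : ∀ x y, stepGraph Z x y ⟶ C' (f x) (f y)),
      f .zero = c ∧ f (lastVertex Z) = d ∧ HEq ((chain Z).map f) q ∧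
        ∃ e, homsHom m (chain Z) = eqToHom e
  | _, _, nil c, Z, h => by
    obtain rfl : Z = [] := h
    -- Any object function works, since all homs of the empty graph are initial; it only has to send
    -- 0 to `c`.
    exact ⟨fun _ => c, fun _ _ => (emptyCoprodIsInitial V).to _, rfl, rfl, HEq.rfl, rfl, rfl⟩
  | _, d, cons c q, X :: Z, h => by
    obtain ⟨h1, h2⟩ := List.cons.inj h
    obtain ⟨f, m, rfl, rfl, hq, e, hm⟩ := exists_hom_of_stepGraph C' q Z h2
    obtain rfl := eq_of_heq hq
    subst h1
    -- The new object function sends 0 to the first object `c` and follows `f` on the shifted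
    -- vertices, so `f'` after `succ` is `f` by definition.
    let f' : Vertex.{w} → T := fun x => match x with
      | .zero => c
      | .succ x => f x
    have hp : ((chain Z).map Vertex.succ).map f' = (chain Z).map f := ObjSeq.map_map _ _ _
    have hh : ((chain Z).map Vertex.succ).homs (stepGraph (C' c (f .zero) :: Z)) =
      (((chain Z).map Vertex.succ).map f').homs C' := by
      rw [hp, ← h2, homs_map_obj]
      exact (chain_homs Z).symm
    -- After the substitution the first entry is the hom from `c` to `f 0`, so the identity is a
    -- valid hom map from 0 to 1; `m` supplies the hom maps between shifted vertices.
    refine ⟨f', extendDesc (C' := C') f' (𝟙 _) m, rfl, rfl,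
      heq_of_eq (congrArg (cons c) hp), congrArg _ hh, ?_⟩
    -- The head is an identity, so it remains to see that the tail is a transport. The tail runs
    -- along the shifted chain, where the morphism restricts to `m` and `hm` applies.
    refine Eq.trans ?_ (consHom_eqToHom rfl hh)
    refine congrArg (consHom (𝟙 _)) (eq_of_heq ?_)
    refine (homsHom_map_obj_heq (g := Vertex.succ) _ _).trans ?_
    refine (heq_of_eq hm).trans ?_
    exact heq_eqToHom_of_eq e
      (homs_map_obj Vertex.succ (stepGraph (C' c (f .zero) :: Z)) (chain Z)).symm
      (congrArg (homs C') hp.symm)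

lemma exists_linearGraph_homs (Z : List V) :
    ∃ (C : Vertex.{w} → Vertex.{w} → V) (b : Vertex.{w}) (p : ObjSeq Vertex.zero b),
      IsLinearGraph C ∧ p.IsLinear ∧ p.homs C = Z :=
  ⟨stepGraph Z, _, chain Z, isLinearGraph_stepGraph Z, isLinear_chain Z, (chain_homs Z).symm⟩

/-- Take the step graph of the flattened sequence and cut its chain at the places prescribed by `Z`.
Linearity is claimed for the concatenation only: it is the summand of the concatenation, in the
graph with homs `C`, that has to be inverted. -/
lemma exists_linearGraph_nestedHoms (Z : List (List V)) :
    ∃ (C : Vertex.{w} → Vertex.{w} → V) (b : Vertex.{w}) (p : ObjSeq Vertex.zero b)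
      (c : p.Nested), IsLinearGraph C ∧ (p.flat c).IsLinear ∧ p.nestedHoms C c = Z := by
  obtain ⟨p, c, hZ, hc⟩ := exists_nested_of_homs_eq_flatten _ Z _ (chain_homs.{w} Z.flatten).symm
  exact ⟨_, _, p, c, isLinearGraph_stepGraph _, hc ▸ isLinear_chain _, hZ⟩

/-- Every morphism of sequences is the sequence of hom maps of a morphism of linear graphs. -/
theorem exists_idHoms_of_seqHom : {Z Z' : List V} → (f : Z ⟶ Z') →
    ∃ (C C' : Vertex.{w} → Vertex.{w} → V) (b : Vertex.{w}) (p : ObjSeq Vertex.zero b)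
      (m : ∀ x y, C x y ⟶ C' x y), IsLinearGraph C ∧ IsLinearGraph C' ∧ p.IsLinear ∧
        p.homs C = Z ∧ p.homs C' = Z' ∧ HEq (idHoms m p) f
  | _, _, SeqHom.nil => ⟨emptyGraph V, emptyGraph V, .zero, nil _, fun _ _ => 𝟙 _,
      isLinearGraph_emptyGraph, isLinearGraph_emptyGraph, trivial, rfl, rfl, HEq.rfl⟩
  | _, _, SeqHom.cons (a := X) (b := X') f fs => by
    obtain ⟨C, C', b, p, m, hC, hC', hp, rfl, rfl, h⟩ := exists_idHoms_of_seqHom fs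
    obtain rfl := eq_of_heq h
    -- Source and target graphs are extended together, so that one sequence `p` serves for both. The
    -- step graphs of `Z` and `Z'` would give chains whose end points agree only propositionally.
    refine ⟨extend X C, extend X' C', b.succ, cons _ (p.map Vertex.succ),
      extendDesc (C' := extend X' C') (fun x => x) f m, hC.extend X, hC'.extend X',
      ⟨rfl, hp.map_succ⟩,
      congrArg _ (homs_map_obj _ _ _), congrArg _ (homs_map_obj _ _ _), ?_⟩
    refine consHom_heq f (homs_map_obj _ _ _) (homs_map_obj _ _ _) ?_
    exact idHoms_map_obj_heq (g := Vertex.succ) (C := extend X C) (C' := extend X' C') _ p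

end LinearGraph

/-! ### Monad functors over `Set`, read on homs. -/

section HomMap

variable {V : Type u} [Category.{v} V] {W : Type u'} [Category.{v'} W]

/-- Lying over the identity of `Set` pins down the object function, so only hom maps over a fixed
set of objects remain. -/
lemma EGraph.exists_eq_mk {S : Type w} {C C' : S → S → V}
    (f : (EGraph.mk S C : EGraph.{w} V) ⟶ EGraph.mk S C')
    (e : (EGraph.ob V).map f = 𝟙 _) :
    ∃ m : ∀ a b, C a b ⟶ C' a b, 
      f = EGraph.Hom.mk (X := ⟨S, C⟩) (Y := ⟨S, C'⟩) (fun a => a) m := by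
  obtain ⟨o, m⟩ := f
  obtain rfl : o = fun a => a := by
    funext a
    exact congrArg (fun k => k.hom a) e
  exact ⟨m, rfl⟩

lemma EGraph.mk_injective {X Y : EGraph.{w} V} {o : X.obj → Y.obj}
    {m m' : ∀ a b, X.hom a b ⟶ Y.hom (o a) (o b)}
    (h : (EGraph.Hom.mk o m : X ⟶ Y) = EGraph.Hom.mk o m') (a b : X.obj) : m a b = m' a b :=
  congrFun (congrFun (eq_of_heq (EGraph.Hom.mk.inj h).2) a) b

variable [HasCoproducts.{w} V] [HasCoproducts.{w} W] {E : Multitensor V} {F : Multitensor W}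
  {H : V ⥤ W} {hE : Multitensor.Distributive.{w} E} {hF : Multitensor.Distributive.{w} F}

namespace MonadFunctorStr

variable (M : MonadFunctorStr (E.gamma hE) (F.gamma hF) (EGraph.map H) (EGraph.map_over H))
  {S T : Type w}

/-- The object function of `M.ψ.app` is the identity only propositionally, so its hom maps do not
have the desired type as they stand; `homMap` is chosen from this existence statement. The transport
in `over_set` is along a reflexivity here and unfolds to an identity. -/
lemma exists_homMap (C : S → S → V) :
    ∃ m : ∀ a b, F.gammaHom (fun x y => H.obj (C x y)) a b ⟶ H.obj (E.gammaHom C a b),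
      M.ψ.app ⟨S, C⟩ = EGraph.Hom.mk (X := ⟨S, F.gammaHom fun x y => H.obj (C x y)⟩)
        (Y := ⟨S, fun a b => H.obj (E.gammaHom C a b)⟩) (fun a => a) m :=
  EGraph.exists_eq_mk (M.ψ.app ⟨S, C⟩) (M.over_set ⟨S, C⟩)

/-- The hom maps of a monad functor structure over `Set`. -/
noncomputable def homMap (C : S → S → V) (a b : S) :
    F.gammaHom (fun x y => H.obj (C x y)) a b ⟶ H.obj (E.gammaHom C a b) :=
  (M.exists_homMap C).choose a b

lemma app_eq (X : EGraph.{w} V) :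
    M.ψ.app X = EGraph.Hom.mk (X := ((F.gamma hF).T.obj ((EGraph.map H).obj X)))
        (Y := (EGraph.map H).obj ((E.gamma hE).T.obj X)) (fun a => a) (M.homMap X.hom) :=
  (M.exists_homMap X.hom).choose_spec

/-- Naturality of `M.ψ` at a graph morphism, read on the hom from `a` to `b`. The morphism may
change the object set, which is what later allows transport from a step graph to an arbitrary graph.
-/
lemma homMap_natural {C : S → S → V} {C' : T → T → V} {f : S → T}
    (m : ∀ a b, C a b ⟶ C' (f a) (f b)) (a b : S) :
    F.gammaMap (C' := fun x y => H.obj (C' x y)) (f := f) (fun a b => H.map (m a b)) a b ≫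
        M.homMap C' (f a) (f b) = M.homMap C a b ≫ H.map (E.gammaMap m a b) := by
  have h := M.ψ.naturality (X := ⟨S, C⟩) (Y := ⟨T, C'⟩) ⟨f, m⟩
  rw [app_eq, app_eq] at h
  exact EGraph.mk_injective h a b

lemma homMap_unit (C : S → S → V) (a b : S) :
    F.gammaUnit (fun x y => H.obj (C x y)) a b ≫ M.homMap C a b =
      H.map (E.gammaUnit C a b) := by
  have h := M.unit ⟨S, C⟩
  rw [app_eq] at h
  exact EGraph.mk_injective h a b

lemma homMap_mul (C : S → S → V) (a b : S) :
    Multitensor.gammaMul hF (fun x y => H.obj (C x y)) a b ≫ M.homMap C a b =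
      F.gammaMap (f := fun x => x) (M.homMap C) a b ≫ M.homMap (E.gammaHom C) a b ≫
        H.map (Multitensor.gammaMul hE C a b) := by
  have h := M.mul ⟨S, C⟩
  rw [app_eq, app_eq] at h
  exact EGraph.mk_injective h a b

/-- The component at a sequence `Z` of the lax monoidal structure induced by a monad functor
structure. -/
noncomputable def laxMap (Z : List V) : F.E.obj (Z.map H.obj) ⟶ H.obj (E.E.obj Z) :=
  -- The inverse is taken in `V`, before `H` is applied, so no preservation property of `H` is
  -- needed.
  haveI := (isLinearGraph_stepGraph Z).isIso_incl' hE (isLinear_chain Z) (chain_homs Z)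
  F.incl' _ _ (chain Z) ((congrArg (List.map H.obj) (chain_homs Z)).trans
    (homs_map (stepGraph Z) H.obj (chain Z)).symm) ≫ M.homMap (stepGraph Z) _ _ ≫
      H.map (inv (E.incl' _ _ (chain Z) (chain_homs Z)))

/-- The defining square of `laxMap` with the inverse cleared: the universal case of `incl'_homMap`.
-/
lemma incl'_chain_homMap (Z : List V) (h) :
    F.incl' _ (Z.map H.obj) (chain Z) h ≫ M.homMap (stepGraph Z) _ _ =
      M.laxMap Z ≫ H.map (E.incl' _ _ (chain Z) (chain_homs Z)) := by
  have := (isLinearGraph_stepGraph.{w} Z).isIso_incl' hE (isLinear_chain Z) (chain_homs Z)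
  simp [laxMap]

end MonadFunctorStr

end HomMap

/-! ### Coproduct inclusions and morphisms of graphs. -/

section Comparison

variable {V : Type u} [Category.{v} V] {W : Type u'} [Category.{v'} W] {S T : Type w}

/-- A graph morphism that is the identity along `p` carries the summand of `p` identically onto the
summand of its image; the transport is absorbed by `incl'`. -/
lemma Multitensor.incl'_gammaMap_of_eqToHom [HasCoproducts.{w} V] (E : Multitensor V)
    {C : S → S → V} {C' : T → T → V} {f : S → T} (m : ∀ a b, C a b ⟶ C' (f a) (f b))
    {a b : S} (p : ObjSeq a b) (e : p.homs C = (p.map f).homs C')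
    (h : homsHom m p = eqToHom e) {Z : List V} (hZ : Z = p.homs C) :
    E.incl' C Z p hZ ≫ E.gammaMap m a b = E.incl' C' Z (p.map f) (hZ.trans e) := by
  rw [incl', Category.assoc, incl_gammaMap, h, E.map_incl, E.map_incl']

/-- Functors preserve identities, so a graph morphism that is the identity along `p` remains so
after `𝒢H`. Only the existence of the equality of lists is recorded, since its proof is irrelevant.
-/
lemma homsHom_map_eq_eqToHom (H : V ⥤ W) {C : S → S → V} {C' : T → T → V} {f : S → T}
    (m : ∀ a b, C a b ⟶ C' (f a) (f b)) {a b : S} (p : ObjSeq a b)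
    (e : p.homs C = (p.map f).homs C') (h : homsHom m p = eqToHom e) :
    ∃ e', homsHom (C := fun x y => H.obj (C x y)) (C' := fun x y => H.obj (C' x y)) (f := f)
      (fun a b => H.map (m a b)) p = eqToHom e' := by
  have h1 := homsHom_map_heq H m p
  rw [h, mapHom_eqToHom] at h1
  exact ⟨_, eq_of_heq (h1.trans
    (heq_eqToHom_of_eq _ (homs_map _ _ _).symm (homs_map _ _ _).symm))⟩

lemma idHoms_map_heq (H : V ⥤ W) {C C' : S → S → V}
    (m : ∀ a b, C a b ⟶ C' a b) : {a b : S} → (p : ObjSeq a b) →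
      HEq (idHoms (C := fun x y => H.obj (C x y)) (C' := fun x y => H.obj (C' x y))
        (fun a b => H.map (m a b)) p) (mapHom H (idHoms m p))
  | _, _, nil _ => HEq.rfl
  | _, _, cons _ p => consHom_heq (H.map (m _ _)) (homs_map _ _ _) (homs_map _ _ _)
      (idHoms_map_heq H m p)

/-- Using `incl'` on the image under `H` of the list of homs hides the identification with the homs
of the image graph, so that `mapHom H` appears exactly as in the naturality axiom of a lax or oplax
structure. -/
lemma Multitensor.incl'_gammaMap_map [HasCoproducts.{w} W] (F : Multitensor W) {H : V ⥤ W}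
    {C C' : S → S → V} (m : ∀ a b, C a b ⟶ C' a b) {a b : S} (p : ObjSeq a b) :
    F.incl' (fun x y => H.obj (C x y)) _ p (homs_map C H.obj p).symm ≫
        F.gammaMap (C' := fun x y => H.obj (C' x y)) (f := fun x => x)
          (fun a b => H.map (m a b)) a b =
      F.E.map (mapHom H (idHoms m p)) ≫
        F.incl' (fun x y => H.obj (C' x y)) _ p (homs_map C' H.obj p).symm := by
  have h := comp_eqToHom_of_heq (homs_map C H.obj p).symm (homs_map C' H.obj p).symm
    (idHoms_map_heq H m p).symm
  rw [incl', incl', Category.assoc, incl_gammaMap_id, ← Category.assoc, ← F.E.map_comp,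
    ← h, F.E.map_comp, Category.assoc]

end Comparison

/-! ### The lax monoidal structure of a monad functor. -/

namespace MonadFunctorStr

variable {V : Type u} [Category.{v} V] {W : Type u'} [Category.{v'} W]
variable [HasCoproducts.{w} V] [HasCoproducts.{w} W] {E : Multitensor V} {F : Multitensor W}
  {H : V ⥤ W} {hE : Multitensor.Distributive.{w} E} {hF : Multitensor.Distributive.{w} F}

variable (M : MonadFunctorStr (E.gamma hE) (F.gamma hF) (EGraph.map H) (EGraph.map_over H))
  {S T : Type w}

/-- Naturality along the morphism from the step graph, which is the identity along the chain,
carries the defining square of `laxMap` to the summand `p` of an arbitrary graph. Thus all of `M` is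
determined by `laxMap`. -/
theorem incl'_homMap (C : S → S → V) {a b : S} (p : ObjSeq a b) {Z : List V}
    (hZ : Z = p.homs C) (h) :
    F.incl' _ (Z.map H.obj) p h ≫ M.homMap C a b = M.laxMap Z ≫ H.map (E.incl' C Z p hZ) := by
  -- Once the end points are substituted, the heterogeneous equality becomes an equality and `p` is
  -- literally the image of the chain.
  obtain ⟨f, m, rfl, rfl, hq, e, hm⟩ := exists_hom_of_stepGraph C p Z hZ
  obtain rfl := eq_of_heq hq
  obtain ⟨e', hm'⟩ := homsHom_map_eq_eqToHom H m (chain Z) e hm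
  -- Both inclusions factor through those of the step graph: for `E` by `hm`, for `F` by `hm'`.
  -- `homMap_natural` connects the two factorisations.
  rw [← E.incl'_gammaMap_of_eqToHom m (chain Z) e hm (chain_homs Z), H.map_comp,
    ← Category.assoc,
    ← M.incl'_chain_homMap Z ((congrArg (List.map H.obj) (chain_homs Z)).trans
    (homs_map (stepGraph Z) H.obj (chain Z)).symm), Category.assoc, ← M.homMap_natural,
    ← Category.assoc,
    F.incl'_gammaMap_of_eqToHom _ _ _ hm']

/-- Has the shape of `LaxStr.incl_gammaHom`, so that `M` and `Γ` of its lax structure can be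
compared summand by summand. -/
lemma incl_homMap (C : S → S → V) {a b : S} (p : ObjSeq a b) :
    F.incl _ p ≫ M.homMap C a b =
      F.E.map (eqToHom (homs_map C H.obj p)) ≫ M.laxMap (p.homs C) ≫ H.map (E.incl C p) := by
  have h := M.incl'_homMap C p rfl (homs_map C H.obj p).symm
  rw [E.incl'_self] at h
  rw [← h, ← Category.assoc, F.map_incl', F.incl'_self]

lemma laxMap_comp_incl (C : S → S → V) {a b : S} (p : ObjSeq a b) :
    M.laxMap (p.homs C) ≫ H.map (E.incl C p) =
      F.incl' _ _ p (homs_map C H.obj p).symm ≫ M.homMap C a b := by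
  rw [M.incl'_homMap C p rfl, E.incl'_self]

/-- Realise `f` as the hom maps, along a linear sequence, of a morphism of linear graphs; then the
claim is naturality of `M` at this morphism restricted to one summand. -/
lemma laxMap_natural {Z Z' : List V} (f : Z ⟶ Z') :
    F.E.map (mapHom H f) ≫ M.laxMap Z' = M.laxMap Z ≫ H.map (E.E.map f) := by
  obtain ⟨C, C', b, p, m, hC, hC', hp, rfl, rfl, h⟩ := exists_idHoms_of_seqHom.{w} f
  obtain rfl := eq_of_heq h
  -- Both sides end in `H` of `E` at the target sequence, so it is the inclusion for the target
  -- graph that is cancelled.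
  have := hC'.isIso_incl hE hp
  rw [← cancel_mono (H.map (E.incl C' p)), Category.assoc, Category.assoc, ← H.map_comp,
    ← E.incl_gammaMap_id, H.map_comp, laxMap_comp_incl, ← Category.assoc (M.laxMap _),
    laxMap_comp_incl, Category.assoc, ← M.homMap_natural (f := fun x => x) m, ← Category.assoc,
    ← Category.assoc, F.incl'_gammaMap_map]

/-- The unit law of `M` factors through the summand of the sequence `a, b`. With a general graph
`C`, the case of `stepGraph [X]` follows by unfolding, as its hom from 0 to 1 is `X` by definition.
-/
lemma unit_comp_laxMap (C : S → S → V) (a b : S) [IsIso (E.inclSingle C a b)] :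
    F.u (H.obj (C a b)) ≫ M.laxMap [C a b] = H.map (E.u (C a b)) := by
  have h1 := M.homMap_unit C a b
  have h2 : M.laxMap [C a b] ≫ H.map (E.inclSingle C a b) =
      F.inclSingle (fun x y => H.obj (C x y)) a b ≫ M.homMap C a b :=
    (M.laxMap_comp_incl C (single a b)).trans (congrArg (· ≫ _) (F.incl'_self _ _))
  rw [Multitensor.gammaUnit, Multitensor.gammaUnit, Category.assoc, ← h2, H.map_comp,
    ← Category.assoc] at h1
  exact (cancel_mono _).1 h1

lemma laxMap_unit (X : V) : F.u (H.obj X) ≫ M.laxMap [X] = H.map (E.u X) := by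
  have : IsIso (E.inclSingle (stepGraph [X]) .zero (.succ .zero)) :=
    (isLinearGraph_stepGraph.{w} [X]).isIso_incl hE (isLinear_chain [X])
  exact M.unit_comp_laxMap (stepGraph [X]) .zero (.succ .zero)

/-- This is `incl_homMap` applied to each inner sequence. It parallels `LaxStr.nestedIncl_idHoms`,
which is not available here because it presupposes the substitution axiom being proved. -/
lemma nestedIncl_idHoms (C : S → S → V) : {a b : S} → (p : ObjSeq a b) → (c : p.Nested) →
    F.nestedIncl _ p c ≫ idHoms (M.homMap C) p ≫ eqToHom (homs_map (E.gammaHom C) H.obj p) =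
      eqToHom (by rw [nestedHoms_map]) ≫ seqOf₂ M.laxMap (p.nestedHoms C c) ≫
        mapHom H (E.nestedIncl C p c)
  | _, _, nil _, _ => rfl
  | _, _, cons a (b := b) p, c => by
    have h1 := consHom_eqToHom (rfl : H.obj (E.gammaHom C a b) = _)
      (homs_map (E.gammaHom C) H.obj p)
    have h2 := consHom_eqToHom (congrArg F.E.obj (homs_map C H.obj c.1))
      (congrArg (List.map F.E.obj) (nestedHoms_map C H.obj p c.2))
    refine (congrArg (fun t => F.nestedIncl _ (ObjSeq.cons a p) c ≫
      idHoms (M.homMap C) (ObjSeq.cons a p) ≫ t) h1.symm).trans ?_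
    refine Eq.trans ?_ (congrArg (fun t =>
      t ≫ seqOf₂ M.laxMap ((ObjSeq.cons a p).nestedHoms C c) ≫
        mapHom H (E.nestedIncl C (ObjSeq.cons a p) c)) h2)
    refine congrArg₂ consHom ?_ (nestedIncl_idHoms C p c.2)
    rw [eqToHom_refl, Category.comp_id, incl_homMap, eqToHom_map]

/-- The first two factors on the right of the multiplication law, on a doubly-nested summand:
`incl_homMap` acts once on the inner sequences, under `F`, and once on the outer sequence in the
graph `ΓE`. Naturality of `laxMap` then moves the inner inclusions past it. -/
lemma incl₂_gammaMap_homMap (C : S → S → V) {a b : S} (p : ObjSeq a b) (c : p.Nested) :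
    F.incl₂ _ p c ≫ F.gammaMap (f := fun x => x) (M.homMap C) a b ≫
        M.homMap (E.gammaHom C) a b =
      F.E.map (eqToHom (by rw [nestedHoms_map])) ≫ F.E.map (seqOf₂ M.laxMap (p.nestedHoms C c)) ≫
        M.laxMap ((p.nestedHoms C c).map E.E.obj) ≫ H.map (E.incl₂ C p c) := by
  rw [Multitensor.incl₂, Category.assoc, ← Category.assoc (F.incl _ _),
    Multitensor.incl_gammaMap_id, Category.assoc, incl_homMap,
    ← Category.assoc (F.E.map (idHoms _ _)), ← F.E.map_comp, ← Category.assoc,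
    ← F.E.map_comp, nestedIncl_idHoms, F.E.map_comp, F.E.map_comp, Category.assoc,
    Category.assoc, ← Category.assoc (F.E.map (mapHom _ _)), M.laxMap_natural, Category.assoc,
    ← H.map_comp]
  rfl

/-- In a graph with a doubly-nested sequence whose homs are `Z`, the multiplication law of `M` on
that summand is the required equation followed by `H` of the inclusion of the concatenation. The
concatenation is linear, so this inclusion can be cancelled. -/
lemma laxMap_subst (Z : List (List V)) :
    F.E.map (seqOf₂ M.laxMap Z) ≫ M.laxMap (Z.map E.E.obj) ≫ H.map (E.σ Z) =
      F.σ (Z.map (List.map H.obj)) ≫ F.E.map (eqToHom (map_flatten_eq H.obj Z)) ≫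
        M.laxMap Z.flatten := by
  obtain ⟨C, b, p, c, hC, hl, rfl⟩ := exists_linearGraph_nestedHoms.{w} Z
  have := hC.isIso_incl' hE hl (flatten_nestedHoms C p c)
  rw [← cancel_mono (H.map (E.incl' C _ (p.flat c) (flatten_nestedHoms C p c)))]
  have h := congrArg (F.incl₂ _ p c ≫ ·) (M.homMap_mul C _ _)
  have h1 := congrArg (· ≫ H.map (Multitensor.gammaMul hE C _ _)) (M.incl₂_gammaMap_homMap C p c)
  simp only [Category.assoc] at h h1 ⊢
  -- On both sides the multiplication of `Γ`, restricted to the doubly-nested summand, becomes `σ`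
  -- followed by an inclusion.
  rw [h1, ← H.map_comp, Multitensor.incl₂_gammaMul, ← Category.assoc,
    Multitensor.incl₂_gammaMul, Category.assoc] at h
  rw [← M.incl'_homMap C (p.flat c) (flatten_nestedHoms C p c) (by
      rw [flatten_nestedHoms, homs_map]), ← Category.assoc (F.E.map (eqToHom _)) (F.incl' _ _ _ _),
    F.map_incl']
  -- The source of `h` is built from the nested homs of the image graph, that of the goal from the
  -- image of the nested homs. Precomposing with the invertible transport between them makes `h`
  -- applicable.
  rw [← H.map_comp, ← cancel_epi (F.E.map (eqToHom (congrArg (List.map F.E.obj)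
      (nestedHoms_map C H.obj p c)))), ← h,
    ← Category.assoc _ (F.σ _), Multitensor.σ_cast F (nestedHoms_map C H.obj p c), Category.assoc,
    ← Category.assoc (F.E.map (eqToHom _)) (F.incl' _ _ _ _), F.map_incl']

/-- The lax monoidal structure induced by a monad functor structure over `Set`. -/
noncomputable def toLaxStr : LaxStr E F H where
  ψ := M.laxMap
  natural := M.laxMap_natural
  unit := M.laxMap_unit
  subst := M.laxMap_subst

lemma toLaxStr_gammaHom (C : S → S → V) (a b : S) : M.toLaxStr.gammaHom C a b = M.homMap C a b :=
  (F.incl_isCoprod _ a b).hom_ext fun p => by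
    rw [LaxStr.incl_gammaHom, incl_homMap]
    rfl

lemma gamma_toLaxStr : M.toLaxStr.gamma hE hF = M :=
  MonadFunctorStr.ext_app fun X => by
    rw [M.app_eq]
    exact EGraph.hom_ext fun a b => M.toLaxStr_gammaHom X.hom a b

end MonadFunctorStr

/-! ### Monad 2-cells and bijectivity of `Γ`, lax case. -/

section LaxFull

variable {V : Type u} [Category.{v} V] {W : Type u'} [Category.{v'} W]
variable [HasCoproducts.{w} V] [HasCoproducts.{w} W] {E : Multitensor V} {F : Multitensor W}
  {H K : V ⥤ W} {hE : Multitensor.Distributive.{w} E} {hF : Multitensor.Distributive.{w} F}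

lemma LaxStr.ψ_comp_incl {S : Type w} (L : LaxStr E F H) (C : S → S → V) {a b : S}
    (p : ObjSeq a b) : L.ψ (p.homs C) ≫ H.map (E.incl C p) =
      F.incl' _ _ p (homs_map C H.obj p).symm ≫ L.gammaHom C a b := by
  rw [LaxStr.incl'_gammaHom, eqToHom_refl, F.E.map_id, Category.id_comp]

/-- A monad 2-cell between the monad functors of lax monoidal functors is monoidal. -/
theorem LaxStr.isMonoidal_of_isCell {L : LaxStr E F H} {M : LaxStr E F K} {φ : H ⟶ K}
    (h : (L.gamma hE hF).IsCell (M.gamma hE hF) (EGraph.mapNat φ)) :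
    L.IsMonoidal M φ := fun Z => by
  obtain ⟨C, b, p, hC, hp, rfl⟩ := exists_linearGraph_homs.{w} Z
  have := hC.isIso_incl hE hp
  have h1 : L.gammaHom C .zero b ≫ φ.app (E.gammaHom C .zero b) =
      F.gammaMap (f := fun x => x) (fun x y => φ.app (C x y)) .zero b ≫ M.gammaHom C .zero b :=
    EGraph.mk_injective (h ⟨_, C⟩) .zero b
  have h2 := comp_eqToHom_of_heq (homs_map _ _ _).symm (homs_map _ _ _).symm
    (seqOf_homs φ C p).symm
  have h3 : F.incl' _ _ p (homs_map C H.obj p).symm ≫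
      F.gammaMap (f := fun x => x) (fun x y => φ.app (C x y)) .zero b =
      F.E.map (seqOf (fun X => φ.app X) (p.homs C)) ≫
        F.incl' _ _ p (homs_map C K.obj p).symm := by
    rw [Multitensor.incl', Multitensor.incl', Category.assoc, Multitensor.incl_gammaMap_id,
      ← Category.assoc, ← F.E.map_comp, ← h2, F.E.map_comp, Category.assoc]
  -- After the invertible inclusion is added on the right, the claim is the cell condition `h1`
  -- restricted to the summand `p`.
  rw [← cancel_mono (K.map (E.incl C p)), Category.assoc, Category.assoc, ← φ.naturality,
    ← Category.assoc, LaxStr.ψ_comp_incl, LaxStr.ψ_comp_incl, Category.assoc, h1,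
    ← Category.assoc, h3, Category.assoc]

/-- Surjectivity is `gamma_toLaxStr`. For injectivity, if two structures have the same image under
`Γ`, the identity of `H` is a monad 2-cell between the images, hence monoidal, and for an identity
this says that the two structures coincide. -/
theorem LaxStr.gamma_bijective (hE : Multitensor.Distributive.{w} E)
    (hF : Multitensor.Distributive.{w} F) (H : V ⥤ W) :
    Function.Bijective (fun L : LaxStr E F H => L.gamma hE hF) := by
  refine ⟨fun L M h => LaxStr.ext' fun Z => ?_, fun M => ⟨M.toLaxStr, M.gamma_toLaxStr⟩⟩
  have h1 : L.IsMonoidal M (𝟙 H) := LaxStr.isMonoidal_of_isCell (hE := hE) (hF := hF) fun X => by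
    have h2 : L.gamma hE hF = M.gamma hE hF := h
    rw [h2]
    exact (Category.comp_id _).trans
      ((congrArg (· ≫ _) ((F.gamma hF).T.map_id _)).trans (Category.id_comp _)).symm
  have h2 := h1 Z
  have h3 : seqOf (fun X => (𝟙 H : H ⟶ H).app X) Z = 𝟙 (Z.map H.obj) := seqOf_id H.obj Z
  rw [h3, F.E.map_id, Category.id_comp] at h2
  exact (Category.comp_id _).symm.trans h2

end LaxFull

/-! ### The oplax case. -/

section Oplax

variable {V : Type u} [Category.{v} V] {W : Type u'} [Category.{v'} W]
  [HasCoproducts.{w} V] [HasCoproducts.{w} W] {E : Multitensor V} {F : Multitensor W}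
  {H K : V ⥤ W} {hE : Multitensor.Distributive.{w} E} {hF : Multitensor.Distributive.{w} F}

namespace MonadOpfunctorStr

variable (M : MonadOpfunctorStr (E.gamma hE) (F.gamma hF) (EGraph.map H) (EGraph.map_over H))
  {S T : Type w}

lemma exists_homMap (C : S → S → V) :
    ∃ m : ∀ a b, H.obj (E.gammaHom C a b) ⟶ F.gammaHom (fun x y => H.obj (C x y)) a b,
      M.ψ.app ⟨S, C⟩ = EGraph.Hom.mk (X := ⟨S, fun a b => H.obj (E.gammaHom C a b)⟩)
        (Y := ⟨S, F.gammaHom fun x y => H.obj (C x y)⟩) (fun a => a) m :=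
  EGraph.exists_eq_mk (M.ψ.app ⟨S, C⟩) (M.over_set ⟨S, C⟩)

/-- The hom maps of a monad opfunctor structure over `Set`. -/
noncomputable def homMap (C : S → S → V) (a b : S) :
    H.obj (E.gammaHom C a b) ⟶ F.gammaHom (fun x y => H.obj (C x y)) a b :=
  (M.exists_homMap C).choose a b

lemma app_eq (X : EGraph.{w} V) :
    M.ψ.app X = EGraph.Hom.mk (X := (EGraph.map H).obj ((E.gamma hE).T.obj X))
      (Y := (F.gamma hF).T.obj ((EGraph.map H).obj X)) (fun a => a) (M.homMap X.hom) :=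
  (M.exists_homMap X.hom).choose_spec

lemma homMap_natural {C : S → S → V} {C' : T → T → V} {f : S → T}
    (m : ∀ a b, C a b ⟶ C' (f a) (f b)) (a b : S) :
    H.map (E.gammaMap m a b) ≫ M.homMap C' (f a) (f b) =
      M.homMap C a b ≫ F.gammaMap (C' := fun x y => H.obj (C' x y)) (f := f)
        (fun a b => H.map (m a b)) a b := by
  have h := M.ψ.naturality (X := ⟨S, C⟩) (Y := ⟨T, C'⟩) ⟨f, m⟩
  rw [app_eq, app_eq] at h
  exact EGraph.mk_injective h a b

lemma homMap_unit (C : S → S → V) (a b : S) :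
    H.map (E.gammaUnit C a b) ≫ M.homMap C a b =
      F.gammaUnit (fun x y => H.obj (C x y)) a b := by
  have h := M.unit ⟨S, C⟩
  rw [app_eq] at h
  exact EGraph.mk_injective h a b

lemma homMap_mul (C : S → S → V) (a b : S) :
    H.map (Multitensor.gammaMul hE C a b) ≫ M.homMap C a b =
      M.homMap (E.gammaHom C) a b ≫ F.gammaMap (f := fun x => x) (M.homMap C) a b ≫
        Multitensor.gammaMul hF (fun x y => H.obj (C x y)) a b := by
  have h := M.mul ⟨S, C⟩
  rw [app_eq, app_eq] at h
  exact EGraph.mk_injective h a b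

variable (hH : ∀ J : Type w, PreservesColimitsOfShape (Discrete J) H)

/-- The component at a sequence `Z` of the oplax monoidal structure induced by a monad opfunctor
structure. -/
noncomputable def oplaxMap (Z : List V) : H.obj (E.E.obj Z) ⟶ F.E.obj (Z.map H.obj) :=
  -- The inclusion now stands on the target side, in the image of the step graph under `𝒢H`; that
  -- graph is linear because `H` preserves initial objects.
  haveI := ((isLinearGraph_stepGraph Z).map hH).isIso_incl' hF (isLinear_chain Z)
    ((congrArg (List.map H.obj) (chain_homs Z)).trans
      (homs_map (stepGraph Z) H.obj (chain Z)).symm)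
  H.map (E.incl' _ _ (chain Z) (chain_homs Z)) ≫ M.homMap (stepGraph Z) _ _ ≫
    inv (F.incl' (fun x y => H.obj (stepGraph Z x y)) (Z.map H.obj) (chain Z)
      ((congrArg (List.map H.obj) (chain_homs Z)).trans
        (homs_map (stepGraph Z) H.obj (chain Z)).symm))

lemma incl'_chain_homMap (Z : List V) (h) :
    H.map (E.incl' _ _ (chain Z) (chain_homs Z)) ≫ M.homMap (stepGraph Z) _ _ =
      M.oplaxMap hH Z ≫ F.incl' _ (Z.map H.obj) (chain Z) h := by
  have := ((isLinearGraph_stepGraph Z).map hH).isIso_incl' hF (isLinear_chain Z) h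
  simp [oplaxMap]

/-- Same transport from the step graph as in the lax case, with the naturality square of `M` read in
the other direction. -/
theorem incl'_homMap (C : S → S → V) {a b : S} (p : ObjSeq a b) {Z : List V}
    (hZ : Z = p.homs C) (h) :
    H.map (E.incl' C Z p hZ) ≫ M.homMap C a b =
      M.oplaxMap hH Z ≫ F.incl' _ (Z.map H.obj) p h := by
  obtain ⟨f, m, rfl, rfl, hq, e, hm⟩ := exists_hom_of_stepGraph C p Z hZ
  obtain rfl := eq_of_heq hq
  obtain ⟨e', hm'⟩ := homsHom_map_eq_eqToHom H m (chain Z) e hm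
  rw [← E.incl'_gammaMap_of_eqToHom m (chain Z) e hm (chain_homs Z), H.map_comp, Category.assoc,
    M.homMap_natural, ← Category.assoc,
    M.incl'_chain_homMap hH Z ((congrArg (List.map H.obj) (chain_homs Z)).trans
      (homs_map (stepGraph Z) H.obj (chain Z)).symm), Category.assoc,
    F.incl'_gammaMap_of_eqToHom _ _ _ hm']

lemma incl_homMap (C : S → S → V) {a b : S} (p : ObjSeq a b) :
    H.map (E.incl C p) ≫ M.homMap C a b =
      M.oplaxMap hH (p.homs C) ≫ F.incl' _ _ p (homs_map C H.obj p).symm := by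
  rw [← M.incl'_homMap hH C p rfl, E.incl'_self]

lemma oplaxMap_natural {Z Z' : List V} (f : Z ⟶ Z') :
    H.map (E.E.map f) ≫ M.oplaxMap hH Z' = M.oplaxMap hH Z ≫ F.E.map (mapHom H f) := by
  obtain ⟨C, C', b, p, m, hC, hC', hp, rfl, rfl, h⟩ := exists_idHoms_of_seqHom.{w} f
  obtain rfl := eq_of_heq h
  -- The two sides end in `F` of the image under `H` of the target sequence, so the inclusion to
  -- cancel is that of `F` in the image of the target graph.
  have := (hC'.map hH).isIso_incl' hF hp (homs_map C' H.obj p).symm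
  rw [← cancel_mono (F.incl' (fun x y => H.obj (C' x y)) _ p (homs_map C' H.obj p).symm),
    Category.assoc, Category.assoc, ← F.incl'_gammaMap_map, ← incl_homMap, ← Category.assoc,
    ← H.map_comp, ← E.incl_gammaMap_id, H.map_comp, Category.assoc,
    M.homMap_natural (f := fun x => x) m, ← Category.assoc, M.incl_homMap hH, Category.assoc]

lemma unit_comp_oplaxMap (C : S → S → V) (a b : S)
    [IsIso (F.inclSingle (fun x y => H.obj (C x y)) a b)] :
    H.map (E.u (C a b)) ≫ M.oplaxMap hH [C a b] = F.u (H.obj (C a b)) := by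
  have h1 := M.homMap_unit C a b
  have h2 : H.map (E.inclSingle C a b) ≫ M.homMap C a b =
      M.oplaxMap hH [C a b] ≫ F.inclSingle (fun x y => H.obj (C x y)) a b :=
    (M.incl_homMap hH C (single a b)).trans (congrArg (_ ≫ ·) (F.incl'_self _ _))
  rw [Multitensor.gammaUnit, Multitensor.gammaUnit, H.map_comp, Category.assoc, h2,
    ← Category.assoc] at h1
  exact (cancel_mono _).1 h1

lemma oplaxMap_unit (X : V) : H.map (E.u X) ≫ M.oplaxMap hH [X] = F.u (H.obj X) := by
  have : IsIso (F.inclSingle (fun x y => H.obj (stepGraph [X] x y)) .zero (.succ .zero)) :=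
    ((isLinearGraph_stepGraph.{w} [X]).map hH).isIso_incl hF (isLinear_chain [X])
  exact M.unit_comp_oplaxMap hH (stepGraph [X]) .zero (.succ .zero)

lemma nestedIncl_idHoms (C : S → S → V) : {a b : S} → (p : ObjSeq a b) → (c : p.Nested) →
    mapHom H (E.nestedIncl C p c) ≫ eqToHom (homs_map (E.gammaHom C) H.obj p).symm ≫
        idHoms (M.homMap C) p =
      seqOf₂ (M.oplaxMap hH) (p.nestedHoms C c) ≫ eqToHom (by rw [nestedHoms_map]) ≫
        F.nestedIncl _ p c
  | _, _, nil _, _ => rfl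
  | _, _, cons a (b := b) p, c => by
    have h1 := consHom_eqToHom (rfl : H.obj (E.gammaHom C a b) = _)
      (homs_map (E.gammaHom C) H.obj p).symm
    have h2 := consHom_eqToHom (congrArg F.E.obj (homs_map C H.obj c.1).symm)
      (congrArg (List.map F.E.obj) (nestedHoms_map C H.obj p c.2).symm)
    refine (congrArg (fun t => mapHom H (E.nestedIncl C (ObjSeq.cons a p) c) ≫ t ≫
      idHoms (M.homMap C) (ObjSeq.cons a p)) h1.symm).trans ?_
    refine Eq.trans ?_ (congrArg (fun t =>
      seqOf₂ (M.oplaxMap hH) ((ObjSeq.cons a p).nestedHoms C c) ≫ t ≫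
        F.nestedIncl _ (ObjSeq.cons a p) c) h2)
    refine congrArg₂ consHom ?_ (nestedIncl_idHoms C p c.2)
    rw [eqToHom_refl, Category.id_comp, M.incl_homMap hH, Multitensor.incl', eqToHom_map]

lemma incl₂_homMap_gammaMap (C : S → S → V) {a b : S} (p : ObjSeq a b) (c : p.Nested) :
    H.map (E.incl₂ C p c) ≫ M.homMap (E.gammaHom C) a b ≫
        F.gammaMap (f := fun x => x) (M.homMap C) a b =
      M.oplaxMap hH ((p.nestedHoms C c).map E.E.obj) ≫
        F.E.map (seqOf₂ (M.oplaxMap hH) (p.nestedHoms C c)) ≫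
          F.E.map (eqToHom (by rw [nestedHoms_map])) ≫ F.incl₂ _ p c := by
  rw [Multitensor.incl₂, H.map_comp, Category.assoc, ← Category.assoc (H.map (E.incl _ _)),
    M.incl_homMap hH, Multitensor.incl', Category.assoc, Category.assoc,
    Multitensor.incl_gammaMap_id, ← Category.assoc, M.oplaxMap_natural, Category.assoc,
    ← Category.assoc (F.E.map (eqToHom _)), ← F.E.map_comp,
    ← Category.assoc (F.E.map (mapHom _ _)), ← F.E.map_comp, M.nestedIncl_idHoms hH, F.E.map_comp,
    F.E.map_comp, Category.assoc, Category.assoc]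
  rfl

lemma oplaxMap_subst (Z : List (List V)) :
    M.oplaxMap hH (Z.map E.E.obj) ≫ F.E.map (seqOf₂ (M.oplaxMap hH) Z) ≫
        F.σ (Z.map (List.map H.obj)) ≫ F.E.map (eqToHom (map_flatten_eq H.obj Z)) =
      H.map (E.σ Z) ≫ M.oplaxMap hH Z.flatten := by
  obtain ⟨C, b, p, c, hC, hl, rfl⟩ := exists_linearGraph_nestedHoms.{w} Z
  have hf : (p.nestedHoms C c).flatten.map H.obj = (p.flat c).homs fun x y => H.obj (C x y) := by
    rw [flatten_nestedHoms, homs_map]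
  have := (hC.map hH).isIso_incl' hF hl hf
  rw [← cancel_mono (F.incl' (fun x y => H.obj (C x y)) _ (p.flat c) hf)]
  have h := congrArg (H.map (E.incl₂ C p c) ≫ ·) (M.homMap_mul C _ _)
  have h1 := congrArg (· ≫ Multitensor.gammaMul hF (fun x y => H.obj (C x y)) _ _)
    (M.incl₂_homMap_gammaMap hH C p c)
  simp only [Category.assoc] at h h1 ⊢
  -- `h` becomes the claim followed by the inclusion of the concatenation. Unlike in the lax case
  -- the transport of lists sits in the middle and moves past `σ` into `incl'`, so nothing has to be
  -- cancelled on the left.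
  rw [h1, ← Category.assoc, ← H.map_comp, Multitensor.incl₂_gammaMul,
    Multitensor.incl₂_gammaMul, H.map_comp, Category.assoc,
    M.incl'_homMap hH C (p.flat c) (flatten_nestedHoms C p c) hf,
    ← Category.assoc (F.E.map (eqToHom _)),
    Multitensor.σ_cast F (nestedHoms_map C H.obj p c).symm, Category.assoc, F.map_incl'] at h
  rw [h, F.map_incl']

/-- The oplax monoidal structure induced by a monad opfunctor structure over `Set`. -/
noncomputable def toOplaxStr : OplaxStr E F H where
  ψ := M.oplaxMap hH
  natural := M.oplaxMap_natural hH
  unit := M.oplaxMap_unit hH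
  subst := M.oplaxMap_subst hH

/-- The maps agree after `H` of each inclusion, and these are jointly epimorphic because `H`
preserves the coproduct. -/
lemma toOplaxStr_gammaHom (C : S → S → V) (a b : S) :
    (M.toOplaxStr hH).gammaHom hH C a b = M.homMap C a b :=
  map_incl_hom_ext hH C fun p => by
    rw [OplaxStr.incl_gammaHom, M.incl_homMap hH]
    rfl

lemma gamma_toOplaxStr : (M.toOplaxStr hH).gamma hH hE hF = M :=
  MonadOpfunctorStr.ext_app fun X => by
    rw [M.app_eq]
    exact EGraph.hom_ext fun a b => M.toOplaxStr_gammaHom hH X.hom a b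

end MonadOpfunctorStr

/-- A monad 2-cell between the monad opfunctors of oplax monoidal functors is monoidal. -/
theorem OplaxStr.isMonoidal_of_isCell {L : OplaxStr E F H} {M : OplaxStr E F K} {φ : H ⟶ K}
    {hH : ∀ J : Type w, PreservesColimitsOfShape (Discrete J) H}
    {hK : ∀ J : Type w, PreservesColimitsOfShape (Discrete J) K}
    (h : (L.gamma hH hE hF).IsCell (M.gamma hK hE hF) (EGraph.mapNat φ)) :
    L.IsMonoidal M φ := fun Z => by
  obtain ⟨C, b, p, hC, hp, rfl⟩ := exists_linearGraph_homs.{w} Z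
  -- The equation takes values in `F` of the image under `K`, so it is preservation of initial
  -- objects by `K` that makes the cancellation possible.
  have := (hC.map hK).isIso_incl' hF hp (homs_map C K.obj p).symm
  have h1 : φ.app (E.gammaHom C .zero b) ≫ M.gammaHom hK C .zero b = L.gammaHom hH C .zero b ≫
      F.gammaMap (f := fun x => x) (fun x y => φ.app (C x y)) .zero b :=
    EGraph.mk_injective (h ⟨_, C⟩) .zero b
  have h2 := congrArg (H.map (E.incl C p) ≫ ·) h1
  have h3 := comp_eqToHom_of_heq (homs_map _ _ _).symm (homs_map _ _ _).symm
    (seqOf_homs φ C p).symm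
  rw [← Category.assoc, φ.naturality, Category.assoc, OplaxStr.incl_gammaHom, F.map_incl,
    ← Category.assoc (H.map _), OplaxStr.incl_gammaHom, Category.assoc, Category.assoc,
    Multitensor.incl_gammaMap_id, ← Category.assoc (F.E.map (eqToHom _)), ← F.E.map_comp, ← h3,
    F.E.map_comp, Category.assoc, F.map_incl] at h2
  rw [← cancel_mono (F.incl' (fun x y => K.obj (C x y)) _ p (homs_map C K.obj p).symm),
    Category.assoc, Category.assoc, h2]

/-- As in the lax case, injectivity is the statement on 2-cells applied to the identity of `H`. -/
theorem OplaxStr.gamma_bijective (hE : Multitensor.Distributive.{w} E)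
    (hF : Multitensor.Distributive.{w} F)
    (hH : ∀ J : Type w, PreservesColimitsOfShape (Discrete J) H) :
    Function.Bijective (fun L : OplaxStr E F H => L.gamma hH hE hF) := by
  refine ⟨fun L M h => OplaxStr.ext' fun Z => ?_,
    fun M => ⟨M.toOplaxStr hH, M.gamma_toOplaxStr hH⟩⟩
  have h1 : L.IsMonoidal M (𝟙 H) := OplaxStr.isMonoidal_of_isCell (hH := hH) (hK := hH)
    (hE := hE) (hF := hF) fun X => by
      have h2 : L.gamma hH hE hF = M.gamma hH hE hF := h
      rw [h2]
      exact (Category.id_comp _).trans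
        ((congrArg (_ ≫ ·) ((F.gamma hF).T.map_id _)).trans (Category.comp_id _)).symm
  have h2 := h1 Z
  have h3 : seqOf (fun X => (𝟙 H : H ⟶ H).app X) Z = 𝟙 (Z.map H.obj) := seqOf_id H.obj Z
  rw [h3, F.E.map_id, Category.comp_id] at h2
  exact ((Category.id_comp _).symm.trans h2).symm

end Oplax

/-! ### The 2-functors `Ψ` and `Ψ'`. -/

theorem twoFullyFaithful_psi : TwoFullyFaithful Psi.{w, v, u} := fun X Y => by
  refine ⟨⟨fun {f g} α => ?_⟩, ⟨fun {f g α β} h => ?_⟩, fun f g h => ?_, fun f => ?_⟩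
  · let α' : GMnd.Hom₂ _ _ := α
    -- The underlying natural transformation is unchanged, so fullness only asks that it be
    -- monoidal.
    exact ⟨DistMult.Hom₂.mk α'.φ (LaxStr.isMonoidal_of_isCell α'.cell), rfl⟩
  · exact DistMult.Hom₂.ext (congrArg GMnd.Hom₂.φ h)
  · obtain ⟨H, L⟩ := f
    obtain ⟨K, M⟩ := g
    -- The underlying functor is part of the image, so it is recovered first; injectivity of `Γ`
    -- over this fixed functor then applies.
    obtain ⟨rfl, h'⟩ := GMnd.Hom.mk.inj h
    exact congrArg (DistMult.Hom.mk H) ((LaxStr.gamma_bijective _ _ H).1 (eq_of_heq h'))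
  · obtain ⟨H, M⟩ := f
    obtain ⟨L, rfl⟩ := (LaxStr.gamma_bijective X.dist Y.dist H).2 M
    exact ⟨DistMult.Hom.mk H L, rfl⟩

theorem twoFullyFaithful_psiOp : TwoFullyFaithful PsiOp.{w, v, u} := fun X Y => by
  refine ⟨⟨fun {f g} α => ?_⟩, ⟨fun {f g α β} h => ?_⟩, fun f g h => ?_, fun f => ?_⟩
  · let α' : GOpMnd.Hom₂ _ _ := α
    exact ⟨OpDistMult.Hom₂.mk α'.φ (OplaxStr.isMonoidal_of_isCell α'.cell), rfl⟩
  · exact OpDistMult.Hom₂.ext (congrArg GOpMnd.Hom₂.φ h)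
  · obtain ⟨H, hH, L⟩ := f
    obtain ⟨K, hK, M⟩ := g
    -- Preservation of coproducts is a proposition, so it imposes no further equation.
    obtain ⟨rfl, h'⟩ := GOpMnd.Hom.mk.inj h
    exact congrArg (OpDistMult.Hom.mk H hH) ((OplaxStr.gamma_bijective _ _ hH).1 (eq_of_heq h'))
  · obtain ⟨H, hH, M⟩ := f
    obtain ⟨L, rfl⟩ := (OplaxStr.gamma_bijective X.dist Y.dist hH).2 M
    exact ⟨OpDistMult.Hom.mk H hH L, rfl⟩

end EnrichedGraphs

open EnrichedGraphs
theorem mainTheorem11 :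
    TwoFullyFaithful Psi.{w, v, u} ∧ TwoFullyFaithful PsiOp.{w, v, u} ∧
      (∀ (X Y : DistMult.{w, v, u}) (H : X.V ⥤ Y.V),
        Function.Bijective (fun L : LaxStr X.E Y.E H => L.gamma X.dist Y.dist)) ∧
      (∀ (X Y : OpDistMult.{w, v, u}) (H : X.V ⥤ Y.V)
        (hH : ∀ J : Type w, PreservesColimitsOfShape (Discrete J) H),
        Function.Bijective (fun L : OplaxStr X.E Y.E H => L.gamma hH X.dist Y.dist)) :=
  ⟨twoFullyFaithful_psi, twoFullyFaithful_psiOp,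
    fun X Y H => LaxStr.gamma_bijective X.dist Y.dist H,
    fun X Y _ hH => OplaxStr.gamma_bijective X.dist Y.dist hH⟩
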